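/- Let $T=\mathrm{conv}(x_1,x_2,x_3,x_4)\subset\mathbb R^3$ be a non-degenerate tetrahedron with barycentric coordinates $\lambda_1,\dots,\lambda_4$ and Bernstein polynomials $B^n_\alpha=\frac{n!}{\alpha!}\lambda^\alpha$, $|\alpha|=n$. Put $\omega_{ij}=\lambda_i\nabla\lambda_j-\lambda_j\nabla\lambda_i$ and $\chi_\ell=\lambda_i\nabla\lambda_j\times\nabla\lambda_k-\lambda_j\nabla\lambda_i\times\nabla\lambda_k+\lambda_k\nabla\lambda_i\times\nabla\lambda_j$, where $i<j<k$ and $\{i,j,k,\ell\}=\{1,2,3,4\}$. Let $(i_1,i_2,i_3,i_4)$ be a permutation of $(1,2,3,4)$, let $F=\mathrm{conv}(x_{i_1},x_{i_2},x_{i_3})$ be the corresponding face, with outward unit normal $n_F$, and put $I_F=\{i_1,i_2,i_3\}$. For $\alpha$ with $|\alpha|=n$ and $\alpha_{i_4}=0$ let $$\Phi^n_\alpha=(n+1)B^n_\alpha\,(\alpha_{i_1}\omega_{i_2i_3}+\alpha_{i_2}\omega_{i_3i_1}+\alpha_{i_3}\omega_{i_1i_2}).$$ Let $J_n$ be the set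 of $\alpha$ with $|\alpha|=n$ whose support is either a two-element subset of $I_F$ or $I_F$ itself (the edge and face bubble indices), and let $K_n$ be the set of $\alpha$ with $|\alpha|=n$, $\alpha_{i_4}=0$, with one arbitrary index removed. Let $\mathrm{tr}_F$ be restriction to $F$, let $\mathrm{tr}_{\tau,F}$ be restriction to $F$ followed by orthogonal projection onto the plane of $F$, and let $\mathrm{tr}_{n,F}(v)=v|_F\cdot n_F$. Let $\mathbb P_n(F)$ be the polynomials of degree at most $n$ on $F$, let $\mathbb P_n(F)^2$ be the tangential vector fields on $F$ with components in $\mathbb P_n(F)$, and let $x\times\widetilde{\mathbb P}_n(F)$ be the space of fields $(x_2q,-x_1q)$ with $q$ a homogeneous polynomial of degree $n$, where $(x_1,x_2)$ are Cartesian coordinates in the plane of $F$ with an arbitrary origin in that plane. Then: 1. for $n\ge1$, the traces $\mathrm{tr}_F$ of $\{\lambda_k: k\in I_F\}\cup\{B^n_\alpha:\alpha\in J_n\}$ form a basis of $\mathbb P_n(F)$; 2. for $n\ge0$, the sum $\mathbb P_n(F)^2\oplus x\times\widetilde{\mathbb P}_n(F)$ is direct, and the traces $\mathrm{tr}_{\tau,F}$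 of $\{\omega_{k\ell}: k<\ell,\ k,\ell\in I_F\}\cup\{\nabla B^{n+1}_\alpha:\alpha\in J_{n+1}\}\cup\{\Phi^n_\alpha:\alpha\in K_n\}$ form a basis of it; 3. for $n\ge1$, the traces $\mathrm{tr}_{\tau,F}$ of $\{\omega_{k\ell}: k<\ell,\ k,\ell\in I_F\}\cup\{\nabla B^{n+1}_\alpha:\alpha\in J_{n+1}\}\cup\{\Phi^{n-1}_\alpha:\alpha\in K_{n-1}\}$ form a basis of $\mathbb P_n(F)^2$; 4. for $n\ge0$, the traces $\mathrm{tr}_{n,F}$ of $\{\chi_{i_4}\}\cup\{\nabla\times\Phi^n_\alpha:\alpha\in K_n\}$ form a basis of $\mathbb P_n(F)$. Similarly, let $F=\mathrm{conv}(y_1,y_2,y_3)\subset\mathbb R^3$ be a non-degenerate triangle with barycentric coordinates $\lambda^F_k$, Bernstein polynomials $B^{F,n}_\alpha$, surface gradient $\nabla_F$ and $\omega^F_{ij}=\lambda^F_i\nabla_F\lambda^F_j-\lambda^F_j\nabla_F\lambda^F_i$. Let $E=\mathrm{conv}(y_i,y_j)$, $i\ne j$, be an edge with unit tangent $t_E$,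 and let $\mathring J_n$ be the set of $\alpha$ with $|\alpha|=n$ and support $\{i,j\}$. Then: 5. for $n\ge1$, the restrictions to $E$ of $\lambda_i^F$, $\lambda_j^F$ and $B^{F,n}_\alpha$, $\alpha\in\mathring J_n$, form a basis of $\mathbb P_n(E)$; 6. for $n\ge0$, the tangential components $v|_E\cdot t_E$ of $v=\omega^F_{ij}$ and of $v=\nabla_F B^{F,n+1}_\alpha$, $\alpha\in\mathring J_{n+1}$, form a basis of $\mathbb P_n(E)$. -/

import Mathlib

namespace BernsteinBezier

/-- Three-dimensional Euclidean space. -/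
abbrev E3 : Type := EuclideanSpace ℝ (Fin 3)

section Spaces

/-- The family `v` is a basis of the space `S`. -/
def IsBasisOf {ι M : Type*} [AddCommGroup M] [Module ℝ M] (v : ι → M) (S : Submodule ℝ M) : Prop :=
  LinearIndependent ℝ v ∧ Submodule.span ℝ (Set.range v) = S

/-- The vector product of `ℝ³`. -/
noncomputable def cross (u v : E3) : E3 :=
  !₂[u 1 * v 2 - u 2 * v 1, u 2 * v 0 - u 0 * v 2, u 0 * v 1 - u 1 * v 0]

/-- `P_n(S)`: the restrictions to `S` of the polynomials of total degree at most `n`. -/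
noncomputable def polySpace (n : ℕ) (S : Set E3) : Submodule ℝ (S → ℝ) :=
  (MvPolynomial.restrictTotalDegree (Fin 3) ℝ n).map
    (LinearMap.pi fun p : S => (MvPolynomial.aeval fun i => p.1 i).toLinearMap)

/-- `P_n(F)²` for a planar set `F`: the vector fields on `F` that are tangent to the plane of `F`
and whose components are polynomials of degree at most `n`. -/
def tangentPolySpace (n : ℕ) (F : Set E3) : Submodule ℝ (F → E3) where
  carrier := {v | (∀ p, v p ∈ vectorSpan ℝ F) ∧ ∀ i, (fun p => v p i) ∈ polySpace n F}
  add_mem' := fun hu hv =>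
    ⟨fun p => add_mem (hu.1 p) (hv.1 p), fun i => (polySpace n F).add_mem (hu.2 i) (hv.2 i)⟩
  zero_mem' := ⟨fun _ => zero_mem _, fun _ => (polySpace n F).zero_mem⟩
  smul_mem' := fun c _ hv =>
    ⟨fun p => Submodule.smul_mem _ c (hv.1 p), fun i => (polySpace n F).smul_mem c (hv.2 i)⟩

/-- `x × P̃_n(F)` for a set `F` in the plane through `o` with unit normal `ν`: the tangential fields
`q(x - o) ((x - o) × ν)` where `q` is a homogeneous polynomial of degree `n`. In Cartesian
coordinates `(x₁, x₂)` of the oriented plane with origin `o` this is the field `(x₂ q, - x₁ q)`. -/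
noncomputable def rotHomogSpace (n : ℕ) (F : Set E3) (o ν : E3) : Submodule ℝ (F → E3) :=
  (MvPolynomial.homogeneousSubmodule (Fin 3) ℝ n).map
    (LinearMap.pi fun p : F =>
      (MvPolynomial.aeval fun i => (p.1 - o) i).toLinearMap.smulRight (cross (p.1 - o) ν))

end Spaces

section Differential

/-- The curl of a vector field on `ℝ³`. -/
noncomputable def curl (v : E3 → E3) (p : E3) : E3 :=
  let d : Fin 3 → Fin 3 → ℝ := fun j i => fderiv ℝ v p (EuclideanSpace.single j 1) i
  !₂[d 1 2 - d 2 1, d 2 0 - d 0 2, d 0 1 - d 1 0]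

/-- The surface gradient at `p` of a function on the affine hull of `F`: the gradient at `0` of
`w ↦ f (p + w)` on the inner product space of the directions of that affine hull. -/
noncomputable def surfaceGradient (F : Set E3) (f : E3 → ℝ) (p : E3) : E3 :=
  (gradient (fun w : vectorSpan ℝ F => f (p + w)) 0 : vectorSpan ℝ F)

end Differential

section Traces

/-- The scalar trace on `S`. -/
def scalarTrace (S : Set E3) (f : E3 → ℝ) : S → ℝ := fun p => f p

/-- The tangential trace on a face `F`: the orthogonal projection of the field onto the plane of
`F`. It sends `φ ∇λ` to `φ|_F` times the surface gradient of `λ|_F`. -/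
noncomputable def tangentialTrace (F : Set E3) (v : E3 → E3) : F → E3 :=
  fun p => (vectorSpan ℝ F).starProjection (v p)

/-- The normal trace on a face `F` with unit normal `ν`, and the (scalar) tangential trace on an
edge with unit tangent `ν`: the component of the field along `ν`. -/
noncomputable def componentTrace (S : Set E3) (ν : E3) (v : E3 → E3) : S → ℝ :=
  fun p => inner ℝ (v p) ν

end Traces

section Bernstein

variable {ι : Type*} [Fintype ι]

open Classical in
/-- The barycentric coordinates with respect to the simplex with vertices `y`: the `i`-th weight in
`p = ∑ k, w k • y k`, `∑ k, w k = 1` (for `p` in the affine hull of the vertices). -/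
noncomputable def bary (y : ι → E3) (i : ι) (p : E3) : ℝ :=
  if h : ∃ w : ι → ℝ, ∑ k, w k = 1 ∧ p = ∑ k, w k • y k then h.choose i else 0

/-- The Bernstein polynomial with multi-index `α`, of degree `∑ i, α i`. -/
noncomputable def bernstein (y : ι → E3) (α : ι → ℕ) (p : E3) : ℝ :=
  (Nat.multinomial Finset.univ α : ℝ) * ∏ k, bary y k p ^ α k

/-- Multi-indices of order `n` whose domain points lie in the relative interior of the subsimplex
with vertex set `s` (the bubble indices of an edge or of a face). -/
abbrev BubbleIndex (n : ℕ) (s : Finset ι) : Type _ :=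
  {α : ι → ℕ // ∑ i, α i = n ∧ ∀ i, 0 < α i ↔ i ∈ s}

/-- Multi-indices of order `n` whose domain points lie on the subsimplex with vertex set `s`. -/
abbrev ClosedIndex (n : ℕ) (s : Finset ι) : Type _ :=
  {α : ι → ℕ // ∑ i, α i = n ∧ ∀ i, i ∉ s → α i = 0}

/-- The edges of the subsimplex with vertex set `s`. -/
abbrev EdgeOf (s : Finset ι) : Type _ := {e : Finset ι // e ⊆ s ∧ e.card = 2}

/-- The edge bubble indices (over all edges) and the bubble indices of the face `s`. -/
abbrev EdgeFaceIndex (n : ℕ) (s : Finset ι) : Type _ :=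
  (Σ e : EdgeOf s, BubbleIndex n e.1) ⊕ BubbleIndex n s

/-- The multi-index that underlies an edge or face bubble index. -/
def EdgeFaceIndex.toMulti {n : ℕ} {s : Finset ι} : EdgeFaceIndex n s → ι → ℕ :=
  Sum.elim (fun q => q.2.1) (fun α => α.1)

end Bernstein

section Tetrahedron

/-- The lowest-order edge element `λ_i ∇λ_j - λ_j ∇λ_i` of the tetrahedron with vertices `x`. -/
noncomputable def edgeElement (x : Fin 4 → E3) (i j : Fin 4) (p : E3) : E3 :=
  bary x i p • gradient (bary x j) p - bary x j p • gradient (bary x i) p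

/-- The lowest-order face element of the tetrahedron with vertices `x` that belongs to the face
opposite to the vertex `l`; here `i < j < k` are the other three indices. -/
noncomputable def faceElement (x : Fin 4 → E3) (l : Fin 4) (p : E3) : E3 :=
  let i := l.succAbove 0
  let j := l.succAbove 1
  let k := l.succAbove 2
  bary x i p • cross (gradient (bary x j) p) (gradient (bary x k) p)
    - bary x j p • cross (gradient (bary x i) p) (gradient (bary x k) p)
    + bary x k p • cross (gradient (bary x i) p) (gradient (bary x j) p)

/-- The vertex set of the face `conv(x_{i₁}, x_{i₂}, x_{i₃})`, where `(i₁, i₂, i₃, i₄)` is the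
permutation `σ` of the four indices. -/
def faceVertices (σ : Equiv.Perm (Fin 4)) : Finset (Fin 4) := {σ 0, σ 1, σ 2}

/-- The face `conv(x_{i₁}, x_{i₂}, x_{i₃})` of the tetrahedron with vertices `x`. -/
def face (x : Fin 4 → E3) (σ : Equiv.Perm (Fin 4)) : Set E3 :=
  convexHull ℝ {x (σ 0), x (σ 1), x (σ 2)}

/-- `ν` is the outward unit normal of the face `conv(x_{i₁}, x_{i₂}, x_{i₃})`. -/
def IsOutwardUnitNormal (x : Fin 4 → E3) (σ : Equiv.Perm (Fin 4)) (ν : E3) : Prop :=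
  ‖ν‖ = 1 ∧ (∀ w ∈ vectorSpan ℝ (face x σ), inner ℝ ν w = 0) ∧
    inner ℝ ν (x (σ 3) - x (σ 0)) < 0

/-- The non-gradient `H(curl)` face bubble of degree `n` with multi-index `α`. -/
noncomputable def faceBubble (x : Fin 4 → E3) (σ : Equiv.Perm (Fin 4)) (n : ℕ) (α : Fin 4 → ℕ)
    (p : E3) : E3 :=
  (((n : ℝ) + 1) * bernstein x α p) •
    ((α (σ 0) : ℝ) • edgeElement x (σ 1) (σ 2) p + (α (σ 1) : ℝ) • edgeElement x (σ 2) (σ 0) p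
      + (α (σ 2) : ℝ) • edgeElement x (σ 0) (σ 1) p)

/-- The pairs `i < j` of vertex indices in `s`. -/
abbrev PairIndex (s : Finset (Fin 4)) : Type := {q : Fin 4 × Fin 4 // q.1 ∈ s ∧ q.2 ∈ s ∧ q.1 < q.2}

/-- The `H¹` basis functions of degree `n` that belong to a face: the `λ_k`, and the edge and face
bubbles. -/
noncomputable def h1FaceFamily (x : Fin 4 → E3) (σ : Equiv.Perm (Fin 4)) (n : ℕ) :
    {k // k ∈ faceVertices σ} ⊕ EdgeFaceIndex n (faceVertices σ) → E3 → ℝ :=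
  Sum.elim (fun k => bary x k.1) (fun α => bernstein x α.toMulti)

/-- The `H(curl)` basis functions that belong to a face: the lowest-order edge elements, the
gradients of the edge and face bubbles of degree `n + 1`, and the non-gradient face bubbles of
degree `m` with the single index `β` left out. -/
noncomputable def hcurlFaceFamily (x : Fin 4 → E3) (σ : Equiv.Perm (Fin 4)) (n m : ℕ)
    (β : ClosedIndex m (faceVertices σ)) :
    PairIndex (faceVertices σ) ⊕ EdgeFaceIndex (n + 1) (faceVertices σ) ⊕
      {α : ClosedIndex m (faceVertices σ) // α ≠ β} → E3 → E3 :=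
  Sum.elim (fun q => edgeElement x q.1.1 q.1.2)
    (Sum.elim (fun α => gradient (bernstein x α.toMulti)) (fun α => faceBubble x σ m α.1.1))

/-- The `H(div)` basis functions that belong to a face: its lowest-order face element, and the curls
of the non-gradient face bubbles of degree `n` with the single index `β` left out. -/
noncomputable def hdivFaceFamily (x : Fin 4 → E3) (σ : Equiv.Perm (Fin 4)) (n : ℕ)
    (β : ClosedIndex n (faceVertices σ)) :
    Unit ⊕ {α : ClosedIndex n (faceVertices σ) // α ≠ β} → E3 → E3 :=
  Sum.elim (fun _ => faceElement x (σ 3)) (fun α => curl (faceBubble x σ n α.1.1))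

end Tetrahedron

section Triangle

/-- The closed triangle with vertices `y`. -/
def triangle (y : Fin 3 → E3) : Set E3 := convexHull ℝ (Set.range y)

/-- The lowest-order edge element of the triangle with vertices `y`, with surface gradients. -/
noncomputable def triEdgeElement (y : Fin 3 → E3) (i j : Fin 3) (p : E3) : E3 :=
  bary y i p • surfaceGradient (triangle y) (bary y j) p
    - bary y j p • surfaceGradient (triangle y) (bary y i) p

/-- The indices of the end points of the edge `conv(y_{j₁}, y_{j₂})`, where `(j₁, j₂, j₃)` is the
permutation `τ` of the three indices. -/
def edgeVertices (τ : Equiv.Perm (Fin 3)) : Finset (Fin 3) := {τ 0, τ 1}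

/-- The edge `conv(y_{j₁}, y_{j₂})` of the triangle with vertices `y`. -/
def edge (y : Fin 3 → E3) (τ : Equiv.Perm (Fin 3)) : Set E3 := convexHull ℝ {y (τ 0), y (τ 1)}

/-- The unit tangent vector of the edge `conv(y_{j₁}, y_{j₂})`. -/
noncomputable def edgeTangent (y : Fin 3 → E3) (τ : Equiv.Perm (Fin 3)) : E3 :=
  ‖y (τ 1) - y (τ 0)‖⁻¹ • (y (τ 1) - y (τ 0))

/-- The `H¹` basis functions of degree `n` on the triangle that belong to an edge: the two
barycentric coordinates, and the edge bubbles. -/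
noncomputable def h1EdgeFamily (y : Fin 3 → E3) (τ : Equiv.Perm (Fin 3)) (n : ℕ) :
    {k // k ∈ edgeVertices τ} ⊕ BubbleIndex n (edgeVertices τ) → E3 → ℝ :=
  Sum.elim (fun k => bary y k.1) (fun α => bernstein y α.1)

/-- The `H(curl)` basis functions on the triangle that belong to an edge: the lowest-order edge
element, and the surface gradients of the edge bubbles of degree `n + 1`. -/
noncomputable def hcurlEdgeFamily (y : Fin 3 → E3) (τ : Equiv.Perm (Fin 3)) (n : ℕ) :
    Unit ⊕ BubbleIndex (n + 1) (edgeVertices τ) → E3 → E3 :=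
  Sum.elim (fun _ => triEdgeElement y (τ 0) (τ 1))
    (fun α => surfaceGradient (triangle y) (bernstein y α.1))

end Triangle

end BernsteinBezier

open BernsteinBezier

namespace BernsteinBezier

/-! ### Bases of subspaces: images, cardinality, rescaling -/

section LinearAlgebra

variable {ι κ M N : Type*} [AddCommGroup M] [Module ℝ M] [AddCommGroup N] [Module ℝ N]

/-! All traces can be computed in coordinates on the plane of the face. As coordinates take the
differences of barycentric coordinates to their values at an origin `o`: on the face the `λ_k`
become polynomials of degree at most one, and those of vertices off the face become zero.
Restriction becomes substitution; the tangential trace of `∑ P_j(λ) ∇λ_j` becomes the pulled-back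
form `∑ P_j dλ_j` (`tangentialTrace_formField`); the normal trace of its curl becomes the planar
rotation of that form, up to a nonzero area factor (`componentTrace_curl_formField`). The maps from
polynomials to traces, `chartMap` and `tangentMap`, are injective, so it suffices to find bases of
polynomial spaces.

Scalars: the Bernstein polynomials form a basis, and those of the vertices may be exchanged for the
`λ_k`, because evaluation at the vertices separates the `λ_k` from all bubbles
(`isBasisOf_bubbles`).

Rotations: in the Bernstein basis the rotation of `∑ u_α Φ_α` is, up to a factor, a weighted graph
Laplacian applied to `u`, two indices being neighbours if they are `γ + e_i` and `γ + e_j`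
(`sum_rot_bubbleForm`). The graph is connected, so by the energy identity only constant `u` are
annihilated; the coefficients of the result always sum to zero, whereas those of a nonzero constant
polynomial are all equal and nonzero. Hence the rotations of all bubbles but one, together with a
constant, are independent, and their number is the dimension (`isBasisOf_rot`).

Tangential fields: the bubbles and one edge element give every rotation of degree at most `m`, and a
rotation-free polynomial field is a gradient. Combinations of edge elements with coefficient sum
zero are exactly the gradients of the `λ_k` and their combinations, so with the gradients of bubbles
they exhaust the rotation-free part. `isBasisOf_fields` states this for an abstract space; `m = n`
gives the sum with the rotated homogeneous fields, and `m = n - 1` gives the full polynomial fields.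
On an edge, integration in one variable plays the same role (`isBasisOf_pderiv`). -/

theorem IsBasisOf.mem {v : ι → M} {S : Submodule ℝ M} (h : IsBasisOf v S) (i : ι) : v i ∈ S :=
  h.2 ▸ Submodule.subset_span ⟨i, rfl⟩

theorem IsBasisOf.map {v : ι → M} {S : Submodule ℝ M} (h : IsBasisOf v S) {f : M →ₗ[ℝ] N}
    (hf : Function.Injective f) : IsBasisOf (fun i => f (v i)) (S.map f) := by
  refine ⟨h.1.map' f (LinearMap.ker_eq_bot.2 hf), ?_⟩
  rw [← h.2, Submodule.map_span, ← Set.range_comp]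
  rfl

/-- A basis has functionals with prescribed values. -/
theorem IsBasisOf.exists_functional {v : ι → M} {S : Submodule ℝ M} (h : IsBasisOf v S)
    (f : ι → ℝ) : ∃ φ : M →ₗ[ℝ] ℝ, ∀ i, φ (v i) = f i := by
  obtain ⟨φ, hφ⟩ := ((Module.Basis.span h.1).constr ℝ f).exists_extend
  refine ⟨φ, fun i => ?_⟩
  have h1 := congrArg (fun g => g (Module.Basis.span h.1 i)) hφ
  simp only [LinearMap.comp_apply, Submodule.subtype_apply, Module.Basis.constr_basis] at h1
  rw [← h1, Module.Basis.span_apply]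

/-- A linearly independent family in `S` of the size of a finite basis of `S` is a basis of `S`. -/
theorem IsBasisOf.of_card [Finite ι] {v : ι → M} {S : Submodule ℝ M} (h : IsBasisOf v S)
    {w : κ → M} (hw : LinearIndependent ℝ w) (hmem : ∀ k, w k ∈ S)
    (hcard : Nat.card κ = Nat.card ι) (hfin : Finite κ) : IsBasisOf w S := by
  cases nonempty_fintype ι
  cases nonempty_fintype κ
  refine ⟨hw, ?_⟩
  have : FiniteDimensional ℝ S := h.2 ▸ FiniteDimensional.span_of_finite ℝ (Set.finite_range v)
  refine Submodule.eq_of_le_of_finrank_eq (Submodule.span_le.2 ?_) ?_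
  · rintro _ ⟨k, rfl⟩
    exact hmem k
  · rw [finrank_span_eq_card hw, ← h.2, finrank_span_eq_card h.1, ← Nat.card_eq_fintype_card,
      ← Nat.card_eq_fintype_card, hcard]

/-- Bases may be reindexed and rescaled. -/
theorem IsBasisOf.reindex_smul {v : ι → M} {S : Submodule ℝ M} (h : IsBasisOf v S) (e : κ ≃ ι)
    (c : κ → ℝ) (hc : ∀ k, c k ≠ 0) {w : κ → M} (hw : ∀ k, w k = c k • v (e k)) :
    IsBasisOf w S := by
  have hw' : w = (fun k => Units.mk0 (c k) (hc k)) • (v ∘ e) := by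
    funext k
    rw [hw k]
    rfl
  refine ⟨hw' ▸ (h.1.comp e e.injective).units_smul _, le_antisymm ?_ ?_⟩
  · rw [Submodule.span_le]
    rintro _ ⟨k, rfl⟩
    rw [hw k]
    exact S.smul_mem _ (h.mem _)
  · rw [← h.2, Submodule.span_le]
    rintro _ ⟨i, rfl⟩
    have : v i = (c (e.symm i))⁻¹ • w (e.symm i) := by
      rw [hw, smul_smul, inv_mul_cancel₀ (hc _), one_smul, e.apply_symm_apply]
    rw [this]
    exact Submodule.smul_mem _ _ (Submodule.subset_span ⟨_, rfl⟩)

end LinearAlgebra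

/-! ### Degrees and chain rules for polynomials -/

section Polynomials

open MvPolynomial

variable {σ τ : Type*}

theorem totalDegree_aeval_le {f : σ → MvPolynomial τ ℝ} (hf : ∀ i, (f i).totalDegree ≤ 1)
    (p : MvPolynomial σ ℝ) : (aeval f p).totalDegree ≤ p.totalDegree := by
  rw [aeval_def, eval₂_eq]
  refine totalDegree_finsetSum_le fun m hm => ?_
  refine (totalDegree_mul _ _).trans ?_
  rw [algebraMap_eq, totalDegree_C, zero_add]
  refine (totalDegree_finsetProd _ _).trans ?_
  calc ∑ i ∈ m.support, (f i ^ m i).totalDegree ≤ ∑ i ∈ m.support, m i := by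
        refine Finset.sum_le_sum fun i _ => (totalDegree_pow _ _).trans ?_
        nlinarith [hf i]
    _ ≤ p.totalDegree := le_totalDegree hm

theorem totalDegree_pderiv_le {n : ℕ} {p : MvPolynomial σ ℝ} (hp : p.totalDegree ≤ n + 1) (i : σ) :
    (pderiv i p).totalDegree ≤ n := by
  classical
  refine Finset.sup_le fun m hm => ?_
  have h1 : m + Finsupp.single i 1 ∈ p.support := by
    rw [mem_support_iff, coeff_pderiv] at hm
    exact mem_support_iff.2 (left_ne_zero_of_mul hm)
  have h2 := (le_totalDegree h1).trans hp
  rw [Finsupp.sum_add_index' (fun _ => rfl) (fun _ _ _ => rfl), Finsupp.sum_single_index rfl] at h2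
  omega

theorem pderiv_aeval [Fintype σ] (f : σ → MvPolynomial τ ℝ) (i : τ) (p : MvPolynomial σ ℝ) :
    pderiv i (aeval f p) = ∑ k, aeval f (pderiv k p) * pderiv i (f k) := by
  classical
  induction p using MvPolynomial.induction_on with
  | C a => simp [← algebraMap_eq]
  | add p q hp hq => simp only [map_add, hp, hq, add_mul, Finset.sum_add_distrib]
  | mul_X p j hp =>
    simp only [map_mul, aeval_X, Derivation.leibniz, hp, smul_eq_mul, pderiv_X, map_add, add_mul,
      Finset.sum_add_distrib, Finset.mul_sum]
    congr 1
    · simp [Pi.single_apply, apply_ite]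
    · exact Finset.sum_congr rfl fun k _ => by ring

theorem hasFDerivAt_eval {V : Type*} [NormedAddCommGroup V] [NormedSpace ℝ V] [Fintype σ]
    {l : σ → V → ℝ} {l' : σ → V →L[ℝ] ℝ} {p : V} (h : ∀ k, HasFDerivAt (l k) (l' k) p)
    (P : MvPolynomial σ ℝ) :
    HasFDerivAt (fun q => eval (fun k => l k q) P)
      (∑ k, eval (fun k => l k p) (pderiv k P) • l' k) p := by
  classical
  induction P using MvPolynomial.induction_on with
  | C a => simpa using hasFDerivAt_const a p
  | add P Q hP hQ => 
    simp only [map_add, add_smul, Finset.sum_add_distrib]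
    exact hP.add hQ
  | mul_X P j hP =>
    have := hP.mul (h j)
    refine (this.congr_fderiv ?_).congr_of_eventuallyEq (Filter.Eventually.of_forall fun q => ?_)
    swap
    · simp
    simp only [Derivation.leibniz, smul_eq_mul, pderiv_X, map_add, map_mul, eval_X, add_smul,
      Finset.sum_add_distrib, Finset.smul_sum, smul_smul]
    congr 1
    simp [Pi.single_apply, apply_ite]

end Polynomials

/-! ### Bernstein polynomials and the exchange of the vertex functions -/

section BernsteinBasis

open MvPolynomial

variable {ι : Type*} [Fintype ι] {d : ℕ}

/-- The Bernstein polynomial as a form in the barycentric coordinates. -/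
noncomputable def bernsteinPoly (α : ι → ℕ) : MvPolynomial ι ℝ :=
  C (Nat.multinomial Finset.univ α : ℝ) * ∏ k, X k ^ α k

theorem eval_bernsteinPoly (w : ι → ℝ) (α : ι → ℕ) :
    eval w (bernsteinPoly α) = (Nat.multinomial Finset.univ α : ℝ) * ∏ k, w k ^ α k := by
  simp [bernsteinPoly]

theorem bernstein_eq_eval (y : ι → E3) (α : ι → ℕ) (p : E3) :
    bernstein y α p = eval (fun k => bary y k p) (bernsteinPoly α) := by
  rw [eval_bernsteinPoly, bernstein]

theorem bernsteinPoly_eq_monomial (α : ι → ℕ) :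
    bernsteinPoly α =
      monomial (Finsupp.equivFunOnFinite.symm α) (Nat.multinomial Finset.univ α : ℝ) := by
  rw [monomial_eq, Finsupp.prod_fintype _ _ fun _ => pow_zero _]
  rfl

theorem multinomial_ne_zero (α : ι → ℕ) : (Nat.multinomial Finset.univ α : ℝ) ≠ 0 :=
  Nat.cast_ne_zero.2 (Nat.multinomial_pos _ _).ne'

theorem isHomogeneous_bernsteinPoly (α : ι → ℕ) : (bernsteinPoly α).IsHomogeneous (∑ i, α i) := by
  rw [bernsteinPoly_eq_monomial]
  refine isHomogeneous_monomial _ ?_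
  rw [Finsupp.degree_eq_sum]
  rfl

instance finite_closedIndex (n : ℕ) (s : Finset ι) : Finite (ClosedIndex n s) := by
  classical
  refine Set.Finite.subset (Finset.piAntidiag (Finset.univ : Finset ι) n).finite_toSet fun α hα => ?_
  simpa using hα.1

/-- `l` are the barycentric coordinates with respect to a simplex in `ℝᵈ` with vertex set `s`. -/
structure IsBaryPoly (s : Finset ι) (l : ι → MvPolynomial (Fin d) ℝ) : Prop where
  totalDegree_le : ∀ k, (l k).totalDegree ≤ 1
  sum_eq_one : ∑ k, l k = 1
  eq_zero : ∀ k, k ∉ s → l k = 0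
  exists_eval : ∀ w : ι → ℝ, ∑ k, w k = 1 → (∀ k, k ∉ s → w k = 0) →
    ∃ r : Fin d → ℝ, ∀ k, eval r (l k) = w k
  exists_X : ∀ i, ∃ a : ι → ℝ, X i = ∑ k, a k • l k

variable {s : Finset ι} {l : ι → MvPolynomial (Fin d) ℝ}

theorem IsBaryPoly.sum_mem (h : IsBaryPoly s l) : ∑ k ∈ s, l k = 1 := by
  rw [← h.sum_eq_one]
  exact Finset.sum_subset s.subset_univ fun k _ hk => h.eq_zero k hk

theorem IsBaryPoly.nonempty (h : IsBaryPoly s l) : s.Nonempty := by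
  rw [Finset.nonempty_iff_ne_empty]
  rintro rfl
  simpa using h.sum_mem

/-- A relation on the simplex extends by homogeneity to the open positive orthant, where only the
zero polynomial vanishes. Coordinates outside `s` are irrelevant, since the indices vanish there. -/
theorem IsBaryPoly.linearIndependent_bernstein (h : IsBaryPoly s l) (n : ℕ) :
    LinearIndependent ℝ (fun α : ClosedIndex n s => aeval l (bernsteinPoly α.1)) := by
  classical
  have : Fintype (ClosedIndex n s) := Fintype.ofFinite _
  rw [Fintype.linearIndependent_iff]
  intro c hc
  set Q : MvPolynomial ι ℝ := ∑ α : ClosedIndex n s, c α • bernsteinPoly α.1 with hQ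
  have hlQ : aeval l Q = 0 := by simpa [hQ] using hc
  have hQ0 : Q = 0 := by
    refine funext_set (fun _ => Set.Ioi (0 : ℝ)) (fun _ => Set.Ioi_infinite 0) fun w hw => ?_
    have hw0 : ∀ k, 0 < w k := fun k => hw k trivial
    set t : ℝ := ∑ k ∈ s, w k with ht
    have ht0 : 0 < t := Finset.sum_pos (fun k _ => hw0 k) h.nonempty
    obtain ⟨r, hr⟩ := h.exists_eval (fun k => if k ∈ s then w k / t else 0)
      (by simp [← Finset.sum_div, ← ht, ht0.ne']) (fun k hk => by simp [hk])
    have h0 : eval (fun k => if k ∈ s then w k / t else 0) Q = 0 := by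
      have := congrArg (eval r) hlQ
      rw [map_zero, ← aeval_eq_eval, ← AlgHom.comp_apply, comp_aeval] at this
      simpa [hr, aeval_eq_eval] using this
    have hscale : eval w Q = t ^ n * eval (fun k => if k ∈ s then w k / t else 0) Q := by
      simp only [hQ, map_sum, smul_eval, Finset.mul_sum, eval_bernsteinPoly]
      refine Finset.sum_congr rfl fun α _ => ?_
      have : ∏ k, w k ^ α.1 k = t ^ n * ∏ k, (if k ∈ s then w k / t else 0) ^ α.1 k := by
        have htn : t ^ n = ∏ k, t ^ α.1 k := by rw [Finset.prod_pow_eq_pow_sum, α.2.1]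
        rw [htn, ← Finset.prod_mul_distrib]
        refine Finset.prod_congr rfl fun k _ => ?_
        by_cases hk : k ∈ s
        · rw [if_pos hk, ← mul_pow, mul_div_cancel₀ _ ht0.ne']
        · simp [α.2.2 k hk]
      rw [this]
      ring
    rw [hscale, h0, mul_zero, map_zero]
  intro α
  have hcoeff := congrArg (coeff (Finsupp.equivFunOnFinite.symm α.1)) hQ0
  simp only [hQ, coeff_sum, coeff_smul, bernsteinPoly_eq_monomial, coeff_monomial,
    EmbeddingLike.apply_eq_iff_eq, coeff_zero, smul_eq_mul] at hcoeff
  rw [Finset.sum_eq_single α (fun β _ hβ => by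
    rw [if_neg fun he => hβ (Subtype.ext he), mul_zero]) (fun hα => absurd (Finset.mem_univ _) hα),
    if_pos rfl] at hcoeff
  exact (mul_eq_zero.1 hcoeff).resolve_right (multinomial_ne_zero _)

/-- A monomial that involves a vertex outside `s` is sent to zero; any other one is a multiple of a
Bernstein polynomial. -/
theorem IsBaryPoly.aeval_mem_span (h : IsBaryPoly s l) {n : ℕ} {Q : MvPolynomial ι ℝ}
    (hQ : Q.IsHomogeneous n) :
    aeval l Q ∈ Submodule.span ℝ
      (Set.range fun α : ClosedIndex n s => aeval l (bernsteinPoly α.1)) := by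
  classical
  rw [Q.as_sum, map_sum]
  refine Submodule.sum_mem _ fun m hm => ?_
  by_cases hs : ∀ k, k ∉ s → m k = 0
  · have hdeg : ∑ k, m k = n := by
      rw [← Finsupp.degree_eq_sum]
      by_contra hne
      exact (mem_support_iff.1 hm) (hQ.coeff_eq_zero hne)
    have : monomial m (coeff m Q) =
        (coeff m Q / (Nat.multinomial Finset.univ m : ℝ)) • bernsteinPoly (m : ι → ℕ) := by
      rw [bernsteinPoly_eq_monomial, smul_monomial, smul_eq_mul,
        div_mul_cancel₀ _ (multinomial_ne_zero _)]
      rw [Finsupp.equivFunOnFinite_symm_coe]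
    rw [this, map_smul]
    exact Submodule.smul_mem _ _ (Submodule.subset_span ⟨⟨m, hdeg, hs⟩, rfl⟩)
  · push Not at hs
    obtain ⟨k, hk, hmk⟩ := hs
    rw [aeval_monomial, Finsupp.prod_fintype _ _ fun _ => pow_zero _,
      Finset.prod_eq_zero (Finset.mem_univ k) (by rw [h.eq_zero k hk, zero_pow hmk]), mul_zero]
    exact zero_mem _

/-- The Bernstein polynomials of degree `n` form a basis of the polynomials of degree at
most `n`. -/
theorem IsBaryPoly.isBasisOf_bernstein (h : IsBaryPoly s l) (n : ℕ) :
    IsBasisOf (fun α : ClosedIndex n s => aeval l (bernsteinPoly α.1))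
      (restrictTotalDegree (Fin d) ℝ n) := by
  refine ⟨h.linearIndependent_bernstein n, le_antisymm ?_ ?_⟩
  · rw [Submodule.span_le]
    rintro _ ⟨α, rfl⟩
    rw [SetLike.mem_coe, mem_restrictTotalDegree]
    refine (totalDegree_aeval_le h.totalDegree_le _).trans ?_
    exact (isHomogeneous_bernsteinPoly α.1).totalDegree_le.trans α.2.1.le
  · intro p hp
    rw [mem_restrictTotalDegree] at hp
    choose a ha using h.exists_X
    rw [p.as_sum]
    refine Submodule.sum_mem _ fun m hm => ?_
    have hmn : ∑ i, m i ≤ n := by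
      have := (le_totalDegree hm).trans hp
      rwa [Finsupp.sum_fintype _ _ fun _ => rfl] at this
    -- Homogenisation: coordinates are linear forms in the `λ_k`, and a power of `∑ λ_k = 1` fills
    -- the degree up to `n`.
    have : monomial m (coeff m p) = aeval l
        (C (coeff m p) * (∏ i, (∑ k, a i k • X k) ^ m i) * (∑ k, X k) ^ (n - ∑ i, m i)) := by
      simp only [map_mul, map_prod, map_pow, map_sum, map_smul, aeval_X, ← ha, h.sum_eq_one,
        one_pow, mul_one]
      rw [monomial_eq, Finsupp.prod_fintype _ _ fun _ => pow_zero _]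
      simp [algebraMap_eq]
    rw [this]
    refine h.aeval_mem_span ?_
    have h1 : ((∏ i, (∑ k, a i k • X k) ^ m i : MvPolynomial ι ℝ)).IsHomogeneous (∑ i, m i) := by
      refine IsHomogeneous.prod _ _ _ fun i _ => ?_
      have : (∑ k, a i k • X k : MvPolynomial ι ℝ).IsHomogeneous 1 := by
        refine IsHomogeneous.sum _ _ _ fun k _ => ?_
        rw [smul_eq_C_mul]
        exact isHomogeneous_C_mul_X _ _
      simpa using this.pow (m i)
    have h2 : (∑ k, X k : MvPolynomial ι ℝ).IsHomogeneous 1 :=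
      IsHomogeneous.sum _ _ _ fun k _ => isHomogeneous_X _ _
    have h3 := (h1.C_mul (coeff m p)).mul (h2.pow (n - ∑ i, m i))
    convert h3 using 1
    omega

/-- The sum of the Bernstein polynomials is one. -/
theorem IsBaryPoly.sum_bernstein (h : IsBaryPoly s l) (n : ℕ) [Fintype (ClosedIndex n s)] :
    ∑ α : ClosedIndex n s, aeval l (bernsteinPoly α.1) = 1 := by
  classical
  have h1 := Finset.sum_pow_eq_sum_piAntidiag s l n
  rw [h.sum_mem, one_pow] at h1
  rw [h1]
  refine (Finset.sum_bij (fun α _ => α.1) ?_ ?_ ?_ ?_)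
  · intro α _
    rw [Finset.mem_piAntidiag]
    refine ⟨?_, fun i hi => by_contra fun his => hi (α.2.2 i his)⟩
    exact (Finset.sum_subset s.subset_univ fun k _ hk => α.2.2 k hk).trans α.2.1
  · exact fun α _ β _ hαβ => Subtype.ext hαβ
  · intro α hα
    rw [Finset.mem_piAntidiag] at hα
    have hs : ∀ i, i ∉ s → α i = 0 := fun i hi => by_contra fun h0 => hi (hα.2 i h0)
    exact ⟨⟨α, (Finset.sum_subset s.subset_univ fun k _ hk => hs k hk).symm.trans hα.1, hs⟩,
      Finset.mem_univ _, rfl⟩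
  · intro α _
    have h2 : Nat.multinomial Finset.univ α.1 = Nat.multinomial s α.1 :=
      (Nat.multinomial_congr_of_sdiff s.subset_univ
        (fun k hk => α.2.2 k (Finset.mem_sdiff.1 hk).2) fun _ _ => rfl).symm
    have h3 : ∏ k, l k ^ α.1 k = ∏ k ∈ s, l k ^ α.1 k :=
      (Finset.prod_subset s.subset_univ fun k _ hk => by rw [α.2.2 k hk, pow_zero]).symm
    simp only [bernsteinPoly, map_mul, map_prod, map_pow, aeval_X, h3, h2]
    simp

/-- The multi-indices of order `n` on `s` that do not belong to a vertex. -/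
def IsBubble (n : ℕ) (s : Finset ι) (α : ι → ℕ) : Prop :=
  ∑ i, α i = n ∧ (∀ i, i ∉ s → α i = 0) ∧ ∃ i j, i ≠ j ∧ α i ≠ 0 ∧ α j ≠ 0

/-- The barycentric coordinates and the Bernstein polynomials that do not belong to a vertex form a
basis. -/
theorem IsBaryPoly.isBasisOf_bubbles (h : IsBaryPoly s l) {n : ℕ} (hn : 1 ≤ n) {J : Type*}
    {μ : J → ι → ℕ} (hμ : Function.Injective μ) (hrange : ∀ α, (∃ j, μ j = α) ↔ IsBubble n s α) :
    IsBasisOf (Sum.elim (fun k : {k // k ∈ s} => l k) (fun j => aeval l (bernsteinPoly (μ j))))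
      (restrictTotalDegree (Fin d) ℝ n) := by
  classical
  have hb : ∀ j, IsBubble n s (μ j) := fun j => (hrange _).1 ⟨j, rfl⟩
  let μ' : J → ClosedIndex n s := fun j => ⟨μ j, (hb j).1, (hb j).2.1⟩
  have hμ' : Function.Injective μ' := fun i j hij => hμ (congrArg Subtype.val hij)
  have hJ : Finite J := Finite.of_injective μ' hμ'
  have : Fintype J := Fintype.ofFinite J
  -- The index `n e_k` of the vertex `k`, whose Bernstein polynomial `λ_k` replaces.
  have hsingle : ∀ k : {k // k ∈ s}, ∑ i, (Pi.single k.1 n : ι → ℕ) i = n ∧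
      ∀ i, i ∉ s → (Pi.single k.1 n : ι → ℕ) i = 0 := fun k =>
    ⟨by simp, fun i hi => Pi.single_eq_of_ne (ne_of_mem_of_not_mem k.2 hi).symm _⟩
  let f : {k // k ∈ s} ⊕ J → ClosedIndex n s := Sum.elim (fun k => ⟨_, hsingle k⟩) μ'
  have hne : ∀ (k : {k // k ∈ s}) j, (Pi.single k.1 n : ι → ℕ) ≠ μ j := by
    intro k j hkj
    obtain ⟨i, i', hii, hi, hi'⟩ := (hb j).2.2
    rw [← hkj] at hi hi'
    by_cases hik : i = k
    · exact hi' (Pi.single_eq_of_ne (fun he => hii (hik.trans he.symm)) _)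
    · exact hi (Pi.single_eq_of_ne hik _)
  have hf : Function.Bijective f := by
    constructor
    · rintro (k | i) (k' | j) hkj
      · have h1 : (Pi.single k.1 n : ι → ℕ) = Pi.single k'.1 n := congrArg Subtype.val hkj
        by_contra hkk
        have hkk' : k.1 ≠ k'.1 := fun he => hkk (congrArg Sum.inl (Subtype.ext he))
        have h2 := congrFun h1 k.1
        rw [Pi.single_eq_same, Pi.single_eq_of_ne hkk'] at h2
        omega
      · exact absurd (congrArg Subtype.val hkj) (hne k j)
      · exact absurd (congrArg Subtype.val hkj).symm (hne k' i)
      · exact congrArg Sum.inr (hμ' hkj)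
    · intro α
      by_cases hα : IsBubble n s α.1
      · obtain ⟨j, hj⟩ := (hrange _).2 hα
        exact ⟨Sum.inr j, Subtype.ext hj⟩
      · obtain ⟨k, hk⟩ : ∃ k, α.1 k ≠ 0 := by
          by_contra! h0
          have := α.2.1
          simp [h0] at this
          omega
        have hks : k ∈ s := by_contra fun hks => hk (α.2.2 k hks)
        have hz : ∀ i, i ≠ k → α.1 i = 0 := fun i hi => by_contra fun h0 =>
          hα ⟨α.2.1, α.2.2, i, k, hi, h0, hk⟩
        refine ⟨Sum.inl ⟨k, hks⟩, Subtype.ext (funext fun i => ?_)⟩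
        have hkn : α.1 k = n :=
          (Finset.sum_eq_single k (fun i _ hi => hz i hi) (by simp)).symm.trans α.2.1
        change (Pi.single k n : ι → ℕ) i = α.1 i
        by_cases hi : i = k
        · rw [hi, Pi.single_eq_same, hkn]
        · rw [Pi.single_eq_of_ne hi, hz i hi]
  refine (h.isBasisOf_bernstein n).of_card ?_ ?_ (Nat.card_congr (Equiv.ofBijective f hf))
    inferInstance
  · rw [Fintype.linearIndependent_iff]
    intro g hg
    rw [Fintype.sum_sum_type] at hg
    simp only [Sum.elim_inl, Sum.elim_inr] at hg
    have hinl : ∀ k, g (Sum.inl k) = 0 := by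
      intro k
      -- At the vertex `k` every bubble and every other barycentric coordinate vanishes.
      obtain ⟨r, hr⟩ := h.exists_eval (Pi.single k.1 1) (by simp)
        fun i hi => Pi.single_eq_of_ne (ne_of_mem_of_not_mem k.2 hi).symm _
      have h1 := congrArg (eval r) hg
      rw [map_add, map_sum, map_sum, map_zero, Finset.sum_eq_single k
        (fun i _ hi => by
          rw [smul_eval, hr, Pi.single_eq_of_ne (fun he => hi (Subtype.ext he)), mul_zero])
        (by simp), Finset.sum_eq_zero (s := Finset.univ (α := J)), smul_eval, hr,
        Pi.single_eq_same, mul_one, add_zero] at h1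
      · exact h1
      · intro j _
        rw [smul_eval, ← aeval_eq_eval, ← AlgHom.comp_apply, comp_aeval]
        simp only [aeval_eq_eval, hr, eval_bernsteinPoly]
        obtain ⟨i, i', hii, hi, hi'⟩ := (hb j).2.2
        obtain ⟨i, hik, hi⟩ : ∃ i, i ≠ k.1 ∧ μ j i ≠ 0 := by
          by_cases hik : i = k
          · exact ⟨i', fun he => hii (hik.trans he.symm), hi'⟩
          · exact ⟨i, hik, hi⟩
        rw [Finset.prod_eq_zero (Finset.mem_univ i)
          (by rw [Pi.single_eq_of_ne hik, zero_pow hi]), mul_zero, mul_zero]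
    simp only [hinl, zero_smul, Finset.sum_const_zero, zero_add] at hg
    have h2 := Fintype.linearIndependent_iff.1
      ((h.linearIndependent_bernstein n).comp μ' hμ') (fun j => g (Sum.inr j)) hg
    rintro (k | j)
    · exact hinl k
    · exact h2 j
  · rintro (k | j)
    · exact (mem_restrictTotalDegree _ _ _).2 ((h.totalDegree_le k).trans hn)
    · exact (h.isBasisOf_bernstein n).mem (μ' j)

theorem bubbleIndex_iff {n : ℕ} (hs : s.card = 2) (α : ι → ℕ) :
    (∃ β : BubbleIndex n s, β.1 = α) ↔ IsBubble n s α := by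
  classical
  obtain ⟨a, b, hab, rfl⟩ := Finset.card_eq_two.1 hs
  constructor
  · rintro ⟨β, rfl⟩
    refine ⟨β.2.1, fun i hi => ?_, a, b, hab, ?_, ?_⟩
    · have := (β.2.2 i).not.2 hi
      omega
    · exact ((β.2.2 a).2 (by simp)).ne'
    · exact ((β.2.2 b).2 (by simp)).ne'
  · rintro ⟨h1, h2, i, j, hij, hi, hj⟩
    refine ⟨⟨α, h1, fun k => ⟨fun hk => by_contra fun hks => hk.ne' (h2 k hks), fun hk => ?_⟩⟩, rfl⟩
    have his := not_imp_comm.1 (h2 i) hi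
    have hjs := not_imp_comm.1 (h2 j) hj
    simp only [Finset.mem_insert, Finset.mem_singleton] at his hjs hk
    have : k = i ∨ k = j := by grind
    rcases this with rfl | rfl <;> omega

/-- The support of the multi-index recovers the edge, and its size distinguishes edges from the
face. -/
theorem edgeFaceIndex_toMulti_injective {n : ℕ} (hs : s.card = 3) :
    Function.Injective (EdgeFaceIndex.toMulti : EdgeFaceIndex n s → ι → ℕ) := by
  rintro (⟨e, α⟩ | α) (⟨e', α'⟩ | α') hα
  · have h1 : α.1 = α'.1 := hα
    have h2 : e = e' := by
      refine Subtype.ext (Finset.ext fun i => ?_)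
      rw [← α.2.2, ← α'.2.2, h1]
    subst h2
    rw [Subtype.ext h1]
  · have h1 : α.1 = α'.1 := hα
    have h2 : e.1 = s := Finset.ext fun i => by rw [← α.2.2, ← α'.2.2, h1]
    have := e.2.2
    rw [h2] at this
    omega
  · have h1 : α.1 = α'.1 := hα
    have h2 : s = e'.1 := Finset.ext fun i => by rw [← α.2.2, ← α'.2.2, h1]
    have := e'.2.2
    rw [← h2] at this
    omega
  · exact congrArg Sum.inr (Subtype.ext hα)

/-- With three vertices, a support of at least two elements is either an edge or all of `s`. -/
theorem edgeFaceIndex_iff {n : ℕ} (hs : s.card = 3) (α : ι → ℕ) :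
    (∃ β : EdgeFaceIndex n s, β.toMulti = α) ↔ IsBubble n s α := by
  classical
  have key : ∀ e : Finset ι, e ⊆ s → 1 < e.card → ∀ β : BubbleIndex n e, IsBubble n s β.1 := by
    intro e hes he β
    obtain ⟨a, ha, b, hb, hab⟩ := Finset.one_lt_card.1 he
    refine ⟨β.2.1, fun i hi => ?_, a, b, hab, ((β.2.2 a).2 ha).ne', ((β.2.2 b).2 hb).ne'⟩
    have := (β.2.2 i).not.2 fun hie => hi (hes hie)
    omega
  constructor
  · rintro ⟨⟨e, β⟩ | β, rfl⟩
    · exact key e.1 e.2.1 (by rw [e.2.2]; norm_num) β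
    · exact key s subset_rfl (by omega) β
  · rintro ⟨h1, h2, i, j, hij, hi, hj⟩
    let e : Finset ι := {k | α k ≠ 0}
    have hes : e ⊆ s := fun k hk => by_contra fun hks => (Finset.mem_filter.1 hk).2 (h2 k hks)
    have he : 1 < e.card := Finset.one_lt_card.2 ⟨i, by simpa [e], j, by simpa [e], hij⟩
    have hpos : ∀ k, 0 < α k ↔ k ∈ e := fun k => by simp [e, Nat.pos_iff_ne_zero]
    by_cases he2 : e.card = 2
    · exact ⟨Sum.inl ⟨⟨e, hes, he2⟩, α, h1, hpos⟩, rfl⟩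
    · have : e = s := Finset.eq_of_subset_of_card_le hes (by omega)
      exact ⟨Sum.inr ⟨α, h1, this ▸ hpos⟩, rfl⟩

end BernsteinBasis

/-! ### Multiplication by a coordinate and differentiation of Bernstein polynomials -/

section BernsteinRecurrence

open MvPolynomial

variable {ι : Type*} [Fintype ι] [DecidableEq ι]

/-- Both sides equal `(|α| + 1)! / α!`. -/
theorem succ_mul_multinomial_add_single (α : ι → ℕ) (j : ι) :
    (α j + 1) * Nat.multinomial Finset.univ (α + Pi.single j 1) =
      (∑ i, α i + 1) * Nat.multinomial Finset.univ α := by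
  have h1 := Nat.multinomial_spec Finset.univ α
  have h2 := Nat.multinomial_spec Finset.univ (α + Pi.single j 1)
  have h3 : ∑ i, (α + Pi.single j 1 : ι → ℕ) i = ∑ i, α i + 1 := by
    simp [Finset.sum_add_distrib]
  have h4 : ∏ i, ((α + Pi.single j 1 : ι → ℕ) i).factorial = (α j + 1) * ∏ i, (α i).factorial := by
    rw [← Finset.mul_prod_erase _ _ (Finset.mem_univ j),
      ← Finset.mul_prod_erase _ (fun i => (α i).factorial) (Finset.mem_univ j), ← mul_assoc]
    congr 1
    · simp [Nat.factorial_succ]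
    · refine Finset.prod_congr rfl fun i hi => ?_
      simp [Pi.single_eq_of_ne (Finset.ne_of_mem_erase hi)]
  rw [h3, Nat.factorial_succ, ← h1, h4] at h2
  have hpos : 0 < ∏ i, (α i).factorial := Finset.prod_pos fun i _ => Nat.factorial_pos _
  refine Nat.eq_of_mul_eq_mul_left hpos ?_
  linarith

theorem bernsteinPoly_mul_X (α : ι → ℕ) (j : ι) :
    ((∑ i, α i : ℕ) + 1 : ℝ) • (X j * bernsteinPoly α) =
      (α j + 1 : ℝ) • bernsteinPoly (α + Pi.single j 1) := by
  have h1 : ∏ k, (X k : MvPolynomial ι ℝ) ^ (α + Pi.single j 1 : ι → ℕ) k = X j * ∏ k, X k ^ α k := by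
    simp only [Pi.add_apply, pow_add, Finset.prod_mul_distrib]
    rw [mul_comm]
    congr 1
    rw [Finset.prod_eq_single j (fun i _ hi => by rw [Pi.single_eq_of_ne hi, pow_zero]) (by simp),
      Pi.single_eq_same, pow_one]
  have h2 : (α j + 1 : ℝ) * (Nat.multinomial Finset.univ (α + Pi.single j 1) : ℝ) =
      ((∑ i, α i : ℕ) + 1) * (Nat.multinomial Finset.univ α : ℝ) := by
    exact_mod_cast succ_mul_multinomial_add_single α j
  rw [bernsteinPoly, bernsteinPoly, h1, smul_eq_C_mul, smul_eq_C_mul, ← mul_assoc (C _) (C _),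
    ← C_mul, h2, C_mul]
  ring

theorem pderiv_bernsteinPoly_add_single (α : ι → ℕ) (i : ι) :
    pderiv i (bernsteinPoly (α + Pi.single i 1)) =
      ((∑ i, α i : ℕ) + 1 : ℝ) • bernsteinPoly α := by
  have h2 : (α i + 1 : ℝ) * (Nat.multinomial Finset.univ (α + Pi.single i 1) : ℝ) =
      ((∑ i, α i : ℕ) + 1) * (Nat.multinomial Finset.univ α : ℝ) := by
    exact_mod_cast succ_mul_multinomial_add_single α i
  rw [bernsteinPoly_eq_monomial, bernsteinPoly_eq_monomial, pderiv_monomial, smul_monomial,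
    smul_eq_mul, ← h2]
  congr 1
  · congr 1
    ext k
    simp [Finsupp.single_apply, Pi.single_apply, eq_comm]
  · simp [mul_comm]

end BernsteinRecurrence

/-! ### The neighbour graph on multi-indices and its energy -/

section Indices

variable {ι : Type*} [Fintype ι] [DecidableEq ι] {s : Finset ι} {n : ℕ}

/-- Adding one at a vertex of `s`. -/
def ClosedIndex.succ (α : ClosedIndex n s) (i : s) : ClosedIndex (n + 1) s :=
  ⟨α.1 + Pi.single i.1 1, by simp [Finset.sum_add_distrib, α.2.1], fun k hk => by
    simp [α.2.2 k hk, Pi.single_eq_of_ne (ne_of_mem_of_not_mem i.2 hk).symm]⟩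

theorem ClosedIndex.succ_val (α : ClosedIndex n s) (i : s) :
    (α.succ i).1 = α.1 + Pi.single i.1 1 := rfl

theorem ClosedIndex.exists_succ (α : ClosedIndex (n + 1) s) (i : s) (hi : α.1 i ≠ 0) :
    ∃ γ : ClosedIndex n s, γ.succ i = α := by
  have h : α.1 - Pi.single i.1 1 + Pi.single i.1 1 = α.1 := by
    funext k
    by_cases hk : k = i.1
    · subst hk
      simp
      omega
    · simp [Pi.single_eq_of_ne hk]
  refine ⟨⟨α.1 - Pi.single i.1 1, ?_, fun k hk => by simp [α.2.2 k hk]⟩, Subtype.ext h⟩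
  have h1 := congrArg (fun f => ∑ k, f k) h
  simp only [Pi.add_apply, Finset.sum_add_distrib, Finset.sum_pi_single', Finset.mem_univ,
    if_true, α.2.1] at h1
  omega

theorem ClosedIndex.succ_injective (i : s) :
    Function.Injective fun α : ClosedIndex n s => α.succ i := fun _ _ h =>
  Subtype.ext (add_right_cancel (congrArg Subtype.val h))

omit [DecidableEq ι] in
theorem ClosedIndex.sum_mem (α : ClosedIndex n s) : ∑ i : s, α.1 i = n := by
  rw [Finset.sum_coe_sort s]
  exact (Finset.sum_subset s.subset_univ fun k _ hk => α.2.2 k hk).trans α.2.1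

/-- The substitution `α = γ + e_i`: an index that is not of this form has `α_i = 0` and contributes
nothing. -/
theorem ClosedIndex.sum_succ {M : Type*} [AddCommGroup M] [Module ℝ M]
    [Fintype (ClosedIndex n s)] [Fintype (ClosedIndex (n + 1) s)]
    (f : ClosedIndex (n + 1) s → s → M) :
    ∑ α, ∑ i : s, (α.1 i : ℝ) • f α i =
      ∑ γ : ClosedIndex n s, ∑ i : s, (γ.1 i + 1 : ℝ) • f (γ.succ i) i := by
  rw [Finset.sum_comm, Finset.sum_comm (s := Finset.univ (α := ClosedIndex n s))]
  refine Finset.sum_congr rfl fun i _ => ?_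
  refine (Fintype.sum_of_injective _ (ClosedIndex.succ_injective i) _ _ (fun α hα => ?_)
    fun γ => ?_).symm
  · by_cases hi : α.1 i = 0
    · rw [hi, Nat.cast_zero, zero_smul]
    · exact absurd (α.exists_succ i hi) hα
  · simp [ClosedIndex.succ_val]

/-- A function on the indices that agrees at all neighbours is constant. -/
theorem ClosedIndex.eq_of_neighbours {c : ClosedIndex (n + 1) s → ℝ}
    (hc : ∀ (γ : ClosedIndex n s) (i j : s), c (γ.succ i) = c (γ.succ j))
    (α β : ClosedIndex (n + 1) s) : c α = c β := by
  obtain ⟨i₀, hi₀⟩ : s.Nonempty := by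
    rw [Finset.nonempty_iff_ne_empty]
    rintro rfl
    have := α.sum_mem
    simp at this
  -- Induction on the distance `k` to the vertex index at `i₀`; each step moves one unit from some
  -- `j` to `i₀`.
  have key : ∀ k, ∀ α β : ClosedIndex (n + 1) s, α.1 i₀ = n + 1 → β.1 i₀ + k = n + 1 →
      c β = c α := by
    intro k
    induction k with
    | zero =>
      intro α β hα hβ
      congr 1
      have : ∀ γ : ClosedIndex (n + 1) s, γ.1 i₀ = n + 1 → γ.1 = Pi.single i₀ (n + 1) := by
        intro γ hγ
        funext j
        by_cases hj : j = i₀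
        · rw [hj, Pi.single_eq_same, hγ]
        · rw [Pi.single_eq_of_ne hj]
          have h1 := γ.2.1
          rw [← Finset.add_sum_erase _ _ (Finset.mem_univ i₀), hγ] at h1
          have h2 := Finset.single_le_sum (f := γ.1) (fun _ _ => Nat.zero_le _)
            (Finset.mem_erase.2 ⟨hj, Finset.mem_univ j⟩)
          omega
      exact Subtype.ext ((this β hβ).trans (this α hα).symm)
    | succ k ih =>
      intro α β hα hβ
      obtain ⟨j, hj, hjβ⟩ : ∃ j, j ≠ i₀ ∧ β.1 j ≠ 0 := by
        by_contra! h0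
        have h1 := β.2.1
        rw [Finset.sum_eq_single i₀ (fun j _ hj => h0 j hj) (by simp)] at h1
        omega
      have hjs : j ∈ s := by_contra fun hjs => hjβ (β.2.2 j hjs)
      obtain ⟨γ, rfl⟩ := β.exists_succ ⟨j, hjs⟩ hjβ
      rw [hc γ ⟨j, hjs⟩ ⟨i₀, hi₀⟩]
      refine ih α _ hα ?_
      rw [ClosedIndex.succ_val] at hβ ⊢
      simp only [Pi.add_apply, Pi.single_eq_same, Pi.single_eq_of_ne hj.symm] at hβ ⊢
      omega
  have hv : ∑ k, (Pi.single i₀ (n + 1) : ι → ℕ) k = n + 1 := by simp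
  let v : ClosedIndex (n + 1) s := ⟨Pi.single i₀ (n + 1), hv, fun k hk =>
    Pi.single_eq_of_ne (ne_of_mem_of_not_mem hi₀ hk).symm _⟩
  have hle : ∀ γ : ClosedIndex (n + 1) s, γ.1 i₀ ≤ n + 1 := fun γ =>
    (Finset.single_le_sum (f := γ.1) (fun _ _ => Nat.zero_le _) (Finset.mem_univ i₀)).trans
      γ.2.1.le
  have h1 := key (n + 1 - α.1 i₀) v α (by simp [v]) (by have := hle α; omega)
  have h2 := key (n + 1 - β.1 i₀) v β (by simp [v]) (by have := hle β; omega)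
  rw [h1, h2]

/-- The energy identity of the weighted graph Laplacian on the indices. -/
theorem ClosedIndex.eq_of_energy_eq_zero [Fintype (ClosedIndex n s)]
    {c : ClosedIndex (n + 1) s → ℝ}
    (hc : ∑ γ : ClosedIndex n s, ∑ i : s, ∑ j : s,
      ((γ.1 i + 1 : ℝ) * (γ.1 j + 1)) * (c (γ.succ i) * (c (γ.succ i) - c (γ.succ j))) = 0)
    (α β : ClosedIndex (n + 1) s) : c α = c β := by
  -- Adding the copy of the sum with `i` and `j` exchanged completes the square.
  have hsq : ∑ γ : ClosedIndex n s, ∑ i : s, ∑ j : s,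
      ((γ.1 i + 1 : ℝ) * (γ.1 j + 1)) * (c (γ.succ i) - c (γ.succ j)) ^ 2 = 0 := by
    have h2 : ∑ γ : ClosedIndex n s, ∑ i : s, ∑ j : s,
        ((γ.1 i + 1 : ℝ) * (γ.1 j + 1)) * (c (γ.succ j) * (c (γ.succ j) - c (γ.succ i))) = 0 := by
      rw [← hc]
      refine Finset.sum_congr rfl fun γ _ => ?_
      rw [Finset.sum_comm]
      exact Finset.sum_congr rfl fun i _ => Finset.sum_congr rfl fun j _ => by ring
    rw [← add_zero (0 : ℝ)]
    nth_rewrite 1 [← hc]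
    rw [← h2]
    simp only [← Finset.sum_add_distrib]
    exact Finset.sum_congr rfl fun γ _ => Finset.sum_congr rfl fun i _ =>
      Finset.sum_congr rfl fun j _ => by ring
  have hnn : ∀ (γ : ClosedIndex n s) (i j : s),
      0 ≤ ((γ.1 i + 1 : ℝ) * (γ.1 j + 1)) * (c (γ.succ i) - c (γ.succ j)) ^ 2 :=
    fun γ i j => by positivity
  refine ClosedIndex.eq_of_neighbours (fun γ i j => ?_) α β
  have h1 := (Finset.sum_eq_zero_iff_of_nonneg fun γ _ => Finset.sum_nonneg fun i _ =>
    Finset.sum_nonneg fun j _ => hnn γ i j).1 hsq γ (Finset.mem_univ _)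
  have h2 := (Finset.sum_eq_zero_iff_of_nonneg fun i _ => Finset.sum_nonneg fun j _ =>
    hnn γ i j).1 h1 i (Finset.mem_univ _)
  have h3 := (Finset.sum_eq_zero_iff_of_nonneg fun j _ => hnn γ i j).1 h2 j (Finset.mem_univ _)
  have h4 : ((γ.1 i + 1 : ℝ) * (γ.1 j + 1)) ≠ 0 := by positivity
  exact sub_eq_zero.1 (pow_eq_zero_iff two_ne_zero |>.1 ((mul_eq_zero.1 h3).resolve_left h4))

end Indices

/-! ### Rotations of the face bubbles as a graph Laplacian -/

section Rotation

open MvPolynomial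

variable {ι : Type*} [Fintype ι] [DecidableEq ι] {d : ℕ}

/-- The components of the differential form `∑ j, P j dl_j`. -/
noncomputable def pullForm (l : ι → MvPolynomial (Fin d) ℝ) (P : ι → MvPolynomial ι ℝ)
    (i : Fin d) : MvPolynomial (Fin d) ℝ :=
  ∑ j, aeval l (P j) * pderiv i (l j)

/-- The lowest-order edge form. -/
noncomputable def edgeForm (i j : ι) : ι → MvPolynomial ι ℝ := Pi.single j (X i) - Pi.single i (X j)

/-- The non-gradient face bubble form of the face with vertices `a`, `b`, `c`. -/
noncomputable def bubbleForm (a b c : ι) (n : ℕ) (α : ι → ℕ) : ι → MvPolynomial ι ℝ :=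
  ((n + 1 : ℝ) • bernsteinPoly α) •
    ((α a : ℝ) • edgeForm b c + (α b : ℝ) • edgeForm c a + (α c : ℝ) • edgeForm a b)

/-- The gradient of a form, with respect to the barycentric coordinates. -/
noncomputable def gradForm (P : MvPolynomial ι ℝ) : ι → MvPolynomial ι ℝ := fun k => pderiv k P

theorem pullForm_edgeForm (l : ι → MvPolynomial (Fin d) ℝ) (j k : ι) (i : Fin d) :
    pullForm l (edgeForm j k) i = l j * pderiv i (l k) - l k * pderiv i (l j) := by
  have h : ∀ m, aeval l (edgeForm j k m) * pderiv i (l m) =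
      (if m = k then l j * pderiv i (l k) else 0) - if m = j then l k * pderiv i (l j) else 0 := by
    intro m
    simp only [edgeForm, Pi.sub_apply, Pi.single_apply, map_sub, sub_mul]
    split_ifs with h1 h2 <;> simp_all
  simp only [pullForm, h, Finset.sum_sub_distrib, Finset.sum_ite_eq', Finset.mem_univ, if_true]

omit [DecidableEq ι] in
theorem pullForm_gradForm (l : ι → MvPolynomial (Fin d) ℝ) (P : MvPolynomial ι ℝ) (i : Fin d) :
    pullForm l (gradForm P) i = pderiv i (aeval l P) :=
  (pderiv_aeval l i P).symm

theorem pullForm_bubbleForm (l : ι → MvPolynomial (Fin d) ℝ) (a b c : ι) (n : ℕ) (α : ι → ℕ)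
    (i : Fin d) :
    pullForm l (bubbleForm a b c n α) i =
      C ((n : ℝ) + 1) * aeval l (bernsteinPoly α) *
        (C (α a : ℝ) * pullForm l (edgeForm b c) i + C (α b : ℝ) * pullForm l (edgeForm c a) i +
          C (α c : ℝ) * pullForm l (edgeForm a b) i) := by
  simp only [pullForm, bubbleForm, Finset.mul_sum, ← Finset.sum_add_distrib]
  refine Finset.sum_congr rfl fun j _ => ?_
  simp only [Pi.smul_apply, Pi.add_apply, smul_eq_mul, map_mul, map_add, map_smul]
  simp only [smul_eq_C_mul, C_add]
  ring

/-- The rotation of a plane vector field. -/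
noncomputable def rot :
    (Fin 2 → MvPolynomial (Fin 2) ℝ) →ₗ[ℝ] MvPolynomial (Fin 2) ℝ :=
  (pderiv 0).toLinearMap ∘ₗ LinearMap.proj 1 - (pderiv 1).toLinearMap ∘ₗ LinearMap.proj 0

theorem rot_apply (v : Fin 2 → MvPolynomial (Fin 2) ℝ) :
    rot v = pderiv 0 (v 1) - pderiv 1 (v 0) := rfl

/-- The Jacobian determinant of two functions in the plane. -/
noncomputable def wedge (f g : MvPolynomial (Fin 2) ℝ) : MvPolynomial (Fin 2) ℝ :=
  pderiv 0 f * pderiv 1 g - pderiv 1 f * pderiv 0 g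

/-- `l` are the barycentric coordinates of a positively oriented triangle with vertices `a`, `b`,
`c`, of unit coordinate area. -/
structure IsTrianglePoly (a b c : ι) (l : ι → MvPolynomial (Fin 2) ℝ) : Prop
    extends IsBaryPoly {a, b, c} l where
  ne_ab : a ≠ b
  ne_ac : a ≠ c
  ne_bc : b ≠ c
  wedge_eq_one : wedge (l a) (l b) = 1

variable {a b c : ι} {l : ι → MvPolynomial (Fin 2) ℝ}

omit [DecidableEq ι] in
theorem IsBaryPoly.exists_pderiv_eq_C {s : Finset ι} {l : ι → MvPolynomial (Fin d) ℝ}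
    (h : IsBaryPoly s l) (i : Fin d) (k : ι) : ∃ r, pderiv i (l k) = C r :=
  ⟨_, totalDegree_eq_zero_iff_eq_C.1
    (Nat.le_zero.1 (totalDegree_pderiv_le (h.totalDegree_le k) i))⟩

omit [Fintype ι] in
theorem sum_triple {M : Type*} [AddCommMonoid M] (h1 : a ≠ b) (h2 : a ≠ c) (h3 : b ≠ c)
    {f : ι → M} : ∑ k ∈ {a, b, c}, f k = f a + f b + f c := by
  rw [Finset.sum_insert (by simp [h1, h2]), Finset.sum_insert (by simp [h3]),
    Finset.sum_singleton, add_assoc]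

theorem IsTrianglePoly.eq_sub (h : IsTrianglePoly a b c l) : l c = 1 - l a - l b := by
  have := h.sum_mem
  rw [sum_triple h.ne_ab h.ne_ac h.ne_bc] at this
  linear_combination this

/-- For the edge form `ω` opposite the vertex `i`, the product rule gives `rot (B ω) = 2 B + ∇B ∧
ω`. Since the `λ_k` sum to one and neighbouring gradients have wedge one, `∇B ∧ ω = ∑ λ_k ∂_k B -
∂_i B`, and the Euler identity turns the sum into `n B`. -/
theorem IsTrianglePoly.rot_bubbleForm (h : IsTrianglePoly a b c l) {n : ℕ}
    (α : ClosedIndex n {a, b, c}) :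
    rot (pullForm l (bubbleForm a b c n α.1)) = ((n : ℝ) + 1) •
      ∑ i : ({a, b, c} : Finset ι), (α.1 i : ℝ) •
        (((n : ℝ) + 2) • aeval l (bernsteinPoly α.1) -
          aeval l (pderiv i.1 (bernsteinPoly α.1))) := by
  obtain ⟨r0a, h0a⟩ := h.exists_pderiv_eq_C 0 a
  obtain ⟨r1a, h1a⟩ := h.exists_pderiv_eq_C 1 a
  obtain ⟨r0b, h0b⟩ := h.exists_pderiv_eq_C 0 b
  obtain ⟨r1b, h1b⟩ := h.exists_pderiv_eq_C 1 b
  have hW := h.wedge_eq_one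
  have hc := h.eq_sub
  have hE := congrArg (aeval l) (isHomogeneous_bernsteinPoly α.1).sum_X_mul_pderiv
  have hD : ∀ i : Fin 2, pderiv i (aeval l (bernsteinPoly α.1)) =
      ∑ k ∈ {a, b, c}, aeval l (pderiv k (bernsteinPoly α.1)) * pderiv i (l k) := by
    intro i
    rw [pderiv_aeval]
    exact (Finset.sum_subset (Finset.subset_univ _) fun k _ hk => by
      rw [h.eq_zero k hk, map_zero, mul_zero]).symm
  rw [map_sum, ← Finset.sum_subset (Finset.subset_univ {a, b, c}) (fun k _ hk => by
    rw [map_mul, aeval_X, h.eq_zero k hk, zero_mul]), α.2.1] at hE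
  simp only [sum_triple h.ne_ab h.ne_ac h.ne_bc, map_mul, aeval_X, map_nsmul] at hD hE
  rw [Finset.sum_coe_sort {a, b, c} fun i => (α.1 i : ℝ) •
        (((n : ℝ) + 2) • aeval l (bernsteinPoly α.1) -
          aeval l (pderiv i (bernsteinPoly α.1)))]
  simp only [sum_triple h.ne_ab h.ne_ac h.ne_bc]
  rw [wedge, h0a, h1a, h0b, h1b] at hW
  rw [rot_apply, pullForm_bubbleForm, pullForm_bubbleForm]
  simp only [pullForm_edgeForm, Derivation.leibniz, map_add, map_sub, smul_eq_mul, hD, hc, h0a,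
    h1a, h0b, h1b, pderiv_C, pderiv_one, map_zero]
  rw [hc] at hE
  generalize aeval l (bernsteinPoly α.1) = B at *
  generalize aeval l (pderiv a (bernsteinPoly α.1)) = Ba at *
  generalize aeval l (pderiv b (bernsteinPoly α.1)) = Bb at *
  generalize aeval l (pderiv c (bernsteinPoly α.1)) = Bc at *
  simp only [smul_eq_C_mul, nsmul_eq_mul, C_add, C_1, ← C_eq_coe_nat] at *
  generalize (C (α.1 a : ℝ) : MvPolynomial (Fin 2) ℝ) = αa at *
  generalize (C (α.1 b : ℝ) : MvPolynomial (Fin 2) ℝ) = αb at *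
  generalize (C (α.1 c : ℝ) : MvPolynomial (Fin 2) ℝ) = αc at *
  have h2 : (C 2 : MvPolynomial (Fin 2) ℝ) = 2 := map_ofNat C 2
  rw [h2]
  linear_combination (C (n : ℝ) + 1) * (2 * B * (αa + αb + αc) +
    (αa + αb + αc) * (l a * Ba + l b * Bb + (1 - l a - l b) * Bc) -
      (αa * Ba + αb * Bb + αc * Bc)) * hW + (C (n : ℝ) + 1) * (αa + αb + αc) * hE

theorem IsTrianglePoly.rot_bubbleForm_mem (h : IsTrianglePoly a b c l) {n : ℕ}
    (α : ClosedIndex n {a, b, c}) :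
    rot (pullForm l (bubbleForm a b c n α.1)) ∈ restrictTotalDegree (Fin 2) ℝ n := by
  rw [h.rot_bubbleForm α]
  refine Submodule.smul_mem _ _ (Submodule.sum_mem _ fun i _ => Submodule.smul_mem _ _
    (Submodule.sub_mem _ (Submodule.smul_mem _ _ ((h.isBasisOf_bernstein n).mem α)) ?_))
  rw [mem_restrictTotalDegree]
  refine (totalDegree_aeval_le h.totalDegree_le _).trans (totalDegree_pderiv_le ?_ _)
  exact ((isHomogeneous_bernsteinPoly α.1).totalDegree_le.trans α.2.1.le).trans (Nat.le_succ n)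

/-- Degree elevation: multiply by `∑ λ_j = 1`. -/
theorem IsBaryPoly.bernstein_succ {s : Finset ι} {l : ι → MvPolynomial (Fin d) ℝ}
    (h : IsBaryPoly s l) {n : ℕ} (γ : ClosedIndex n s) :
    ((n : ℝ) + 1) • aeval l (bernsteinPoly γ.1) =
      ∑ j : s, (γ.1 j + 1 : ℝ) • aeval l (bernsteinPoly (γ.succ j).1) := by
  have h1 : ∀ j : s, (γ.1 j + 1 : ℝ) • aeval l (bernsteinPoly (γ.succ j).1) =
      l j * (((n : ℝ) + 1) • aeval l (bernsteinPoly γ.1)) := by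
    intro j
    have := congrArg (aeval l) (bernsteinPoly_mul_X γ.1 j.1)
    rw [γ.2.1, map_smul, map_smul, map_mul, aeval_X] at this
    rw [ClosedIndex.succ_val, ← this, mul_smul_comm]
  simp only [h1]
  rw [← Finset.sum_mul, Finset.sum_coe_sort s l, h.sum_mem, one_mul]

/-- With `α = γ + e_i` both terms of `rot_bubbleForm` become sums over `j`: `∂_i B_α` is a multiple
of `B_γ`, to which degree elevation applies, and `n + 3 = ∑ (γ_j + 1)` over the three vertices. The
differences that result are the edges of the neighbour graph. -/
theorem IsTrianglePoly.sum_rot_bubbleForm (h : IsTrianglePoly a b c l) {n : ℕ}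
    [Fintype (ClosedIndex n {a, b, c})] [Fintype (ClosedIndex (n + 1) {a, b, c})]
    (u : ClosedIndex (n + 1) {a, b, c} → ℝ) :
    ∑ α, u α • rot (pullForm l (bubbleForm a b c (n + 1) α.1)) = ((n : ℝ) + 2) •
      ∑ γ : ClosedIndex n {a, b, c}, ∑ i : ({a, b, c} : Finset ι), ∑ j : ({a, b, c} : Finset ι),
        ((γ.1 i + 1 : ℝ) * (γ.1 j + 1)) • u (γ.succ i) •
          (aeval l (bernsteinPoly (γ.succ i).1) - aeval l (bernsteinPoly (γ.succ j).1)) := by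
  have h1 : ∀ α : ClosedIndex (n + 1) {a, b, c},
      u α • rot (pullForm l (bubbleForm a b c (n + 1) α.1)) = ((n : ℝ) + 2) •
        ∑ i : ({a, b, c} : Finset ι), (α.1 i : ℝ) • (u α • (((n : ℝ) + 3) •
          aeval l (bernsteinPoly α.1) - aeval l (pderiv i.1 (bernsteinPoly α.1)))) := by
    intro α
    have e1 : ((n + 1 : ℕ) : ℝ) + 1 = n + 2 := by push_cast; ring
    have e2 : ((n + 1 : ℕ) : ℝ) + 2 = n + 3 := by push_cast; ring
    rw [h.rot_bubbleForm α, e1, e2, smul_comm, Finset.smul_sum]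
    simp only [smul_comm (u α)]
  simp only [h1]
  rw [← Finset.smul_sum, ClosedIndex.sum_succ (fun α i => u α • (((n : ℝ) + 3) •
          aeval l (bernsteinPoly α.1) - aeval l (pderiv i.1 (bernsteinPoly α.1))))]
  congr 1
  refine Finset.sum_congr rfl fun γ _ => Finset.sum_congr rfl fun i _ => ?_
  have h2 : aeval l (pderiv i.1 (bernsteinPoly (γ.succ i).1)) =
      ∑ j : ({a, b, c} : Finset ι), (γ.1 j + 1 : ℝ) • aeval l (bernsteinPoly (γ.succ j).1) := by
    rw [ClosedIndex.succ_val, pderiv_bernsteinPoly_add_single, γ.2.1, map_smul, h.bernstein_succ]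
  have h3 : ((n : ℝ) + 3) • aeval l (bernsteinPoly (γ.succ i).1) =
      ∑ j : ({a, b, c} : Finset ι), (γ.1 j + 1 : ℝ) • aeval l (bernsteinPoly (γ.succ i).1) := by
    rw [← Finset.sum_smul, Finset.sum_add_distrib, ← Nat.cast_sum, γ.sum_mem]
    congr 2
    rw [Finset.sum_const, Finset.card_univ, Fintype.card_coe,
      Finset.card_eq_three.2 ⟨a, b, c, h.ne_ab, h.ne_ac, h.ne_bc, rfl⟩]
    norm_num
  rw [h2, h3, ← Finset.sum_sub_distrib, Finset.smul_sum, Finset.smul_sum]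
  refine Finset.sum_congr rfl fun j _ => ?_
  rw [← smul_sub, smul_comm (u _), smul_smul]

/-- A linear relation between a constant and the rotations of the face bubbles has equal
coefficients at the bubbles, and no constant. -/
theorem IsTrianglePoly.const_of_sum_rot_eq_zero (h : IsTrianglePoly a b c l) {n : ℕ}
    [Fintype (ClosedIndex n {a, b, c})] {u : ClosedIndex n {a, b, c} → ℝ} {r : ℝ}
    (hu : C r + ∑ α, u α • rot (pullForm l (bubbleForm a b c n α.1)) = 0) :
    r = 0 ∧ ∀ α β, u α = u β := by
  cases n with
  | zero =>
    -- In degree zero the only index is `0`, and its bubble vanishes.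
    have hsub : ∀ α β : ClosedIndex 0 {a, b, c}, α = β := fun α β => Subtype.ext <| funext fun i => by
      rw [Finset.sum_eq_zero_iff.1 α.2.1 i (Finset.mem_univ i),
        Finset.sum_eq_zero_iff.1 β.2.1 i (Finset.mem_univ i)]
    refine ⟨?_, fun α β => by rw [hsub α β]⟩
    rw [Finset.sum_eq_zero fun α _ => ?_, add_zero, ← C_0] at hu
    · exact C_injective _ _ hu
    · rw [h.rot_bubbleForm α, Finset.sum_eq_zero fun i _ => ?_, smul_zero, smul_zero]
      rw [Finset.sum_eq_zero_iff.1 α.2.1 i.1 (Finset.mem_univ _), Nat.cast_zero, zero_smul]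
  | succ n =>
    have : Fintype (ClosedIndex n {a, b, c}) := Fintype.ofFinite _
    have hr : C r = r • ∑ α : ClosedIndex (n + 1) {a, b, c}, aeval l (bernsteinPoly α.1) := by
      rw [h.sum_bernstein, smul_eq_C_mul, mul_one]
    have hn2 : ((n : ℝ) + 2) ≠ 0 := by positivity
    rw [h.sum_rot_bubbleForm, hr] at hu
    -- The relation is tested with the functional that takes the values `f` on the Bernstein basis.
    have key : ∀ f : ClosedIndex (n + 1) {a, b, c} → ℝ,
        r * ∑ α, f α + ((n : ℝ) + 2) * ∑ γ : ClosedIndex n {a, b, c},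
          ∑ i : ({a, b, c} : Finset ι), ∑ j : ({a, b, c} : Finset ι),
          ((γ.1 i + 1 : ℝ) * (γ.1 j + 1)) * (u (γ.succ i) * (f (γ.succ i) - f (γ.succ j))) = 0 := by
      intro f
      obtain ⟨φ, hφ⟩ := (h.isBasisOf_bernstein (n + 1)).exists_functional f
      have := congrArg φ hu
      simpa only [map_add, map_smul, map_sum, map_sub, hφ, map_zero, smul_eq_mul] using this
    have hr0 : r = 0 := by
      -- A constant test function removes all differences and isolates `r`.
      have h1 := key fun _ => 1
      simp only [sub_self, mul_zero, Finset.sum_const_zero, add_zero] at h1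
      refine (mul_eq_zero.1 h1).resolve_right ?_
      have : Nonempty (ClosedIndex (n + 1) {a, b, c}) :=
        ⟨⟨Pi.single a (n + 1), by simp, fun k hk => Pi.single_eq_of_ne (by grind) _⟩⟩
      simp
    refine ⟨hr0, ClosedIndex.eq_of_energy_eq_zero ?_⟩
    -- Testing with `u` itself produces the energy.
    have h2 := key u
    rw [hr0, zero_mul, zero_add] at h2
    exact (mul_eq_zero.1 h2).resolve_left hn2

/-- The rotations of all but one of the face bubbles form a basis together with a constant. -/
theorem IsTrianglePoly.isBasisOf_rot (h : IsTrianglePoly a b c l) {n : ℕ}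
    (β : ClosedIndex n {a, b, c}) {r : ℝ} (hr : r ≠ 0) :
    IsBasisOf (Sum.elim (fun _ : Unit => C r) fun α : {α : ClosedIndex n {a, b, c} // α ≠ β} =>
      rot (pullForm l (bubbleForm a b c n α.1.1))) (restrictTotalDegree (Fin 2) ℝ n) := by
  have : Fintype (ClosedIndex n {a, b, c}) := Fintype.ofFinite _
  refine (h.isBasisOf_bernstein n).of_card ?_ ?_ ?_ inferInstance
  · rw [Fintype.linearIndependent_iff]
    intro g hg
    rw [Fintype.sum_sum_type] at hg
    simp only [Finset.univ_unique, Finset.sum_singleton, Sum.elim_inl, Sum.elim_inr] at hg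
    -- Extension by zero at the omitted index: once `u` is constant, it equals `u β = 0`.
    let u : ClosedIndex n {a, b, c} → ℝ := fun α => if hα : α ≠ β then g (Sum.inr ⟨α, hα⟩) else 0
    have hsum : ∑ α : {α : ClosedIndex n {a, b, c} // α ≠ β},
        g (Sum.inr α) • rot (pullForm l (bubbleForm a b c n α.1.1)) =
        ∑ α, u α • rot (pullForm l (bubbleForm a b c n α.1)) := by
      refine Fintype.sum_of_injective _ Subtype.val_injective _ _ (fun α hα => ?_) fun α => ?_
      · have : α = β := by simpa using hα
        simp [u, this]
      · simp [u, α.2]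
    rw [hsum, smul_eq_C_mul, ← C_mul] at hg
    obtain ⟨h1, h2⟩ := h.const_of_sum_rot_eq_zero hg
    rintro (i | α)
    · exact (mul_eq_zero.1 h1).resolve_right hr
    · have := h2 α.1 β
      simpa [u, α.2] using this
  · rintro (i | α)
    · exact (mem_restrictTotalDegree _ _ _).2 ((totalDegree_C r).le.trans (Nat.zero_le n))
    · exact h.rot_bubbleForm_mem α.1
  -- In the count, the constant takes the place of the omitted `β`.
  · exact Nat.card_congr (((Equiv.sumComm _ _).trans (Equiv.optionEquivSumPUnit _).symm).trans
      (Equiv.optionSubtypeNe β))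

end Rotation

/-! ### Polynomial potentials, and derivatives of bubbles on an edge -/

section Potentials

open MvPolynomial

variable {d : ℕ}

theorem pderiv_homogeneousComponent_succ (i : Fin d) (m : ℕ) (p : MvPolynomial (Fin d) ℝ) :
    pderiv i (homogeneousComponent (m + 1) p) = homogeneousComponent m (pderiv i p) := by
  ext k
  rw [coeff_pderiv, coeff_homogeneousComponent, coeff_homogeneousComponent, coeff_pderiv, map_add,
    Finsupp.degree_single]
  simp

/-- Closedness holds degree by degree, because differentiation shifts the grading by one. -/
theorem pderiv_homogeneousComponent_comm {i j : Fin d} {p q : MvPolynomial (Fin d) ℝ}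
    (h : pderiv i p = pderiv j q) (m : ℕ) :
    pderiv i (homogeneousComponent m p) = pderiv j (homogeneousComponent m q) := by
  cases m with
  | zero => simp [homogeneousComponent_zero]
  | succ m => rw [pderiv_homogeneousComponent_succ, pderiv_homogeneousComponent_succ, h]

/-- The Poincaré lemma for polynomial fields. -/
theorem exists_potential {v : Fin d → MvPolynomial (Fin d) ℝ} {n : ℕ}
    (hv : ∀ i, v i ∈ restrictTotalDegree (Fin d) ℝ n)
    (hclosed : ∀ i j, pderiv i (v j) = pderiv j (v i)) :
    ∃ f ∈ restrictTotalDegree (Fin d) ℝ (n + 1), ∀ i, pderiv i f = v i := by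
  simp only [mem_restrictTotalDegree] at hv
  -- The integral of the field along rays from the origin; a component of degree `m` contributes
  -- `∫₀¹ t^m dt = 1 / (m + 1)`.
  refine ⟨∑ m ∈ Finset.range (n + 1), ((m : ℝ) + 1)⁻¹ •
    ∑ j, X j * homogeneousComponent m (v j), ?_, fun i => ?_⟩
  · refine Submodule.sum_mem _ fun m hm => Submodule.smul_mem _ _ (Submodule.sum_mem _ fun j _ => ?_)
    rw [mem_restrictTotalDegree]
    have h1 := ((isHomogeneous_X ℝ j).mul
      (homogeneousComponent_isHomogeneous m (v j))).totalDegree_le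
    have := Finset.mem_range.1 hm
    omega
  · have h1 : v i = ∑ m ∈ Finset.range (n + 1), homogeneousComponent m (v i) := by
      conv_lhs => rw [← sum_homogeneousComponent (v i)]
      refine Finset.sum_subset (Finset.range_subset_range.2 (by have := hv i; omega))
        fun m _ hm => homogeneousComponent_eq_zero _ _ ?_
      rw [Finset.mem_range] at hm
      omega
    rw [h1, map_sum]
    refine Finset.sum_congr rfl fun m _ => ?_
    have h2 := (homogeneousComponent_isHomogeneous m (v i)).sum_X_mul_pderiv
    -- Closedness replaces `∂_i v_j` by `∂_j v_i`; the Euler identity then gives `m v_i`, and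
    -- differentiating `X_i` gives one more `v_i`.
    have h3 : pderiv i (∑ j, X j * homogeneousComponent m (v j)) =
        ((m : ℝ) + 1) • homogeneousComponent m (v i) := by
      simp only [map_sum, Derivation.leibniz, smul_eq_mul, Finset.sum_add_distrib,
        pderiv_homogeneousComponent_comm (hclosed i _), h2, pderiv_X, Pi.single_apply, mul_ite,
        mul_one, mul_zero, Finset.sum_ite_eq', Finset.mem_univ, if_true]
      rw [add_smul, one_smul, ← Nat.cast_smul_eq_nsmul ℝ]
    have h4 : ((m : ℝ) + 1) ≠ 0 := by positivity
    rw [Derivation.map_smul, h3, smul_smul, inv_mul_cancel₀ h4, one_smul]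

theorem eq_C_of_pderiv_eq_zero {f : MvPolynomial (Fin d) ℝ} (h : ∀ i, pderiv i f = 0) :
    ∃ r, f = C r := by
  refine ⟨coeff 0 f, ?_⟩
  ext m
  rw [coeff_C]
  split_ifs with hm
  · rw [hm]
  · obtain ⟨i, hi⟩ : ∃ i, m i ≠ 0 := by
      by_contra! h0
      exact hm (Finsupp.ext h0).symm
    have h1 := congrArg (coeff (m - Finsupp.single i 1)) (h i)
    rw [coeff_pderiv, coeff_zero, tsub_add_cancel_of_le (by simpa using Nat.one_le_iff_ne_zero.2 hi)]
      at h1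
    refine (mul_eq_zero.1 h1).resolve_right ?_
    positivity

variable {ι : Type*} [Fintype ι] {s : Finset ι} {J : Type*} {μ : J → ι → ℕ} {n : ℕ}

/-- A constant and the derivatives of the bubbles form a basis on an edge. -/
theorem IsBaryPoly.isBasisOf_pderiv {l : ι → MvPolynomial (Fin 1) ℝ} (h : IsBaryPoly s l)
    (hμ : Function.Injective μ) (hrange : ∀ α, (∃ j, μ j = α) ↔ IsBubble (n + 1) s α)
    {r : ℝ} (hr : r ≠ 0) :
    IsBasisOf (Sum.elim (fun _ : Unit => C r) fun j => pderiv 0 (aeval l (bernsteinPoly (μ j))))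
      (restrictTotalDegree (Fin 1) ℝ n) := by
  have hB := h.isBasisOf_bubbles (Nat.le_add_left 1 n) hμ hrange
  have hJ : Finite J := by
    refine Finite.of_injective
      (fun j => (⟨μ j, ((hrange _).1 ⟨j, rfl⟩).1, ((hrange _).1 ⟨j, rfl⟩).2.1⟩ :
        ClosedIndex (n + 1) s)) fun i j hij => hμ (congrArg Subtype.val hij)
  have : Fintype J := Fintype.ofFinite J
  refine ⟨?_, le_antisymm ?_ ?_⟩
  · rw [Fintype.linearIndependent_iff]
    intro g hg
    rw [Fintype.sum_sum_type] at hg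
    simp only [Finset.univ_unique, Finset.sum_singleton, Sum.elim_inl, Sum.elim_inr] at hg
    obtain ⟨x, hx⟩ := h.exists_X 0
    -- The integrated relation: its primitive is a constant `t`. Writing `X 0` and `t` through the
    -- `λ_k` turns it into a relation in the basis of degree `n + 1`.
    obtain ⟨t, ht⟩ := eq_C_of_pderiv_eq_zero
      (f := (g (Sum.inl default) * r) • X 0 + ∑ j, g (Sum.inr j) • aeval l (bernsteinPoly (μ j)))
      (fun i => by
        rw [Subsingleton.elim i 0, map_add, Derivation.map_smul, pderiv_X_self, map_sum]
        simp only [Derivation.map_smul]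
        rw [← hg]
        congr 1
        simp [smul_eq_C_mul])
    have h1 : ∑ k : s, (g (Sum.inl default) * r * x k - t) • l k +
        ∑ j, g (Sum.inr j) • aeval l (bernsteinPoly (μ j)) = 0 := by
      have hC : C t = ∑ k : s, t • l k := by
        rw [← Finset.smul_sum, Finset.sum_coe_sort s l, h.sum_mem, smul_eq_C_mul, mul_one]
      have hX : (g (Sum.inl default) * r) • (X 0 : MvPolynomial (Fin 1) ℝ) =
          ∑ k : s, (g (Sum.inl default) * r * x k) • l k := by
        rw [hx, Finset.sum_coe_sort s fun k => (g (Sum.inl default) * r * x k) • l k,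
          Finset.smul_sum]
        simp only [smul_smul]
        exact (Finset.sum_subset s.subset_univ fun k _ hk => by
          rw [h.eq_zero k hk, smul_zero]).symm
      simp only [sub_smul, Finset.sum_sub_distrib]
      rw [← hC, ← hX, ← ht]
      ring
    have h2 := Fintype.linearIndependent_iff.1 hB.1
      (Sum.elim (fun k : s => g (Sum.inl default) * r * x k - t) fun j => g (Sum.inr j))
      (by rw [Fintype.sum_sum_type]; exact h1)
    have h3 : ∀ j, g (Sum.inr j) = 0 := fun j => h2 (Sum.inr j)
    rintro (_ | j)
    · simp only [h3, zero_smul, Finset.sum_const_zero, add_zero, smul_eq_C_mul, ← C_mul] at hg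
      exact (mul_eq_zero.1 (C_eq_zero.1 hg)).resolve_right hr
    · exact h3 j
  · rw [Submodule.span_le]
    rintro _ ⟨_ | j, rfl⟩
    · exact (mem_restrictTotalDegree _ _ _).2 ((totalDegree_C r).le.trans (Nat.zero_le n))
    · exact (mem_restrictTotalDegree _ _ _).2
        (totalDegree_pderiv_le ((mem_restrictTotalDegree _ _ _).1 (hB.mem (Sum.inr j))) 0)
  · intro p hp
    -- A primitive of `p` is expanded in the basis of degree `n + 1`, where the `λ_k` have constant
    -- derivatives.
    obtain ⟨f, hf, hfp⟩ := exists_potential (v := fun _ => p) (fun _ => hp)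
      (fun i j => by rw [Subsingleton.elim i j])
    rw [← hfp 0]
    rw [← hB.2] at hf
    have hmap := Submodule.mem_map_of_mem (f := (pderiv (R := ℝ) (0 : Fin 1)).toLinearMap) hf
    refine (Submodule.map_span_le _ _ _).2 ?_ hmap
    rintro _ ⟨k | j, rfl⟩
    · obtain ⟨t, ht⟩ : ∃ t, pderiv 0 (l k) = C t :=
        ⟨_, totalDegree_eq_zero_iff_eq_C.1
          (Nat.le_zero.1 (totalDegree_pderiv_le (h.totalDegree_le k) 0))⟩
      have : pderiv 0 (l k) = (t / r) • C r := by
        rw [ht, smul_eq_C_mul, ← C_mul, div_mul_cancel₀ _ hr]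
      change pderiv 0 (l k) ∈ _
      rw [this]
      exact Submodule.smul_mem _ _ (Submodule.subset_span ⟨Sum.inl (), rfl⟩)
    · exact Submodule.subset_span ⟨Sum.inr j, rfl⟩

end Potentials

/-! ### Bases of planar polynomial vector fields -/

section TangentFields

open MvPolynomial

variable {ι : Type*} [Fintype ι] [DecidableEq ι] {a b c : ι} {l : ι → MvPolynomial (Fin 2) ℝ}
  {n : ℕ}

/-- The rotation of an edge form is `2 dλ_j ∧ dλ_k`, and the three wedges agree cyclically because
the `λ_k` sum to one. -/
theorem IsTrianglePoly.rot_edgeForm (h : IsTrianglePoly a b c l) :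
    rot (pullForm l (edgeForm b c)) = C 2 ∧ rot (pullForm l (edgeForm c a)) = C 2 ∧
      rot (pullForm l (edgeForm a b)) = C 2 := by
  obtain ⟨r0a, h0a⟩ := h.exists_pderiv_eq_C 0 a
  obtain ⟨r1a, h1a⟩ := h.exists_pderiv_eq_C 1 a
  obtain ⟨r0b, h0b⟩ := h.exists_pderiv_eq_C 0 b
  obtain ⟨r1b, h1b⟩ := h.exists_pderiv_eq_C 1 b
  have hW := h.wedge_eq_one
  rw [wedge, h0a, h1a, h0b, h1b] at hW
  have h2 : (C 2 : MvPolynomial (Fin 2) ℝ) = 2 := map_ofNat C 2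
  simp only [rot_apply, pullForm_edgeForm, Derivation.leibniz, map_sub, smul_eq_mul, h.eq_sub, h0a,
    h1a, h0b, h1b, pderiv_C, pderiv_one, map_zero, h2]
  refine ⟨?_, ?_, ?_⟩ <;> linear_combination 2 * hW

/-- The gradient of a function in the plane. -/
noncomputable def planeGrad :
    MvPolynomial (Fin 2) ℝ →ₗ[ℝ] (Fin 2 → MvPolynomial (Fin 2) ℝ) :=
  LinearMap.pi fun i => (pderiv i).toLinearMap

theorem planeGrad_apply (f : MvPolynomial (Fin 2) ℝ) (i : Fin 2) :
    planeGrad f i = pderiv i f := rfl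

theorem rot_planeGrad (f : MvPolynomial (Fin 2) ℝ) : rot (planeGrad f) = 0 := by
  rw [rot_apply, planeGrad_apply, planeGrad_apply, sub_eq_zero]
  ext m
  simp only [coeff_pderiv, Finsupp.add_apply, Finsupp.single_apply, zero_ne_one, one_ne_zero,
    if_false, add_zero]
  rw [add_right_comm]
  ring

/-- The coefficients sum to zero, so the rotations cancel and the field has a potential; `λ_a + λ_b
+ λ_c = 1` makes it explicit. -/
theorem IsTrianglePoly.sum_edgeForm (h : IsTrianglePoly a b c l) (x y : ℝ) :
    x • pullForm l (edgeForm b c) + y • pullForm l (edgeForm c a) +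
      (-x - y) • pullForm l (edgeForm a b) = planeGrad (y • l a - x • l b) := by
  funext i
  simp only [Pi.add_apply, Pi.smul_apply, planeGrad_apply, pullForm_edgeForm, h.eq_sub, map_sub,
    Derivation.map_smul, pderiv_one]
  simp only [smul_eq_C_mul, C_neg, C_sub]
  ring

/-- The edge elements, the gradients of the edge and face bubbles and all but one of the
non-gradient face bubbles form a basis of a space of fields that contains them, if the rotations in
the space have degree at most `m` and the rotation-free fields in it have degree at most `n`. -/
theorem IsTrianglePoly.isBasisOf_fields (h : IsTrianglePoly a b c l) {m : ℕ}
    (β : ClosedIndex m {a, b, c}) {J : Type*} {μ : J → ι → ℕ} (hμ : Function.Injective μ)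
    (hrange : ∀ α, (∃ j, μ j = α) ↔ IsBubble (n + 1) {a, b, c} α)
    {V : Submodule ℝ (Fin 2 → MvPolynomial (Fin 2) ℝ)}
    (hω : ∀ j k, pullForm l (edgeForm j k) ∈ V)
    (hgrad : ∀ j, planeGrad (aeval l (bernsteinPoly (μ j))) ∈ V)
    (hbub : ∀ α : ClosedIndex m {a, b, c}, pullForm l (bubbleForm a b c m α.1) ∈ V)
    (hrot : ∀ v ∈ V, rot v ∈ restrictTotalDegree (Fin 2) ℝ m)
    (hker : ∀ v ∈ V, rot v = 0 → ∀ i, v i ∈ restrictTotalDegree (Fin 2) ℝ n) :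
    IsBasisOf (Sum.elim (fun i : Fin 3 => pullForm l
        (![edgeForm b c, edgeForm c a, edgeForm a b] i))
      (Sum.elim (fun j => planeGrad (aeval l (bernsteinPoly (μ j))))
        fun α : {α : ClosedIndex m {a, b, c} // α ≠ β} =>
          pullForm l (bubbleForm a b c m α.1.1))) V := by
  have hB := h.isBasisOf_bubbles (Nat.le_add_left 1 n) hμ hrange
  have hR := h.isBasisOf_rot β (two_ne_zero (α := ℝ))
  obtain ⟨hbc, hca, hab⟩ := h.rot_edgeForm
  have hJ : Finite J := by
    refine Finite.of_injective
      (fun j => (⟨μ j, ((hrange _).1 ⟨j, rfl⟩).1, ((hrange _).1 ⟨j, rfl⟩).2.1⟩ :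
        ClosedIndex (n + 1) {a, b, c})) fun i j hij => hμ (congrArg Subtype.val hij)
  have : Fintype J := Fintype.ofFinite J
  have : Fintype (ClosedIndex m {a, b, c}) := Fintype.ofFinite _
  have : Fintype {α : ClosedIndex m {a, b, c} // α ≠ β} := Fintype.ofFinite _
  refine ⟨?_, le_antisymm ?_ ?_⟩
  · rw [Fintype.linearIndependent_iff]
    intro g hg
    simp only [Fintype.sum_sum_type, Fin.sum_univ_three, Sum.elim_inl, Sum.elim_inr,
      Matrix.cons_val] at hg
    set x := g (Sum.inl 0)
    set y := g (Sum.inl 1)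
    set z := g (Sum.inl 2)
    -- The rotation removes the gradients and leaves a relation between the constant `2 (x + y + z)`
    -- and the rotations of the bubbles.
    have hrot0 := congrArg rot hg
    simp only [map_add, map_smul, map_sum, hbc, hca, hab, rot_planeGrad, smul_zero,
      Finset.sum_const_zero, zero_add, map_zero] at hrot0
    have h1 := Fintype.linearIndependent_iff.1 hR.1
      (Sum.elim (fun _ => x + y + z) fun α => g (Sum.inr (Sum.inr α)))
      (by
        rw [Fintype.sum_sum_type]
        simpa [add_smul] using hrot0)
    have hbub0 : ∀ α, g (Sum.inr (Sum.inr α)) = 0 := fun α => h1 (Sum.inr α)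
    have hz : z = -x - y := by linarith [show x + y + z = 0 from h1 (Sum.inl ())]
    simp only [hbub0, zero_smul, Finset.sum_const_zero, add_zero, hz, h.sum_edgeForm] at hg
    -- What remains is a vanishing gradient, so its potential is a constant `t`.
    obtain ⟨t, ht⟩ := eq_C_of_pderiv_eq_zero
      (f := y • l a - x • l b + ∑ j, g (Sum.inr (Sum.inl j)) • aeval l (bernsteinPoly (μ j)))
      (fun i => by
        rw [← planeGrad_apply, map_add, map_sum]
        simp only [map_smul]
        rw [hg, Pi.zero_apply])
    -- The coefficients of `y λ_a - x λ_b - t`, with `t` written as `t (λ_a + λ_b + λ_c)`.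
    let w : ι → ℝ := fun k => if k = a then y - t else if k = b then -x - t else -t
    have wa : w a = y - t := if_pos rfl
    have wb : w b = -x - t := (if_neg h.ne_ab.symm).trans (if_pos rfl)
    have wc : w c = -t := (if_neg h.ne_ac.symm).trans (if_neg h.ne_bc.symm)
    have h2 := Fintype.linearIndependent_iff.1 hB.1
      (Sum.elim (fun k => w k.1) fun j => g (Sum.inr (Sum.inl j)))
      (by
        rw [Fintype.sum_sum_type]
        simp only [Sum.elim_inl, Sum.elim_inr]
        rw [Finset.sum_coe_sort {a, b, c} fun k => w k • l k, sum_triple h.ne_ab h.ne_ac h.ne_bc,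
          wa, wb, wc, ← sub_eq_zero.2 ht, h.eq_sub]
        simp only [smul_eq_C_mul, C_neg, C_sub]
        ring)
    have ha : y - t = 0 := wa ▸ h2 (Sum.inl ⟨a, by simp⟩)
    have hb : -x - t = 0 := wb ▸ h2 (Sum.inl ⟨b, by simp⟩)
    have hc : -t = 0 := wc ▸ h2 (Sum.inl ⟨c, by simp⟩)
    rintro (i | j | α)
    · have hx : x = 0 := by linarith
      have hy : y = 0 := by linarith
      have hz0 : z = 0 := by linarith
      fin_cases i
      · exact hx
      · exact hy
      · exact hz0
    · exact h2 (Sum.inr j)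
    · exact hbub0 α
  · rw [Submodule.span_le]
    rintro _ ⟨i | j | α, rfl⟩
    · fin_cases i
      · exact hω b c
      · exact hω c a
      · exact hω a b
    · exact hgrad j
    · exact hbub α.1
  · intro v hv
    set S := Submodule.span ℝ (Set.range (Sum.elim (fun i : Fin 3 => pullForm l
        (![edgeForm b c, edgeForm c a, edgeForm a b] i))
      (Sum.elim (fun j => planeGrad (aeval l (bernsteinPoly (μ j))))
        fun α : {α : ClosedIndex m {a, b, c} // α ≠ β} =>
          pullForm l (bubbleForm a b c m α.1.1)))) with hS
    have mbc : pullForm l (edgeForm b c) ∈ S := Submodule.subset_span ⟨Sum.inl 0, rfl⟩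
    have mca : pullForm l (edgeForm c a) ∈ S := Submodule.subset_span ⟨Sum.inl 1, rfl⟩
    have mab : pullForm l (edgeForm a b) ∈ S := Submodule.subset_span ⟨Sum.inl 2, rfl⟩
    have hrv := hrot v hv
    rw [← hR.2, Submodule.mem_span_range_iff_exists_fun] at hrv
    obtain ⟨g, hg⟩ := hrv
    rw [Fintype.sum_sum_type] at hg
    simp only [Finset.univ_unique, Finset.sum_singleton, Sum.elim_inl, Sum.elim_inr] at hg
    -- A member of the span with the same rotation as `v`; the difference is then a gradient.
    set v₀ := g (Sum.inl default) • pullForm l (edgeForm a b) +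
      ∑ α, g (Sum.inr α) • pullForm l (bubbleForm a b c m α.1.1)
    have hv₀S : v₀ ∈ S := add_mem (S.smul_mem _ mab) (S.sum_mem fun α _ => S.smul_mem _
      (Submodule.subset_span ⟨Sum.inr (Sum.inr α), rfl⟩))
    have hv₀V : v₀ ∈ V := add_mem (V.smul_mem _ (hω a b)) (V.sum_mem fun α _ => V.smul_mem _
      (hbub α.1))
    have hrot0 : rot (v - v₀) = 0 := by
      rw [map_sub, ← hg, sub_eq_zero]
      simp only [v₀, map_add, map_smul, map_sum, hab]
    obtain ⟨f, hf, hfv⟩ := exists_potential (hker _ (sub_mem hv hv₀V) hrot0) (by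
      rw [rot_apply, sub_eq_zero] at hrot0
      intro i j
      fin_cases i <;> fin_cases j
      · rfl
      · exact hrot0
      · exact hrot0.symm
      · rfl)
    have hfv' : planeGrad f = v - v₀ := funext hfv
    have hfS : planeGrad f ∈ S := by
      rw [← hB.2] at hf
      have hmap := Submodule.mem_map_of_mem (f := planeGrad) hf
      refine (Submodule.map_span_le _ _ _).2 ?_ hmap
      have hla : planeGrad (l a) ∈ S := by
        have := h.sum_edgeForm 0 1
        simp only [zero_smul, one_smul, zero_add, sub_zero] at this
        rw [← this]
        exact add_mem mca (S.smul_mem _ mab)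
      have hlb : planeGrad (l b) ∈ S := by
        have := h.sum_edgeForm (-1) 0
        simp only [zero_smul, add_zero, zero_sub, neg_smul, one_smul, neg_neg] at this
        rw [← this]
        exact add_mem (S.neg_mem mbc) (S.smul_mem _ mab)
      rintro _ ⟨⟨k, hk⟩ | j, rfl⟩
      · simp only [Finset.mem_insert, Finset.mem_singleton] at hk
        rcases hk with rfl | rfl | rfl
        · exact hla
        · exact hlb
        · have : planeGrad (l k) = - planeGrad (l a) - planeGrad (l b) := by
            funext i
            simp [h.eq_sub, planeGrad_apply]
          simp only [Sum.elim_inl]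
          rw [this]
          exact sub_mem (S.neg_mem hla) hlb
      · exact Submodule.subset_span ⟨Sum.inr (Sum.inl j), rfl⟩
    have : v = planeGrad f + v₀ := by rw [hfv', sub_add_cancel]
    rw [this]
    exact add_mem hfS hv₀S

/-- The fields with components of degree at most `n`. -/
noncomputable def polyFields (n : ℕ) : Submodule ℝ (Fin 2 → MvPolynomial (Fin 2) ℝ) :=
  Submodule.pi Set.univ fun _ => restrictTotalDegree (Fin 2) ℝ n

theorem mem_polyFields {v : Fin 2 → MvPolynomial (Fin 2) ℝ} :
    v ∈ polyFields n ↔ ∀ i, v i ∈ restrictTotalDegree (Fin 2) ℝ n := by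
  simp [polyFields, Submodule.mem_pi]

/-- The field `(x₂ q, - x₁ q)`. -/
noncomputable def rotField :
    MvPolynomial (Fin 2) ℝ →ₗ[ℝ] (Fin 2 → MvPolynomial (Fin 2) ℝ) :=
  LinearMap.pi ![LinearMap.mulLeft ℝ (X 1), LinearMap.mulLeft ℝ (-X 0)]

theorem rotField_apply (q : MvPolynomial (Fin 2) ℝ) : rotField q = ![X 1 * q, -(X 0 * q)] := by
  funext i
  fin_cases i <;> simp [rotField]

/-- The fields `(x₂ q, - x₁ q)` with `q` homogeneous of degree `n`. -/
noncomputable def rotFields (n : ℕ) : Submodule ℝ (Fin 2 → MvPolynomial (Fin 2) ℝ) :=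
  (homogeneousSubmodule (Fin 2) ℝ n).map rotField

/-- Differentiating the two coordinates gives `-2 q`, and the Euler identity gives `-n q`. -/
theorem rot_rotField {q : MvPolynomial (Fin 2) ℝ} (hq : q.IsHomogeneous n) :
    rot (rotField q) = -((n : ℝ) + 2) • q := by
  have h1 := hq.sum_X_mul_pderiv
  rw [Fin.sum_univ_two, nsmul_eq_mul] at h1
  rw [rot_apply, rotField_apply]
  have h2 : (C 2 : MvPolynomial (Fin 2) ℝ) = 2 := map_ofNat C 2
  simp only [Matrix.cons_val_zero, Matrix.cons_val_one, map_neg, Derivation.leibniz, smul_eq_mul,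
    pderiv_X_self, smul_eq_C_mul, C_add, h2, map_natCast]
  linear_combination -h1

/-- The rotation lowers the degree, so components of degree at most `n` leave nothing in degree `n`.
Hence the degree `n` part of the rotation detects the summand `rotField q`. -/
theorem homogeneousComponent_rot_eq_zero {v : Fin 2 → MvPolynomial (Fin 2) ℝ}
    (hv : v ∈ polyFields n) : homogeneousComponent n (rot v) = 0 := by
  have h : ∀ i j, homogeneousComponent n (pderiv i (v j)) = 0 := fun i j => by
    rw [← pderiv_homogeneousComponent_succ, homogeneousComponent_eq_zero, map_zero]
    exact Nat.lt_succ_of_le ((mem_restrictTotalDegree _ _ _).1 (mem_polyFields.1 hv j))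
  rw [rot_apply, map_sub, h, h, sub_zero]

theorem eq_zero_of_homogeneousComponent_rot {q : MvPolynomial (Fin 2) ℝ} (hq : q.IsHomogeneous n)
    (h : homogeneousComponent n (rot (rotField q)) = 0) : q = 0 := by
  rw [rot_rotField hq, map_smul, homogeneousComponent_eq_self hq] at h
  refine (smul_eq_zero.1 h).resolve_left (neg_ne_zero.2 ?_)
  positivity

theorem disjoint_polyFields_rotFields : Disjoint (polyFields n) (rotFields n) := by
  rw [Submodule.disjoint_def]
  rintro _ hv ⟨q, hq, rfl⟩
  rw [eq_zero_of_homogeneousComponent_rot hq (homogeneousComponent_rot_eq_zero hv), map_zero]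

theorem rot_mem_of_mem_sup {v : Fin 2 → MvPolynomial (Fin 2) ℝ}
    (hv : v ∈ polyFields n ⊔ rotFields n) : rot v ∈ restrictTotalDegree (Fin 2) ℝ n := by
  obtain ⟨w, hw, _, ⟨q, hq, rfl⟩, rfl⟩ := Submodule.mem_sup.1 hv
  rw [map_add]
  refine add_mem ?_ ?_
  · rw [rot_apply]
    have h : ∀ i j, pderiv i (w j) ∈ restrictTotalDegree (Fin 2) ℝ n := fun i j =>
      (mem_restrictTotalDegree _ _ _).2 (totalDegree_pderiv_le
        (((mem_restrictTotalDegree _ _ _).1 (mem_polyFields.1 hw j)).trans (Nat.le_succ n)) i)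
    exact sub_mem (h _ _) (h _ _)
  · rw [rot_rotField hq]
    exact Submodule.smul_mem _ _ ((mem_restrictTotalDegree _ _ _).2 hq.totalDegree_le)

theorem mem_polyFields_of_rot_eq_zero {v : Fin 2 → MvPolynomial (Fin 2) ℝ}
    (hv : v ∈ polyFields n ⊔ rotFields n) (h : rot v = 0) : v ∈ polyFields n := by
  obtain ⟨w, hw, _, ⟨q, hq, rfl⟩, rfl⟩ := Submodule.mem_sup.1 hv
  have h1 := congrArg (homogeneousComponent n) h
  rw [map_add, map_add, homogeneousComponent_rot_eq_zero hw, zero_add, map_zero] at h1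
  rwa [eq_zero_of_homogeneousComponent_rot hq h1, map_zero, add_zero]

/-- Only the top-degree part of `q` leaves `polyFields n`; the lower parts yield components of
degree at most `n`. -/
theorem rotField_mem_sup {q : MvPolynomial (Fin 2) ℝ}
    (hq : q ∈ restrictTotalDegree (Fin 2) ℝ n) : rotField q ∈ polyFields n ⊔ rotFields n := by
  rw [mem_restrictTotalDegree] at hq
  rw [← sum_homogeneousComponent q, map_sum]
  refine Submodule.sum_mem _ fun m hm => ?_
  have hmn : m ≤ n := by have := Finset.mem_range.1 hm; omega
  rcases hmn.eq_or_lt with rfl | hlt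
  · exact Submodule.mem_sup_right ⟨_, homogeneousComponent_isHomogeneous m q, rfl⟩
  · refine Submodule.mem_sup_left (mem_polyFields.2 fun i => ?_)
    have h : ∀ j, X j * homogeneousComponent m q ∈ restrictTotalDegree (Fin 2) ℝ n := fun j => by
      rw [mem_restrictTotalDegree]
      have := ((isHomogeneous_X ℝ j).mul (homogeneousComponent_isHomogeneous m q)).totalDegree_le
      omega
    rw [rotField_apply]
    fin_cases i
    · exact h 1
    · exact neg_mem (h 0)

omit [DecidableEq ι] in
theorem IsBaryPoly.exists_affine {s : Finset ι} (h : IsBaryPoly s l) (k : ι) :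
    ∃ r₀ r₁ r : ℝ, l k = C r + C r₀ * X 0 + C r₁ * X 1 ∧ pderiv 0 (l k) = C r₀ ∧
      pderiv 1 (l k) = C r₁ := by
  obtain ⟨r₀, h0⟩ := h.exists_pderiv_eq_C 0 k
  obtain ⟨r₁, h1⟩ := h.exists_pderiv_eq_C 1 k
  obtain ⟨r, hr⟩ := eq_C_of_pderiv_eq_zero (f := l k - C r₀ * X 0 - C r₁ * X 1) (fun i => by
    fin_cases i
    · simp [h0, pderiv_X]
    · simp [h1, pderiv_X])
  exact ⟨r₀, r₁, r, by linear_combination hr, h0, h1⟩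

/-- An edge form has affine components whose linear part, being antisymmetric in the two gradients,
is a multiple of `(x₂, -x₁)`. Multiplication by `p` therefore gives a field in `polyFields n` plus a
multiple of `rotField p`. -/
theorem IsBaryPoly.mul_edgeForm_mem_sup {s : Finset ι} (h : IsBaryPoly s l) (j k : ι)
    {p : MvPolynomial (Fin 2) ℝ} (hp : p ∈ restrictTotalDegree (Fin 2) ℝ n) :
    (fun i => p * pullForm l (edgeForm j k) i) ∈ polyFields n ⊔ rotFields n := by
  obtain ⟨j₀, j₁, r, hj, hj0, hj1⟩ := h.exists_affine j
  obtain ⟨k₀, k₁, t, hk, hk0, hk1⟩ := h.exists_affine k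
  have h1 : (fun i => p * pullForm l (edgeForm j k) i) =
      ![(r * k₀ - t * j₀) • p, (r * k₁ - t * j₁) • p] + (j₁ * k₀ - j₀ * k₁) • rotField p := by
    funext i
    rw [pullForm_edgeForm, rotField_apply]
    fin_cases i
    · simp only [Fin.zero_eta, hj0, hk0]
      simp only [hj, hk, Pi.add_apply, Pi.smul_apply, Matrix.cons_val_zero, smul_eq_C_mul, C_sub,
        C_mul]
      ring
    · simp only [Fin.mk_one, hj1, hk1]
      simp only [hj, hk, Pi.add_apply, Pi.smul_apply, Matrix.cons_val_one,
        Matrix.cons_val_fin_one, smul_eq_C_mul, C_sub, C_mul]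
      ring
  rw [h1]
  refine add_mem (Submodule.mem_sup_left (mem_polyFields.2 fun i => ?_))
    (Submodule.smul_mem _ _ (rotField_mem_sup hp))
  fin_cases i
  · exact Submodule.smul_mem _ _ hp
  · exact Submodule.smul_mem _ _ hp

theorem IsBaryPoly.mul_edgeForm_mem {s : Finset ι} (h : IsBaryPoly s l) (j k : ι)
    {p : MvPolynomial (Fin 2) ℝ} (hp : p ∈ restrictTotalDegree (Fin 2) ℝ n) :
    (fun i => p * pullForm l (edgeForm j k) i) ∈ polyFields (n + 1) := by
  refine mem_polyFields.2 fun i => ?_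
  rw [mem_restrictTotalDegree] at hp ⊢
  refine (totalDegree_mul _ _).trans (add_le_add hp ?_)
  rw [pullForm_edgeForm]
  have h1 : ∀ j k, (l j * pderiv i (l k)).totalDegree ≤ 1 := fun j k => by
    obtain ⟨r, hr⟩ := h.exists_pderiv_eq_C i k
    refine (totalDegree_mul _ _).trans ?_
    rw [hr, totalDegree_C]
    exact h.totalDegree_le j
  exact (totalDegree_sub _ _).trans (max_le (h1 _ _) (h1 _ _))

theorem pullForm_bubbleForm_mem {V : Submodule ℝ (Fin 2 → MvPolynomial (Fin 2) ℝ)}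
    {α : ι → ℕ} (hV : ∀ j k, (fun i => aeval l (bernsteinPoly α) *
      pullForm l (edgeForm j k) i) ∈ V) : pullForm l (bubbleForm a b c n α) ∈ V := by
  have h1 : pullForm l (bubbleForm a b c n α) = ((n : ℝ) + 1) •
      ((α a : ℝ) • (fun i => aeval l (bernsteinPoly α) * pullForm l (edgeForm b c) i) +
        (α b : ℝ) • (fun i => aeval l (bernsteinPoly α) * pullForm l (edgeForm c a) i) +
        (α c : ℝ) • fun i => aeval l (bernsteinPoly α) * pullForm l (edgeForm a b) i) := by
    funext i
    rw [pullForm_bubbleForm]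
    simp only [Pi.smul_apply, Pi.add_apply, smul_eq_C_mul]
    ring
  rw [h1]
  exact V.smul_mem _ (add_mem (add_mem (V.smul_mem _ (hV _ _)) (V.smul_mem _ (hV _ _)))
    (V.smul_mem _ (hV _ _)))

omit [DecidableEq ι] in
theorem IsBaryPoly.planeGrad_mem {s : Finset ι} (h : IsBaryPoly s l) {α : ι → ℕ}
    (hα : IsBubble (n + 1) s α) : planeGrad (aeval l (bernsteinPoly α)) ∈ polyFields n :=
  mem_polyFields.2 fun i => (mem_restrictTotalDegree _ _ _).2 (totalDegree_pderiv_le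
    ((mem_restrictTotalDegree _ _ _).1
      ((h.isBasisOf_bernstein (n + 1)).mem ⟨α, hα.1, hα.2.1⟩)) i)

/-- Here rotations reach degree `n`, the degree of the bubbles, while rotation-free fields lose the
summand `rotField q`. -/
theorem IsTrianglePoly.isBasisOf_sup (h : IsTrianglePoly a b c l)
    (β : ClosedIndex n {a, b, c}) {J : Type*} {μ : J → ι → ℕ} (hμ : Function.Injective μ)
    (hrange : ∀ α, (∃ j, μ j = α) ↔ IsBubble (n + 1) {a, b, c} α) :
    IsBasisOf (Sum.elim (fun i : Fin 3 => pullForm l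
        (![edgeForm b c, edgeForm c a, edgeForm a b] i))
      (Sum.elim (fun j => planeGrad (aeval l (bernsteinPoly (μ j))))
        fun α : {α : ClosedIndex n {a, b, c} // α ≠ β} =>
          pullForm l (bubbleForm a b c n α.1.1))) (polyFields n ⊔ rotFields n) := by
  refine h.isBasisOf_fields β hμ hrange (fun j k => ?_)
    (fun j => Submodule.mem_sup_left (h.planeGrad_mem ((hrange _).1 ⟨j, rfl⟩)))
    (fun α => pullForm_bubbleForm_mem fun j k =>
      h.mul_edgeForm_mem_sup j k ((h.isBasisOf_bernstein n).mem α))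
    (fun v hv => rot_mem_of_mem_sup hv)
    (fun v hv h0 => mem_polyFields.1 (mem_polyFields_of_rot_eq_zero hv h0))
  have h1 : (1 : MvPolynomial (Fin 2) ℝ) ∈ restrictTotalDegree (Fin 2) ℝ n :=
    (mem_restrictTotalDegree _ _ _).2 (totalDegree_one.le.trans (Nat.zero_le n))
  simpa only [one_mul] using h.mul_edgeForm_mem_sup j k h1

/-- Fields of degree `n + 1` have rotations of degree only `n`, so the non-gradient bubbles are
taken one degree lower. -/
theorem IsTrianglePoly.isBasisOf_polyFields (h : IsTrianglePoly a b c l)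
    (β : ClosedIndex n {a, b, c}) {J : Type*} {μ : J → ι → ℕ} (hμ : Function.Injective μ)
    (hrange : ∀ α, (∃ j, μ j = α) ↔ IsBubble (n + 2) {a, b, c} α) :
    IsBasisOf (Sum.elim (fun i : Fin 3 => pullForm l
        (![edgeForm b c, edgeForm c a, edgeForm a b] i))
      (Sum.elim (fun j => planeGrad (aeval l (bernsteinPoly (μ j))))
        fun α : {α : ClosedIndex n {a, b, c} // α ≠ β} =>
          pullForm l (bubbleForm a b c n α.1.1))) (polyFields (n + 1)) := by
  refine h.isBasisOf_fields β hμ hrange (fun j k => ?_)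
    (fun j => h.planeGrad_mem ((hrange _).1 ⟨j, rfl⟩))
    (fun α => pullForm_bubbleForm_mem fun j k =>
      h.mul_edgeForm_mem j k ((h.isBasisOf_bernstein n).mem α))
    (fun v hv => ?_) (fun v hv _ => mem_polyFields.1 hv)
  · have h1 : (1 : MvPolynomial (Fin 2) ℝ) ∈ restrictTotalDegree (Fin 2) ℝ n :=
      (mem_restrictTotalDegree _ _ _).2 (totalDegree_one.le.trans (Nat.zero_le n))
    simpa only [one_mul] using h.mul_edgeForm_mem j k h1
  · have h1 : ∀ i j, pderiv i (v j) ∈ restrictTotalDegree (Fin 2) ℝ n := fun i j =>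
      (mem_restrictTotalDegree _ _ _).2 (totalDegree_pderiv_le
        ((mem_restrictTotalDegree _ _ _).1 (mem_polyFields.1 hv j)) i)
    rw [rot_apply]
    exact sub_mem (h1 _ _) (h1 _ _)

end TangentFields

/-! ### Barycentric coordinates and their affine extensions -/

section Barycentric

variable {ι : Type*} [Fintype ι] {y : ι → E3}

/-- Affine independence makes the chosen weights unique. -/
theorem bary_eq_of_sum (hy : AffineIndependent ℝ y) {w : ι → ℝ} (hw : ∑ k, w k = 1) (k : ι) :
    bary y k (∑ j, w j • y j) = w k := by
  have hex : ∃ w' : ι → ℝ, ∑ k, w' k = 1 ∧ ∑ j, w j • y j = ∑ k, w' k • y k := ⟨w, hw, rfl⟩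
  rw [bary, dif_pos hex]
  refine congrFun ((affineIndependent_iff_eq_of_fintype_affineCombination_eq ℝ y).1 hy _ _
    hex.choose_spec.1 hw ?_) k
  rw [Finset.affineCombination_eq_linear_combination _ _ _ hex.choose_spec.1,
    Finset.affineCombination_eq_linear_combination _ _ _ hw]
  exact hex.choose_spec.2.symm

/-- `g` and `a` are the gradients and the constants of affine extensions of the barycentric
coordinates. -/
def IsDualFrame [DecidableEq ι] (y : ι → E3) (g : ι → E3) (a : ι → ℝ) : Prop :=
  ∀ k j, inner ℝ (g k) (y j) + a k = if j = k then 1 else 0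

omit [Fintype ι] in
-- The edge vectors from a base vertex are independent, so a linear functional can take prescribed
-- values on them; the Riesz representation gives the gradient. Extensions need not be unique when
-- the vertices do not span the space.
theorem exists_isDualFrame [DecidableEq ι] [Nonempty ι] (hy : AffineIndependent ℝ y) :
    ∃ g a, IsDualFrame y g a := by
  obtain ⟨j₀⟩ := ‹Nonempty ι›
  have hv := (affineIndependent_iff_linearIndependent_vsub ℝ y j₀).1 hy
  have h : ∀ k, ∃ (g : E3) (a : ℝ), ∀ j, inner ℝ g (y j) + a = if j = k then 1 else 0 := by
    intro k
    obtain ⟨φ, hφ⟩ := IsBasisOf.exists_functional ⟨hv, rfl⟩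
      (fun j => (if j.1 = k then 1 else 0) - if j₀ = k then 1 else 0)
    have hg : ∀ z, inner ℝ ((InnerProductSpace.toDual ℝ E3).symm
        (LinearMap.toContinuousLinearMap φ)) z = φ z := fun z =>
      InnerProductSpace.toDual_symm_apply
    refine ⟨(InnerProductSpace.toDual ℝ E3).symm (LinearMap.toContinuousLinearMap φ),
      (if j₀ = k then 1 else 0) - φ (y j₀), fun j => ?_⟩
    rw [hg]
    by_cases hj : j = j₀
    · rw [hj]
      ring
    · have := hφ ⟨j, hj⟩
      rw [vsub_eq_sub, map_sub] at this
      linarith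
  choose g a hga using h
  exact ⟨g, a, hga⟩

theorem IsDualFrame.apply_sum [DecidableEq ι] {g : ι → E3} {a : ι → ℝ} (h : IsDualFrame y g a)
    {w : ι → ℝ} (hw : ∑ k, w k = 1) (k : ι) : inner ℝ (g k) (∑ j, w j • y j) + a k = w k := by
  have h1 : ∑ j, w j * (inner ℝ (g k) (y j) + a k) = w k := by
    simp only [h k, mul_ite, mul_one, mul_zero, Finset.sum_ite_eq', Finset.mem_univ, if_true]
  simp only [mul_add, Finset.sum_add_distrib, ← Finset.sum_mul, hw, one_mul] at h1
  rw [← h1, inner_sum]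
  simp only [real_inner_smul_right]

end Barycentric

/-! ### Coordinates on a subsimplex -/

section Chart

open MvPolynomial

variable {ι : Type*} [Fintype ι] [DecidableEq ι] {d : ℕ}

/-- The subsimplex with vertices `y (e i)`. -/
def subsimplex (y : ι → E3) (e : Fin (d + 1) ↪ ι) : Set E3 :=
  convexHull ℝ (Set.range fun i => y (e i))

/-- The edge vectors that end at the last vertex of the subsimplex. -/
def edgeVector (y : ι → E3) (e : Fin (d + 1) ↪ ι) (i : Fin d) : E3 :=
  y (e i.castSucc) - y (e (Fin.last d))

/-- The coordinates on the plane of a subsimplex with origin `o`. -/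
noncomputable def chart (y : ι → E3) (e : Fin (d + 1) ↪ ι) (o p : E3) (i : Fin d) : ℝ :=
  bary y (e i.castSucc) p - bary y (e i.castSucc) o

/-- The barycentric coordinates on a subsimplex as polynomials in the coordinates `chart`. -/
noncomputable def chartPoly (y : ι → E3) (e : Fin (d + 1) ↪ ι) (o : E3) (k : ι) :
    MvPolynomial (Fin d) ℝ :=
  C (bary y k o) +
    ∑ i, C ((if e i.castSucc = k then 1 else 0) - if e (Fin.last d) = k then 1 else 0) * X i

variable {y : ι → E3} {e : Fin (d + 1) ↪ ι} {o p : E3} {g : ι → E3} {a : ι → ℝ}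

omit [Fintype ι] in
theorem IsDualFrame.inner_edgeVector (h : IsDualFrame y g a) (k : ι) (i : Fin d) :
    inner ℝ (g k) (edgeVector y e i) =
      (if e i.castSucc = k then 1 else 0) - if e (Fin.last d) = k then 1 else 0 := by
  rw [edgeVector, inner_sub_right, ← h k, ← h k]
  ring

omit [DecidableEq ι] in
theorem sum_eq_sum_embedding {M : Type*} [AddCommMonoid M] (e : Fin (d + 1) ↪ ι) {f : ι → M}
    (hf : ∀ k, k ∉ Set.range e → f k = 0) : ∑ k, f k = ∑ i, f (e i) :=
  (Fintype.sum_of_injective e e.injective _ _ hf fun _ => rfl).symm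

omit [DecidableEq ι] in
theorem mem_affineSpan_subsimplex_iff : p ∈ affineSpan ℝ (subsimplex y e) ↔
    ∃ w : ι → ℝ, ∑ k, w k = 1 ∧ (∀ k, k ∉ Set.range e → w k = 0) ∧ p = ∑ k, w k • y k := by
  rw [subsimplex, affineSpan_convexHull]
  constructor
  · intro hp
    obtain ⟨w, hw, rfl⟩ := eq_affineCombination_of_mem_affineSpan_of_fintype hp
    have h0 : ∀ k, k ∉ Set.range e → Function.extend e w 0 k = 0 := fun k hk => by
      rw [Function.extend_apply' _ _ _ hk, Pi.zero_apply]
    refine ⟨Function.extend e w 0, ?_, h0, ?_⟩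
    · rw [sum_eq_sum_embedding e h0, ← hw]
      simp only [e.injective.extend_apply]
    · rw [sum_eq_sum_embedding e fun k hk => by rw [h0 k hk, zero_smul],
        Finset.affineCombination_eq_linear_combination _ _ _ hw]
      simp only [e.injective.extend_apply]
  · rintro ⟨w, hw, h0, rfl⟩
    rw [sum_eq_sum_embedding e h0] at hw
    rw [sum_eq_sum_embedding e fun k hk => by rw [h0 k hk, zero_smul],
      ← Finset.affineCombination_eq_linear_combination Finset.univ (fun i => y (e i))
        (fun i => w (e i)) hw]
    exact affineCombination_mem_affineSpan hw _

omit [DecidableEq ι] in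
theorem mem_subsimplex_of_weights {w : ι → ℝ} (hw : ∑ k, w k = 1)
    (h0 : ∀ k, k ∉ Set.range e → w k = 0) (hnn : ∀ k, 0 ≤ w k) :
    ∑ k, w k • y k ∈ subsimplex y e := by
  rw [sum_eq_sum_embedding e h0] at hw
  rw [sum_eq_sum_embedding e fun k hk => by rw [h0 k hk, zero_smul]]
  exact (convex_convexHull ℝ _).sum_mem (fun i _ => hnn _) hw
    fun i _ => subset_convexHull ℝ _ ⟨i, rfl⟩

omit [Fintype ι] [DecidableEq ι] in
theorem mem_affineSpan_of_mem (hp : p ∈ subsimplex y e) : p ∈ affineSpan ℝ (subsimplex y e) :=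
  subset_affineSpan ℝ _ hp

section Affine

variable (hy : AffineIndependent ℝ y)

include hy

omit [DecidableEq ι] in
theorem sum_bary (hp : p ∈ affineSpan ℝ (subsimplex y e)) : ∑ k, bary y k p = 1 := by
  obtain ⟨w, hw, -, rfl⟩ := mem_affineSpan_subsimplex_iff.1 hp
  simpa only [bary_eq_of_sum hy hw] using hw

omit [DecidableEq ι] in
theorem sum_bary_smul (hp : p ∈ affineSpan ℝ (subsimplex y e)) :
    ∑ k, bary y k p • y k = p := by
  obtain ⟨w, hw, -, rfl⟩ := mem_affineSpan_subsimplex_iff.1 hp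
  simp only [bary_eq_of_sum hy hw]

omit [DecidableEq ι] in
theorem bary_eq_zero (hp : p ∈ affineSpan ℝ (subsimplex y e)) {k : ι} (hk : k ∉ Set.range e) :
    bary y k p = 0 := by
  obtain ⟨w, hw, h0, rfl⟩ := mem_affineSpan_subsimplex_iff.1 hp
  rw [bary_eq_of_sum hy hw, h0 k hk]

theorem IsDualFrame.bary_eq (h : IsDualFrame y g a) (hp : p ∈ affineSpan ℝ (subsimplex y e))
    (k : ι) : bary y k p = inner ℝ (g k) p + a k := by
  obtain ⟨w, hw, h0, rfl⟩ := mem_affineSpan_subsimplex_iff.1 hp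
  rw [bary_eq_of_sum hy hw, h.apply_sum hw]

omit [DecidableEq ι] in
-- Differences of barycentric weights sum to zero, so the last vertex can be eliminated: `chart`
-- gives the coordinates of `p - o` in the basis of edge vectors.
theorem sub_eq_sum_chart (ho : o ∈ affineSpan ℝ (subsimplex y e))
    (hp : p ∈ affineSpan ℝ (subsimplex y e)) :
    p - o = ∑ i, chart y e o p i • edgeVector y e i := by
  have h1 : ∀ k, k ∉ Set.range e → (bary y k p - bary y k o) • y k = 0 := fun k hk => by
    rw [bary_eq_zero hy hp hk, bary_eq_zero hy ho hk, sub_zero, zero_smul]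
  have h2 : ∑ i, (bary y (e i) p - bary y (e i) o) = 0 := by
    rw [← sum_eq_sum_embedding e (f := fun k => bary y k p - bary y k o) fun k hk => by
      rw [bary_eq_zero hy hp hk, bary_eq_zero hy ho hk, sub_zero], Finset.sum_sub_distrib,
      sum_bary hy hp, sum_bary hy ho, sub_self]
  have h3 : p - o = ∑ k, (bary y k p - bary y k o) • y k := by
    simp only [sub_smul, Finset.sum_sub_distrib]
    rw [sum_bary_smul hy hp, sum_bary_smul hy ho]
  rw [h3, sum_eq_sum_embedding e h1, Fin.sum_univ_castSucc]
  rw [Fin.sum_univ_castSucc] at h2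
  simp only [edgeVector, smul_sub, Finset.sum_sub_distrib, ← Finset.sum_smul, chart]
  rw [eq_neg_of_add_eq_zero_right h2, neg_smul, sub_eq_add_neg, Finset.sum_sub_distrib]

theorem eval_chartPoly (ho : o ∈ affineSpan ℝ (subsimplex y e))
    (hp : p ∈ affineSpan ℝ (subsimplex y e)) (k : ι) :
    eval (chart y e o p) (chartPoly y e o k) = bary y k p := by
  have : Nonempty ι := ⟨k⟩
  obtain ⟨g, a, h⟩ := exists_isDualFrame hy
  have h1 : bary y k p - bary y k o = inner ℝ (g k) (p - o) := by
    rw [h.bary_eq hy hp, h.bary_eq hy ho, inner_sub_right]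
    ring
  rw [sub_eq_sum_chart hy ho hp, inner_sum] at h1
  simp only [real_inner_smul_right, h.inner_edgeVector] at h1
  rw [chartPoly, map_add, eval_C, map_sum]
  simp only [map_mul, eval_C, eval_X]
  rw [sub_eq_iff_eq_add'.1 h1]
  exact congrArg _ (Finset.sum_congr rfl fun i _ => mul_comm _ _)

end Affine

theorem pderiv_chartPoly (i : Fin d) (k : ι) : pderiv i (chartPoly y e o k) =
    C ((if e i.castSucc = k then 1 else 0) - if e (Fin.last d) = k then 1 else 0) := by
  simp only [chartPoly, map_add, pderiv_C, map_sum, Derivation.leibniz, pderiv_X, smul_eq_mul,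
    mul_zero, add_zero, zero_add, Pi.single_apply, mul_ite, mul_one, Finset.sum_ite_eq',
    Finset.mem_univ, if_true]

theorem chartPoly_castSucc (i : Fin d) :
    chartPoly y e o (e i.castSucc) = C (bary y (e i.castSucc) o) + X i := by
  simp [chartPoly, e.injective.eq_iff, (Fin.castSucc_lt_last i).ne']

theorem isBaryPoly_chartPoly (hy : AffineIndependent ℝ y) {s : Finset ι}
    (hs : ∀ k, k ∈ s ↔ k ∈ Set.range e) (ho : o ∈ affineSpan ℝ (subsimplex y e)) :
    IsBaryPoly s (chartPoly y e o) := by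
  have hsum : ∑ k, chartPoly y e o k = 1 := by
    simp only [chartPoly, Finset.sum_add_distrib, ← map_sum, sum_bary hy ho]
    rw [Finset.sum_comm]
    simp [← Finset.sum_mul]
  refine ⟨fun k => ?_, hsum, fun k hk => ?_, fun w hw h0 => ?_, fun i => ?_⟩
  · refine (totalDegree_add _ _).trans (max_le ((totalDegree_C _).le.trans zero_le_one) ?_)
    refine totalDegree_finsetSum_le fun i _ => (totalDegree_mul _ _).trans ?_
    rw [totalDegree_C, totalDegree_X]
  · rw [hs] at hk
    have h1 : ∀ i, e i ≠ k := fun i hi => hk ⟨i, hi⟩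
    simp [chartPoly, h1, bary_eq_zero hy ho hk]
  · refine ⟨chart y e o (∑ k, w k • y k), fun k => ?_⟩
    rw [eval_chartPoly hy ho (mem_affineSpan_subsimplex_iff.2
      ⟨w, hw, fun k hk => h0 k ((hs k).not.2 hk), rfl⟩), bary_eq_of_sum hy hw]
  · refine ⟨fun k => (if k = e i.castSucc then 1 else 0) - bary y (e i.castSucc) o, ?_⟩
    simp only [sub_smul, Finset.sum_sub_distrib, ← Finset.smul_sum, hsum, ite_smul, one_smul,
      zero_smul, Finset.sum_ite_eq', Finset.mem_univ, if_true, chartPoly_castSucc]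
    rw [smul_eq_C_mul]
    ring

/-- The function on the subsimplex with a given polynomial in the coordinates `chart`. -/
noncomputable def chartMap (y : ι → E3) (e : Fin (d + 1) ↪ ι) (o : E3) :
    MvPolynomial (Fin d) ℝ →ₗ[ℝ] (subsimplex y e → ℝ) :=
  LinearMap.pi fun p => (aeval (chart y e o p.1)).toLinearMap

omit [DecidableEq ι] in
theorem chartMap_apply (P : MvPolynomial (Fin d) ℝ) (p : subsimplex y e) :
    chartMap y e o P p = eval (chart y e o p.1) P := by
  rw [← aeval_eq_eval]
  rfl

section Affine

variable (hy : AffineIndependent ℝ y) (ho : o ∈ affineSpan ℝ (subsimplex y e))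

include hy ho

theorem eval_chart_aeval (p : subsimplex y e) (P : MvPolynomial ι ℝ) :
    eval (chart y e o p.1) (aeval (chartPoly y e o) P) = eval (fun k => bary y k p.1) P := by
  rw [← aeval_eq_eval, ← AlgHom.comp_apply, comp_aeval]
  simp only [aeval_eq_eval, eval_chartPoly hy ho (mem_affineSpan_of_mem p.2)]

/-- The image of the subsimplex under the chart contains an open box, on which only the zero
polynomial vanishes. The box gives each of the first `d` weights a value in `(0, 1/(d+1))`, which
leaves a nonnegative last weight. -/
theorem chartMap_injective : Function.Injective (chartMap y e o) := by
  rw [injective_iff_map_eq_zero]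
  intro P hP
  refine funext_set (fun i => Set.Ioo (-bary y (e i.castSucc) o)
    (-bary y (e i.castSucc) o + 1 / (d + 1 : ℝ)))
    (fun i => Set.Ioo_infinite (by simp only [lt_add_iff_pos_right]; positivity)) fun r hr => ?_
  have hB := isBaryPoly_chartPoly hy (s := Finset.univ.map e) (by simp) ho
  have h1 : ∑ k, eval r (chartPoly y e o k) = 1 := by
    rw [← map_sum, hB.sum_eq_one, map_one]
  have h0 : ∀ k, k ∉ Set.range e → eval r (chartPoly y e o k) = 0 := fun k hk => by
    rw [hB.eq_zero k (by simpa using hk), map_zero]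
  have hc : ∀ i : Fin d, eval r (chartPoly y e o (e i.castSucc)) =
      bary y (e i.castSucc) o + r i := fun i => by
    rw [chartPoly_castSucc, map_add, eval_C, eval_X]
  have hr' : ∀ i, 0 < bary y (e i.castSucc) o + r i ∧
      bary y (e i.castSucc) o + r i ≤ 1 / (d + 1 : ℝ) := fun i => by
    have h2 : r i ∈ Set.Ioo _ _ := hr i trivial
    exact ⟨by linarith [h2.1], by linarith [h2.2]⟩
  have hnn : ∀ k, 0 ≤ eval r (chartPoly y e o k) := by
    intro k
    by_cases hk : k ∈ Set.range e
    · obtain ⟨i, rfl⟩ := hk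
      induction i using Fin.lastCases with
      | cast i => exact (hc i).symm ▸ (hr' i).1.le
      | last =>
        rw [sum_eq_sum_embedding e h0, Fin.sum_univ_castSucc] at h1
        simp only [hc] at h1
        have h2 := Finset.sum_le_sum fun i (_ : i ∈ Finset.univ) => (hr' i).2
        rw [Finset.sum_const, Finset.card_univ, Fintype.card_fin, nsmul_eq_mul] at h2
        have h3 : (d : ℝ) * (1 / (d + 1)) ≤ 1 := by
          rw [mul_one_div, div_le_one (by positivity)]
          linarith
        linarith
    · exact (h0 k hk).ge
  have hmem := mem_subsimplex_of_weights (y := y) h1 h0 hnn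
  have hP' := congrFun hP ⟨_, hmem⟩
  rw [chartMap_apply] at hP'
  have hchart : chart y e o (∑ k, eval r (chartPoly y e o k) • y k) = r := by
    funext i
    rw [chart, bary_eq_of_sum hy h1, hc, add_sub_cancel_left]
  rw [hchart] at hP'
  rw [hP', map_zero]
  rfl

theorem exists_chart_coordinate (i : Fin 3) : ∃ Q : MvPolynomial (Fin d) ℝ, Q.totalDegree ≤ 1 ∧
    ∀ p : subsimplex y e, eval (chart y e o p.1) Q = p.1 i := by
  have hB := isBaryPoly_chartPoly hy (s := Finset.univ.map e) (by simp) ho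
  refine ⟨∑ k, C (y k i) * chartPoly y e o k, ?_, fun p => ?_⟩
  · refine totalDegree_finsetSum_le fun k _ => (totalDegree_mul _ _).trans ?_
    rw [totalDegree_C, zero_add]
    exact hB.totalDegree_le k
  · have h1 := congrArg (fun q : E3 => q i)
      (sum_bary_smul hy (mem_affineSpan_of_mem p.2))
    simp only [WithLp.ofLp_sum, WithLp.ofLp_smul, Finset.sum_apply, Pi.smul_apply,
      smul_eq_mul] at h1
    rw [map_sum, ← h1]
    simp only [map_mul, eval_C, eval_chartPoly hy ho (mem_affineSpan_of_mem p.2), mul_comm]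

omit ho in
theorem exists_coordinate_chart (i : Fin d) : ∃ Q : MvPolynomial (Fin 3) ℝ, Q.totalDegree ≤ 1 ∧
    ∀ p : subsimplex y e, eval (fun j => p.1 j) Q = chart y e o p.1 i := by
  have : Nonempty ι := ⟨e 0⟩
  obtain ⟨g, a, h⟩ := exists_isDualFrame hy
  refine ⟨C (a (e i.castSucc) - bary y (e i.castSucc) o) +
    ∑ j, C (g (e i.castSucc) j) * X j, ?_, fun p => ?_⟩
  · refine (totalDegree_add _ _).trans (max_le ((totalDegree_C _).le.trans zero_le_one) ?_)
    refine totalDegree_finsetSum_le fun i _ => (totalDegree_mul _ _).trans ?_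
    rw [totalDegree_C, totalDegree_X]
  · rw [chart, h.bary_eq hy (mem_affineSpan_of_mem p.2), PiLp.inner_apply, map_add, map_sum, eval_C]
    simp only [map_mul, eval_C, eval_X, RCLike.inner_apply, conj_trivial]
    rw [add_comm, sub_eq_add_neg, ← add_assoc, sub_eq_add_neg]
    simp only [mul_comm]

/-- On the subsimplex, Cartesian coordinates and chart coordinates are affine functions of one
another, so substitution preserves the degree bound in both directions. -/
theorem polySpace_subsimplex (n : ℕ) : polySpace n (subsimplex y e) =
    (restrictTotalDegree (Fin d) ℝ n).map (chartMap y e o) := by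
  have hcomp : ∀ {σ τ : Type} (f : σ → MvPolynomial τ ℝ) (r : τ → ℝ) (P : MvPolynomial σ ℝ),
      eval r (aeval f P) = aeval (fun i => eval r (f i)) P := fun f r P => by
    rw [← aeval_eq_eval, ← AlgHom.comp_apply, comp_aeval]
  refine le_antisymm ?_ ?_
  · rintro _ ⟨P, hP, rfl⟩
    choose Q hQ hQp using exists_chart_coordinate hy ho
    refine ⟨aeval Q P, (mem_restrictTotalDegree _ _ _).2
      ((totalDegree_aeval_le hQ P).trans ((mem_restrictTotalDegree _ _ _).1 hP)), ?_⟩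
    funext p
    rw [chartMap_apply, hcomp]
    simp only [hQp]
    rfl
  · rintro _ ⟨P, hP, rfl⟩
    choose Q hQ hQp using exists_coordinate_chart (e := e) (o := o) hy
    refine ⟨aeval Q P, (mem_restrictTotalDegree _ _ _).2
      ((totalDegree_aeval_le hQ P).trans ((mem_restrictTotalDegree _ _ _).1 hP)), ?_⟩
    funext p
    change eval (fun j => p.1 j) (aeval Q P) = aeval (chart y e o p.1) P
    rw [hcomp]
    simp only [hQp]

/-- The `H¹` functions of a face or an edge form a basis. -/
theorem isBasisOf_scalarTrace {s : Finset ι} (hs : ∀ k, k ∈ s ↔ k ∈ Set.range e) {n : ℕ}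
    (hn : 1 ≤ n) {J : Type*} {μ : J → ι → ℕ} (hμ : Function.Injective μ)
    (hrange : ∀ α, (∃ j, μ j = α) ↔ IsBubble n s α) :
    IsBasisOf (fun j => scalarTrace (subsimplex y e)
      ((Sum.elim (fun k => bary y k.1) (fun j => bernstein y (μ j)) : {k // k ∈ s} ⊕ J → E3 → ℝ) j))
      (polySpace n (subsimplex y e)) := by
  rw [polySpace_subsimplex hy ho]
  convert ((isBaryPoly_chartPoly hy hs ho).isBasisOf_bubbles hn hμ hrange).map
    (chartMap_injective hy ho) using 1
  funext j p
  rcases j with k | j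
  · simp only [Sum.elim_inl, scalarTrace, chartMap_apply]
    rw [eval_chartPoly hy ho (mem_affineSpan_of_mem p.2)]
  · simp only [Sum.elim_inr, scalarTrace, chartMap_apply]
    rw [eval_chart_aeval hy ho, bernstein_eq_eval]

end Affine

omit [Fintype ι] [DecidableEq ι] in
theorem vectorSpan_subsimplex :
    vectorSpan ℝ (subsimplex y e) = Submodule.span ℝ (Set.range (edgeVector y e)) := by
  rw [subsimplex, ← direction_affineSpan, affineSpan_convexHull, direction_affineSpan,
    vectorSpan_range_eq_span_range_vsub_right ℝ _ (Fin.last d)]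
  refine le_antisymm (Submodule.span_le.2 ?_) (Submodule.span_le.2 ?_)
  · rintro _ ⟨i, rfl⟩
    induction i using Fin.lastCases with
    | cast i => exact Submodule.subset_span ⟨i, rfl⟩
    | last => simp
  · rintro _ ⟨i, rfl⟩
    exact Submodule.subset_span ⟨i.castSucc, rfl⟩

omit [Fintype ι] [DecidableEq ι] in
theorem edgeVector_mem (i : Fin d) : edgeVector y e i ∈ vectorSpan ℝ (subsimplex y e) := by
  rw [vectorSpan_subsimplex]
  exact Submodule.subset_span ⟨i, rfl⟩

end Chart

/-! ### Identities for the vector product -/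

section CrossProduct

theorem inner_eq_sum_three (u v : E3) : inner ℝ u v = u 0 * v 0 + u 1 * v 1 + u 2 * v 2 := by
  rw [PiLp.inner_apply, Fin.sum_univ_three]
  simp only [RCLike.inner_apply, conj_trivial]
  ring

theorem cross_apply_zero (u v : E3) : cross u v 0 = u 1 * v 2 - u 2 * v 1 := rfl

theorem cross_apply_one (u v : E3) : cross u v 1 = u 2 * v 0 - u 0 * v 2 := rfl

theorem cross_apply_two (u v : E3) : cross u v 2 = u 0 * v 1 - u 1 * v 0 := rfl

theorem inner_cross_self (u v : E3) : inner ℝ (cross u v) v = (0 : ℝ) := by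
  simp only [inner_eq_sum_three, cross_apply_zero, cross_apply_one, cross_apply_two]
  ring

/-- The Binet-Cauchy formula in the plane with unit normal `ν`. -/
theorem inner_cross_mul_inner_cross {ν u v : E3} (hν : ‖ν‖ = 1) (hu : inner ℝ ν u = (0 : ℝ))
    (hv : inner ℝ ν v = (0 : ℝ)) (a b : E3) :
    (inner ℝ (cross a b) ν : ℝ) * inner ℝ (cross u v) ν =
      inner ℝ a u * inner ℝ b v - inner ℝ a v * inner ℝ b u := by
  have h1 : inner ℝ ν ν = (1 : ℝ) := by rw [real_inner_self_eq_norm_sq, hν, one_pow]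
  have key : (inner ℝ (cross a b) ν : ℝ) * inner ℝ (cross u v) ν =
      inner ℝ ν ν * (inner ℝ a u * inner ℝ b v - inner ℝ a v * inner ℝ b u) -
      inner ℝ ν u * (inner ℝ a ν * inner ℝ b v - inner ℝ a v * inner ℝ b ν) +
      inner ℝ ν v * (inner ℝ a ν * inner ℝ b u - inner ℝ a u * inner ℝ b ν) := by
    simp only [inner_eq_sum_three, cross_apply_zero, cross_apply_one, cross_apply_two]
    ring
  rw [key, h1, hu, hv]
  ring

/-- Cramer's rule: the hypothesis `h` says that `u`, `v`, `ν` have nonzero determinant. -/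
theorem eq_of_inner_eq {ν u v z w : E3} (h : inner ℝ (cross u v) ν ≠ (0 : ℝ))
    (hu : inner ℝ z u = (inner ℝ w u : ℝ)) (hv : inner ℝ z v = (inner ℝ w v : ℝ))
    (hν : inner ℝ z ν = (inner ℝ w ν : ℝ)) : z = w := by
  simp only [inner_eq_sum_three, cross_apply_zero, cross_apply_one, cross_apply_two] at *
  ext i
  refine mul_left_cancel₀ h ?_
  fin_cases i
  · simp only [Fin.zero_eta]
    linear_combination (v 1 * ν 2 - v 2 * ν 1) * hu + (ν 1 * u 2 - ν 2 * u 1) * hv +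
      (u 1 * v 2 - u 2 * v 1) * hν
  · simp only [Fin.mk_one]
    linear_combination (v 2 * ν 0 - v 0 * ν 2) * hu + (ν 2 * u 0 - ν 0 * u 2) * hv +
      (u 2 * v 0 - u 0 * v 2) * hν
  · simp only [Fin.reduceFinMk]
    linear_combination (v 0 * ν 1 - v 1 * ν 0) * hu + (ν 0 * u 1 - ν 1 * u 0) * hv +
      (u 0 * v 1 - u 1 * v 0) * hν

theorem inner_cross_right_self (u v : E3) : inner ℝ (cross u v) u = (0 : ℝ) := by
  simp only [inner_eq_sum_three, cross_apply_zero, cross_apply_one, cross_apply_two]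
  ring

theorem inner_cross_cyclic (u v w : E3) :
    inner ℝ (cross u v) w = (inner ℝ (cross w u) v : ℝ) := by
  simp only [inner_eq_sum_three, cross_apply_zero, cross_apply_one, cross_apply_two]
  ring

theorem inner_cross_swap (u v w : E3) :
    inner ℝ (cross u v) w = -(inner ℝ (cross v u) w : ℝ) := by
  simp only [inner_eq_sum_three, cross_apply_zero, cross_apply_one, cross_apply_two]
  ring

theorem cross_add_left (u v w : E3) : cross (u + v) w = cross u w + cross v w := by
  ext i
  fin_cases i <;> simp [cross] <;> ring

theorem cross_smul_left (c : ℝ) (u w : E3) : cross (c • u) w = c • cross u w := by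
  ext i
  fin_cases i <;> simp [cross] <;> ring

end CrossProduct

/-! ### Tangential fields in the coordinates of the chart -/

section TangentMap

open MvPolynomial

variable {ι : Type*} [Fintype ι] [DecidableEq ι] {d : ℕ} {y : ι → E3} {e : Fin (d + 1) ↪ ι}
  {o : E3} {g : ι → E3} {a : ι → ℝ}

theorem inner_starProjection {K : Submodule ℝ E3} {u : E3} (hu : u ∈ K) (v : E3) :
    inner ℝ (K.starProjection v) u = (inner ℝ v u : ℝ) := by
  have := K.starProjection_inner_eq_zero v u hu
  rw [inner_sub_left, sub_eq_zero] at this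
  exact this.symm

omit [Fintype ι] [DecidableEq ι] in
theorem eq_of_inner_edgeVector {z w : E3} (hz : z ∈ vectorSpan ℝ (subsimplex y e))
    (hw : w ∈ vectorSpan ℝ (subsimplex y e))
    (h : ∀ i, inner ℝ z (edgeVector y e i) = (inner ℝ w (edgeVector y e i) : ℝ)) : z = w := by
  have hK : ∀ u ∈ vectorSpan ℝ (subsimplex y e), inner ℝ (z - w) u = (0 : ℝ) := by
    intro u hu
    rw [vectorSpan_subsimplex] at hu
    induction hu using Submodule.span_induction with
    | mem u hu =>
      obtain ⟨i, rfl⟩ := hu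
      rw [inner_sub_left, h i, sub_self]
    | zero => exact inner_zero_right _
    | add u v _ _ hu hv => rw [inner_add_right, hu, hv, add_zero]
    | smul c u _ hu => rw [real_inner_smul_right, hu, mul_zero]
  exact sub_eq_zero.1 (inner_self_eq_zero.1 (hK _ (sub_mem hz hw)))

/-- The tangential field with given components in the coordinates `chart`. -/
noncomputable def tangentMap (y : ι → E3) (e : Fin (d + 1) ↪ ι) (o : E3) (g : ι → E3) :
    (Fin d → MvPolynomial (Fin d) ℝ) →ₗ[ℝ] (subsimplex y e → E3) :=
  ∑ i, LinearMap.pi fun p => (LinearMap.proj p ∘ₗ chartMap y e o ∘ₗ LinearMap.proj i).smulRight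
    ((vectorSpan ℝ (subsimplex y e)).starProjection (g (e i.castSucc)))

omit [DecidableEq ι] in
theorem tangentMap_apply (v : Fin d → MvPolynomial (Fin d) ℝ) (p : subsimplex y e) :
    tangentMap y e o g v p = ∑ i, eval (chart y e o p.1) (v i) •
      (vectorSpan ℝ (subsimplex y e)).starProjection (g (e i.castSucc)) := by
  rw [tangentMap, LinearMap.sum_apply, Finset.sum_apply]
  simp [chartMap_apply]

omit [DecidableEq ι] in
theorem tangentMap_mem (v : Fin d → MvPolynomial (Fin d) ℝ) (p : subsimplex y e) :
    tangentMap y e o g v p ∈ vectorSpan ℝ (subsimplex y e) := by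
  rw [tangentMap_apply]
  exact Submodule.sum_mem _ fun i _ =>
    Submodule.smul_mem _ _ (Submodule.starProjection_apply_mem _ _)

/-- The projected gradients are dual to the edge vectors, so the components of a tangential field
are its inner products with these vectors. -/
theorem IsDualFrame.inner_tangentMap (hg : IsDualFrame y g a)
    (v : Fin d → MvPolynomial (Fin d) ℝ) (p : subsimplex y e) (i : Fin d) :
    inner ℝ (tangentMap y e o g v p) (edgeVector y e i) = eval (chart y e o p.1) (v i) := by
  rw [tangentMap_apply, sum_inner]
  simp only [real_inner_smul_left, inner_starProjection (edgeVector_mem i), hg.inner_edgeVector,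
    e.injective.eq_iff, Fin.castSucc_inj, (Fin.castSucc_lt_last _).ne', if_false, sub_zero,
    mul_ite, mul_one, mul_zero, Finset.sum_ite_eq, Finset.mem_univ, if_true]

/-- The field `∑ j, P j (λ) ∇λ_j`. -/
noncomputable def formField (y : ι → E3) (g : ι → E3) (P : ι → MvPolynomial ι ℝ) (p : E3) : E3 :=
  ∑ j, eval (fun k => bary y k p) (P j) • g j

variable (hy : AffineIndependent ℝ y) (ho : o ∈ affineSpan ℝ (subsimplex y e))
  (hg : IsDualFrame y g a)

include hy ho hg

theorem tangentMap_injective : Function.Injective (tangentMap y e o g) := by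
  rw [injective_iff_map_eq_zero]
  intro v hv
  funext i
  refine (injective_iff_map_eq_zero _).1 (chartMap_injective hy ho) _ (funext fun p => ?_)
  rw [chartMap_apply, ← hg.inner_tangentMap, hv]
  exact inner_zero_left _

/-- Tangential fields are determined by their inner products with the edge vectors, and `⟪g k,
edgeVector i⟫` is the derivative of `chartPoly k` in the `i`-th coordinate. -/
theorem tangentialTrace_formField (P : ι → MvPolynomial ι ℝ) :
    tangentialTrace (subsimplex y e) (formField y g P) =
      tangentMap y e o g (pullForm (chartPoly y e o) P) := by
  funext p
  refine eq_of_inner_edgeVector (Submodule.starProjection_apply_mem _ _) (tangentMap_mem _ _)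
    fun i => ?_
  rw [hg.inner_tangentMap]
  change inner ℝ ((vectorSpan ℝ (subsimplex y e)).starProjection _) _ = _
  rw [inner_starProjection (edgeVector_mem i), formField, sum_inner, pullForm, map_sum]
  refine Finset.sum_congr rfl fun k _ => ?_
  rw [map_mul, eval_chart_aeval hy ho, pderiv_chartPoly, eval_C, real_inner_smul_left,
    hg.inner_edgeVector]

theorem tangentPolySpace_subsimplex (n : ℕ) : tangentPolySpace n (subsimplex y e) =
    (Submodule.pi Set.univ fun _ : Fin d => restrictTotalDegree (Fin d) ℝ n).map
      (tangentMap y e o g) := by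
  refine le_antisymm ?_ ?_
  · rintro v ⟨hv, hvn⟩
    rw [polySpace_subsimplex hy ho] at hvn
    choose Q hQ hQv using hvn
    refine ⟨fun i => ∑ j, edgeVector y e i j • Q j, ?_, ?_⟩
    · exact fun i _ => Submodule.sum_mem _ fun j _ => Submodule.smul_mem _ _ (hQ j)
    · funext p
      refine eq_of_inner_edgeVector (tangentMap_mem _ _) (hv p) fun i => ?_
      rw [hg.inner_tangentMap, PiLp.inner_apply, map_sum]
      refine Finset.sum_congr rfl fun j _ => ?_
      rw [smul_eval, ← chartMap_apply, hQv]
      rfl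
  · rintro _ ⟨v, hv, rfl⟩
    refine ⟨fun p => tangentMap_mem _ _, fun j => ?_⟩
    have h1 : (fun p => tangentMap y e o g v p j) = ∑ i,
        ((vectorSpan ℝ (subsimplex y e)).starProjection (g (e i.castSucc))) j •
          chartMap y e o (v i) := by
      funext p
      rw [tangentMap_apply, Finset.sum_apply]
      simp [chartMap_apply, mul_comm]
    rw [h1, polySpace_subsimplex hy ho]
    exact Submodule.sum_mem _ fun i _ => Submodule.smul_mem _ _
      (Submodule.mem_map_of_mem (hv i trivial))

end TangentMap

/-! ### The area factor and the rotated homogeneous fields on a face -/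

section Face

open MvPolynomial

variable {ι : Type*} [Fintype ι] [DecidableEq ι] {y : ι → E3} {e : Fin 3 ↪ ι}
  {o ν : E3} {g : ι → E3} {a : ι → ℝ}

theorem isTrianglePoly_chartPoly (hy : AffineIndependent ℝ y)
    (ho : o ∈ affineSpan ℝ (subsimplex y e)) :
    IsTrianglePoly (e 0) (e 1) (e 2) (chartPoly y e o) := by
  refine ⟨isBaryPoly_chartPoly hy (fun k => ?_) ho, ?_, ?_, ?_, ?_⟩
  · simp [Fin.exists_fin_succ, eq_comm]
  · exact e.injective.ne (by decide)
  · exact e.injective.ne (by decide)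
  · exact e.injective.ne (by decide)
  · have h10 : e 1 ≠ e 0 := e.injective.ne (by decide)
    have h20 : e 2 ≠ e 0 := e.injective.ne (by decide)
    have h21 : e 2 ≠ e 1 := e.injective.ne (by decide)
    simp only [wedge, pderiv_chartPoly]
    simp [h10, h20, h21, h10.symm, Fin.last]

/-- The area factor of the edge vectors of a face. -/
noncomputable def areaFactor (y : ι → E3) (e : Fin 3 ↪ ι) (ν : E3) : ℝ :=
  inner ℝ (cross (edgeVector y e 0) (edgeVector y e 1)) ν

variable (hν : ‖ν‖ = 1) (hνF : ∀ w ∈ vectorSpan ℝ (subsimplex y e), inner ℝ ν w = (0 : ℝ))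

include hν hνF

omit [Fintype ι] [DecidableEq ι] in
theorem inner_cross_mul_areaFactor (u v : E3) :
    (inner ℝ (cross u v) ν : ℝ) * areaFactor y e ν =
      inner ℝ u (edgeVector y e 0) * inner ℝ v (edgeVector y e 1) -
        inner ℝ u (edgeVector y e 1) * inner ℝ v (edgeVector y e 0) :=
  inner_cross_mul_inner_cross hν (hνF _ (edgeVector_mem 0)) (hνF _ (edgeVector_mem 1)) u v

omit [Fintype ι] in
-- Tested with the gradients dual to the two edge vectors, the Binet-Cauchy formula has right-hand
-- side one.
theorem IsDualFrame.areaFactor_ne_zero (hg : IsDualFrame y g a) : areaFactor y e ν ≠ 0 := by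
  have h := inner_cross_mul_areaFactor hν hνF (g (e 0)) (g (e 1))
  have h10 : e 1 ≠ e 0 := e.injective.ne (by decide)
  have h20 : e 2 ≠ e 0 := e.injective.ne (by decide)
  have h21 : e 2 ≠ e 1 := e.injective.ne (by decide)
  simp only [hg.inner_edgeVector] at h
  intro h0
  simp [h0, h10, h20, h21, h10.symm, Fin.last] at h

/-- The chart has the same origin `o`, so it is linear in `p - o` and homogeneity is preserved both
ways. -/
theorem rotHomogSpace_subsimplex (hy : AffineIndependent ℝ y)
    (ho : o ∈ affineSpan ℝ (subsimplex y e)) (hg : IsDualFrame y g a) (n : ℕ) :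
    rotHomogSpace n (subsimplex y e) o ν = (rotFields n).map (tangentMap y e o g) := by
  have hA := hg.areaFactor_ne_zero hν hνF (y := y) (e := e)
  -- The inner products of `(p - o) × ν` with the two edge vectors are the area factor times `X 1`
  -- and `-X 0`.
  have key : ∀ (q : MvPolynomial (Fin 2) ℝ) (p : subsimplex y e),
      eval (chart y e o p.1) q • cross (p.1 - o) ν =
        areaFactor y e ν • tangentMap y e o g (rotField q) p := by
    intro q p
    have hpo := sub_eq_sum_chart hy ho (mem_affineSpan_of_mem p.2)
    rw [Fin.sum_univ_two] at hpo
    have c1 : inner ℝ (cross (edgeVector y e 1) ν) (edgeVector y e 0) = areaFactor y e ν := by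
      rw [inner_cross_cyclic, areaFactor]
    have c2 : inner ℝ (cross (edgeVector y e 0) ν) (edgeVector y e 1) = -areaFactor y e ν := by
      rw [inner_cross_cyclic, inner_cross_swap, areaFactor]
    refine eq_of_inner_eq (ν := ν) (u := edgeVector y e 0) (v := edgeVector y e 1) hA ?_ ?_ ?_
    · rw [real_inner_smul_left, real_inner_smul_left, hg.inner_tangentMap, hpo, cross_add_left,
        cross_smul_left, cross_smul_left, inner_add_left, real_inner_smul_left,
        real_inner_smul_left, inner_cross_right_self, c1, rotField_apply, Matrix.cons_val_zero,
        map_mul, eval_X]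
      ring
    · rw [real_inner_smul_left, real_inner_smul_left, hg.inner_tangentMap, hpo, cross_add_left,
        cross_smul_left, cross_smul_left, inner_add_left, real_inner_smul_left,
        real_inner_smul_left, inner_cross_right_self, c2, rotField_apply, Matrix.cons_val_one,
        Matrix.cons_val_fin_one, map_neg, map_mul, eval_X]
      ring
    · rw [real_inner_smul_left, real_inner_smul_left, inner_cross_self,
        real_inner_comm, hνF _ (tangentMap_mem _ _), mul_zero, mul_zero]
  have hcomp : ∀ {σ τ : Type} (f : σ → MvPolynomial τ ℝ) (r : τ → ℝ) (P : MvPolynomial σ ℝ),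
      eval r (aeval f P) = aeval (fun i => eval r (f i)) P := fun f r P => by
    rw [← aeval_eq_eval, ← AlgHom.comp_apply, comp_aeval]
  refine le_antisymm ?_ ?_
  · rintro _ ⟨q, hq, rfl⟩
    have hQ : (aeval (fun i : Fin 3 => (C (edgeVector y e 0 i) * X 0 +
        C (edgeVector y e 1 i) * X 1 : MvPolynomial (Fin 2) ℝ)) q).IsHomogeneous n := by
      have := IsHomogeneous.aeval hq (fun i : Fin 3 => (C (edgeVector y e 0 i) * X 0 +
        C (edgeVector y e 1 i) * X 1 : MvPolynomial (Fin 2) ℝ)) (n := 1)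
        (fun i => (isHomogeneous_C_mul_X _ _).add (isHomogeneous_C_mul_X _ _))
      rwa [one_mul] at this
    refine ⟨areaFactor y e ν • rotField _, Submodule.smul_mem _ _ ⟨_, hQ, rfl⟩, ?_⟩
    funext p
    rw [map_smul, Pi.smul_apply, ← key, hcomp]
    have hpo := sub_eq_sum_chart hy ho (mem_affineSpan_of_mem p.2)
    rw [Fin.sum_univ_two] at hpo
    have h1 : (fun i : Fin 3 => eval (chart y e o p.1) (C (edgeVector y e 0 i) * X 0 +
        C (edgeVector y e 1 i) * X 1 : MvPolynomial (Fin 2) ℝ)) = fun i => (p.1 - o) i := by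
      funext i
      rw [hpo]
      simp [mul_comm]
    rw [h1]
    rfl
  · rintro _ ⟨_, ⟨q, hq, rfl⟩, rfl⟩
    have hQ : (aeval (fun i : Fin 2 => (∑ j, C (g (e i.castSucc) j) * X j :
        MvPolynomial (Fin 3) ℝ)) q).IsHomogeneous n := by
      have := IsHomogeneous.aeval hq (fun i : Fin 2 => (∑ j, C (g (e i.castSucc) j) * X j :
        MvPolynomial (Fin 3) ℝ)) (n := 1)
        (fun i => IsHomogeneous.sum _ _ _ fun j _ => isHomogeneous_C_mul_X _ _)
      rwa [one_mul] at this
    have h2 : tangentMap y e o g (rotField q) = (areaFactor y e ν)⁻¹ • fun p : subsimplex y e =>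
        eval (chart y e o p.1) q • cross (p.1 - o) ν := by
      funext p
      rw [Pi.smul_apply, key, smul_smul, inv_mul_cancel₀ hA, one_smul]
    rw [h2]
    refine Submodule.smul_mem _ _ ⟨_, hQ, ?_⟩
    funext p
    have h1 : (fun i : Fin 2 => eval (fun j => (p.1 - o) j)
        (∑ j, C (g (e i.castSucc) j) * X j : MvPolynomial (Fin 3) ℝ)) = chart y e o p.1 := by
      funext i
      rw [chart, hg.bary_eq hy (mem_affineSpan_of_mem p.2), hg.bary_eq hy ho,
        add_sub_add_right_eq_sub, ← inner_sub_right, PiLp.inner_apply, map_sum]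
      simp [mul_comm]
    change eval (fun j => (p.1 - o) j) _ • cross (p.1 - o) ν = _
    rw [hcomp, h1]
    rfl

end Face

/-! ### Linearity of the fields given by forms -/

section Fields

open MvPolynomial

variable {ι : Type*} [Fintype ι] [DecidableEq ι] {y : ι → E3} {g : ι → E3}

omit [DecidableEq ι] in
theorem formField_add (P Q : ι → MvPolynomial ι ℝ) :
    formField y g (P + Q) = formField y g P + formField y g Q := by
  funext p
  simp only [formField, Pi.add_apply, map_add, add_smul, Finset.sum_add_distrib]

omit [DecidableEq ι] in
theorem formField_smul (f : MvPolynomial ι ℝ) (P : ι → MvPolynomial ι ℝ) (p : E3) :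
    formField y g (f • P) p = eval (fun k => bary y k p) f • formField y g P p := by
  simp only [formField, Pi.smul_apply, smul_eq_mul, map_mul, mul_smul, Finset.smul_sum]

omit [DecidableEq ι] in
theorem formField_smul_real (r : ℝ) (P : ι → MvPolynomial ι ℝ) :
    formField y g (r • P) = r • formField y g P := by
  funext p
  simp only [formField, Pi.smul_apply, smul_eval, mul_smul, Finset.smul_sum]

theorem formField_edgeForm (j k : ι) (p : E3) :
    formField y g (edgeForm j k) p = bary y j p • g k - bary y k p • g j := by
  have h : ∀ m, eval (fun k => bary y k p) (edgeForm j k m) • g m =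
      (if m = k then bary y j p • g k else 0) - if m = j then bary y k p • g j else 0 := by
    intro m
    simp only [edgeForm, Pi.sub_apply, Pi.single_apply, map_sub, sub_smul]
    split_ifs with h1 h2 <;> simp_all
  simp only [formField, h, Finset.sum_sub_distrib, Finset.sum_ite_eq', Finset.mem_univ, if_true]

omit [DecidableEq ι] in
theorem pullForm_smul {d : ℕ} (l : ι → MvPolynomial (Fin d) ℝ) (r : ℝ) (P : ι → MvPolynomial ι ℝ) :
    pullForm l (r • P) = r • pullForm l P := by
  funext i
  simp only [pullForm, Pi.smul_apply, map_smul, Finset.smul_sum, smul_mul_assoc]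

end Fields

/-! ### Gradients, curls and face elements of the tetrahedron -/

section Tetrahedron

open MvPolynomial

variable {x : Fin 4 → E3} {g : Fin 4 → E3} {a : Fin 4 → ℝ}

/-- The vertices of a face of the tetrahedron. -/
def faceEmb (σ : Equiv.Perm (Fin 4)) : Fin 3 ↪ Fin 4 :=
  Fin.castSuccEmb.trans σ.toEmbedding

theorem face_eq_subsimplex (x : Fin 4 → E3) (σ : Equiv.Perm (Fin 4)) :
    face x σ = subsimplex x (faceEmb σ) := by
  rw [face, subsimplex]
  congr 1
  ext p
  simp only [Set.mem_insert_iff, Set.mem_singleton_iff, Set.mem_range, Fin.exists_fin_succ,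
    IsEmpty.exists_iff, or_false, eq_comm (a := p)]
  rfl

theorem mem_faceVertices_iff (σ : Equiv.Perm (Fin 4)) (k : Fin 4) :
    k ∈ faceVertices σ ↔ k ∈ Set.range (faceEmb σ) := by
  simp only [faceVertices, Finset.mem_insert, Finset.mem_singleton, Set.mem_range,
    Fin.exists_fin_succ, IsEmpty.exists_iff, or_false, eq_comm (a := k)]
  rfl

theorem card_faceVertices (σ : Equiv.Perm (Fin 4)) : (faceVertices σ).card = 3 :=
  Finset.card_eq_three.2 ⟨σ 0, σ 1, σ 2, σ.injective.ne (by decide), σ.injective.ne (by decide),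
    σ.injective.ne (by decide), rfl⟩

variable (hx : AffineIndependent ℝ x) (hg : IsDualFrame x g a)

include hx hg

/-- Four affinely independent points span the whole space, so the affine formula holds everywhere
and can be differentiated. -/
theorem bary_tetrahedron (k : Fin 4) : bary x k = fun p => inner ℝ (g k) p + a k := by
  funext p
  refine hg.bary_eq hx (e := Function.Embedding.refl (Fin 4)) ?_ k
  have h1 : affineSpan ℝ (Set.range x) = ⊤ := by
    rw [hx.affineSpan_eq_top_iff_card_eq_finrank_add_one]
    simp
  rw [subsimplex, affineSpan_convexHull]
  change p ∈ affineSpan ℝ (Set.range x)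
  rw [h1]
  exact AffineSubspace.mem_top ℝ E3 p

theorem hasFDerivAt_bary (k : Fin 4) (p : E3) :
    HasFDerivAt (bary x k) (innerSL ℝ (g k)) p := by
  rw [bary_tetrahedron hx hg]
  exact (innerSL ℝ (g k)).hasFDerivAt.add_const (a k)

theorem gradient_eval (P : MvPolynomial (Fin 4) ℝ) (p : E3) :
    gradient (fun q => eval (fun k => bary x k q) P) p = formField x g (gradForm P) p := by
  refine HasGradientAt.gradient (hasGradientAt_iff_hasFDerivAt.2 ?_)
  refine (hasFDerivAt_eval (fun k => hasFDerivAt_bary hx hg k p) P).congr_fderiv ?_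
  ext v
  simp only [formField, gradForm, map_sum, map_smul]
  simp

theorem gradient_bary (k : Fin 4) (p : E3) : gradient (bary x k) p = g k := by
  have := gradient_eval hx hg (X k) p
  simp only [eval_X] at this
  rw [this, formField, Finset.sum_eq_single k]
  · simp [gradForm]
  · intro j _ hj
    simp [gradForm, pderiv_X_of_ne hj.symm]
  · simp

theorem edgeElement_eq (i j : Fin 4) : edgeElement x i j = formField x g (edgeForm i j) := by
  funext p
  rw [edgeElement, formField_edgeForm, gradient_bary hx hg, gradient_bary hx hg]

theorem gradient_bernstein (α : Fin 4 → ℕ) :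
    gradient (bernstein x α) = formField x g (gradForm (bernsteinPoly α)) := by
  funext p
  rw [← gradient_eval hx hg]
  congr 1
  funext q
  exact bernstein_eq_eval x α q

theorem faceBubble_eq (σ : Equiv.Perm (Fin 4)) (n : ℕ) (α : Fin 4 → ℕ) :
    faceBubble x σ n α = formField x g (bubbleForm (σ 0) (σ 1) (σ 2) n α) := by
  funext p
  rw [bubbleForm, formField_smul, formField_add, formField_add, formField_smul_real,
    formField_smul_real, formField_smul_real, smul_eval, ← bernstein_eq_eval, faceBubble,
    edgeElement_eq hx hg, edgeElement_eq hx hg, edgeElement_eq hx hg]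
  rfl

theorem fderiv_formField (P : Fin 4 → MvPolynomial (Fin 4) ℝ) (p v : E3) :
    fderiv ℝ (formField x g P) p v =
      ∑ k, (∑ m, eval (fun k => bary x k p) (pderiv m (P k)) * inner ℝ (g m) v) • g k := by
  have h := HasFDerivAt.fun_sum (u := Finset.univ) fun k _ =>
    (hasFDerivAt_eval (fun m => hasFDerivAt_bary hx hg m p) (P k)).smul_const (g k)
  have h2 : fderiv ℝ (formField x g P) p = _ := h.fderiv
  rw [h2]
  simp

/-- The `g k` are constant, so `curl (P_k g_k) = ∇P_k × g_k`. -/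
theorem inner_curl_formField (P : Fin 4 → MvPolynomial (Fin 4) ℝ) (p ν : E3) :
    inner ℝ (curl (formField x g P) p) ν =
      ∑ k, ∑ m, eval (fun k => bary x k p) (pderiv m (P k)) * inner ℝ (cross (g m) (g k)) ν := by
  have h : ∀ i j, fderiv ℝ (formField x g P) p (EuclideanSpace.single j 1) i =
      ∑ k, ∑ m, eval (fun k => bary x k p) (pderiv m (P k)) * (g m j * g k i) := by
    intro i j
    rw [fderiv_formField hx hg]
    simp only [WithLp.ofLp_sum, WithLp.ofLp_smul, Finset.sum_apply, Pi.smul_apply, smul_eq_mul,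
      Finset.sum_mul, EuclideanSpace.inner_single_right, conj_trivial, one_mul, mul_assoc]
  have hc : ∀ i : Fin 3, curl (formField x g P) p i =
      ∑ k, ∑ m, eval (fun k => bary x k p) (pderiv m (P k)) * cross (g m) (g k) i := by
    intro i
    fin_cases i
    · change (fderiv ℝ (formField x g P) p _) 2 - (fderiv ℝ (formField x g P) p _) 1 = _
      simp only [h, ← Finset.sum_sub_distrib, ← mul_sub]
      rfl
    · change (fderiv ℝ (formField x g P) p _) 0 - (fderiv ℝ (formField x g P) p _) 2 = _
      simp only [h, ← Finset.sum_sub_distrib, ← mul_sub]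
      rfl
    · change (fderiv ℝ (formField x g P) p _) 1 - (fderiv ℝ (formField x g P) p _) 0 = _
      simp only [h, ← Finset.sum_sub_distrib, ← mul_sub]
      rfl
  simp only [inner_eq_sum_three, hc, Finset.sum_mul, ← Finset.sum_add_distrib]
  exact Finset.sum_congr rfl fun k _ => Finset.sum_congr rfl fun m _ => by ring

variable {e : Fin 3 ↪ Fin 4} {o ν : E3} (ho : o ∈ affineSpan ℝ (subsimplex x e)) (hν : ‖ν‖ = 1)
  (hνF : ∀ w ∈ vectorSpan ℝ (subsimplex x e), inner ℝ ν w = (0 : ℝ))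

include ho hν hνF

/-- The normal component of the curl depends only on the tangential trace. By Binet-Cauchy, the area
factor times `⟪g m × g k, ν⟫` is the minor of edge components that occurs in `dλ_m ∧ dλ_k` on the
chart. -/
theorem componentTrace_curl_formField (P : Fin 4 → MvPolynomial (Fin 4) ℝ) :
    componentTrace (subsimplex x e) ν (curl (formField x g P)) =
      (areaFactor x e ν)⁻¹ • chartMap x e o (rot (pullForm (chartPoly x e o) P)) := by
  have hA := hg.areaFactor_ne_zero hν hνF (y := x) (e := e)
  funext p
  rw [Pi.smul_apply, smul_eq_mul, eq_inv_mul_iff_mul_eq₀ hA, chartMap_apply]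
  change areaFactor x e ν * inner ℝ (curl (formField x g P) p.1) ν = _
  have hpull : ∀ i j, eval (chart x e o p.1) (pderiv i (pullForm (chartPoly x e o) P j)) =
      ∑ k, ∑ m, eval (fun k => bary x k p.1) (pderiv m (P k)) *
        (inner ℝ (g m) (edgeVector x e i) * inner ℝ (g k) (edgeVector x e j)) := by
    intro i j
    simp only [pullForm, map_sum, Derivation.leibniz, pderiv_chartPoly, pderiv_C, mul_zero,
      zero_add, pderiv_aeval, smul_eq_mul, map_mul, eval_C, eval_chart_aeval hx ho,
      hg.inner_edgeVector, Finset.mul_sum]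
    exact Finset.sum_congr rfl fun k _ => Finset.sum_congr rfl fun m _ => by ring
  rw [inner_curl_formField hx hg, rot_apply, map_sub, hpull, hpull]
  simp only [Finset.mul_sum, ← Finset.sum_sub_distrib]
  refine Finset.sum_congr rfl fun k _ => Finset.sum_congr rfl fun m _ => ?_
  have := inner_cross_mul_areaFactor hν hνF (y := x) (e := e) (g m) (g k)
  linear_combination eval (fun k => bary x k p.1) (pderiv m (P k)) * this

/-- The tangential parts of the three gradients sum to zero, so their cross products have normal
components equal up to the signs built into `faceElement`; the barycentric weights then sum to one.
The sign of `r` depends on the order of the vertices, and only `r ≠ 0` is needed. -/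
theorem componentTrace_faceElement {σ : Equiv.Perm (Fin 4)} (he : e = faceEmb σ) :
    ∃ r : ℝ, r ≠ 0 ∧ componentTrace (subsimplex x e) ν (faceElement x (σ 3)) =
      (areaFactor x e ν)⁻¹ • chartMap x e o (C r) := by
  have hA := hg.areaFactor_ne_zero hν hνF (y := x) (e := e)
  have hcross := fun i j => inner_cross_mul_areaFactor hν hνF (y := x) (e := e) (g i) (g j)
  have hσ3 : ∀ i, σ 3 ≠ e i := by
    intro i
    subst he
    exact σ.injective.ne (Fin.castSucc_lt_last i).ne'
  have hsum : ∀ i, ∑ k : Fin 3, inner ℝ (g ((σ 3).succAbove k)) (edgeVector x e i) = (0 : ℝ) := by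
    intro i
    have h1 : ∑ k, (inner ℝ (g k) (edgeVector x e i) : ℝ) = 0 := by
      simp [hg.inner_edgeVector]
    rw [Fin.sum_univ_succAbove _ (σ 3), hg.inner_edgeVector, if_neg (hσ3 _).symm,
      if_neg (hσ3 _).symm, sub_zero, zero_add] at h1
    exact h1
  have hs0 := hsum 0
  have hs1 := hsum 1
  rw [Fin.sum_univ_three] at hs0 hs1
  refine ⟨inner ℝ (g ((σ 3).succAbove 1)) (edgeVector x e 0) *
    inner ℝ (g ((σ 3).succAbove 2)) (edgeVector x e 1) -
    inner ℝ (g ((σ 3).succAbove 1)) (edgeVector x e 1) *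
    inner ℝ (g ((σ 3).succAbove 2)) (edgeVector x e 0), ?_, ?_⟩
  · intro h0
    obtain ⟨m, hm⟩ := Fin.exists_succAbove_eq (hσ3 0).symm
    obtain ⟨n, hn⟩ := Fin.exists_succAbove_eq (hσ3 1).symm
    have h10 : e 1 ≠ e 0 := e.injective.ne (by decide)
    have h20 : e 2 ≠ e 0 := e.injective.ne (by decide)
    have h21 : e 2 ≠ e 1 := e.injective.ne (by decide)
    have h2 : (inner ℝ (g (e 0)) (edgeVector x e 0) * inner ℝ (g (e 1)) (edgeVector x e 1) -
        inner ℝ (g (e 0)) (edgeVector x e 1) * inner ℝ (g (e 1)) (edgeVector x e 0) : ℝ) = 1 := by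
      simp only [hg.inner_edgeVector]
      simp [h10, h20, h21, h10.symm, Fin.last]
    rw [← hm, ← hn] at h2
    -- If the chosen minor vanished, so would the minor of any two of the three gradients, contrary
    -- to `h2`.
    generalize (σ 3).succAbove = f at *
    fin_cases m <;> fin_cases n <;> simp only [Fin.zero_eta, Fin.mk_one, Fin.reduceFinMk] at h2 <;>
      grind
  · funext p
    have hp1 : ∑ k : Fin 3, bary x ((σ 3).succAbove k) p.1 = 1 := by
      have h1 := sum_bary hx (mem_affineSpan_of_mem p.2)
      rwa [Fin.sum_univ_succAbove _ (σ 3), bary_eq_zero hx (mem_affineSpan_of_mem p.2)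
        (by rintro ⟨i, hi⟩; exact hσ3 i hi.symm), zero_add] at h1
    rw [Fin.sum_univ_three] at hp1
    rw [Pi.smul_apply, smul_eq_mul, eq_inv_mul_iff_mul_eq₀ hA, chartMap_apply, eval_C]
    change areaFactor x e ν * inner ℝ (faceElement x (σ 3) p.1) ν = _
    simp only [faceElement, gradient_bary hx hg, inner_add_left, inner_sub_left,
      real_inner_smul_left]
    have c12 := hcross ((σ 3).succAbove 1) ((σ 3).succAbove 2)
    have c02 := hcross ((σ 3).succAbove 0) ((σ 3).succAbove 2)
    have c01 := hcross ((σ 3).succAbove 0) ((σ 3).succAbove 1)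
    generalize (σ 3).succAbove = f at *
    have e0 := eq_sub_of_add_eq (eq_sub_of_add_eq hs0)
    have e1 := eq_sub_of_add_eq (eq_sub_of_add_eq hs1)
    rw [e0, e1] at c02 c01
    linear_combination bary x (f 0) p.1 * c12 - bary x (f 1) p.1 * c02 + bary x (f 2) p.1 * c01 +
      (inner ℝ (g (f 1)) (edgeVector x e 0) * inner ℝ (g (f 2)) (edgeVector x e 1) -
        inner ℝ (g (f 1)) (edgeVector x e 1) * inner ℝ (g (f 2)) (edgeVector x e 0)) * hp1

end Tetrahedron

/-! ### Bases of the traces on a face -/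

section FaceBases

open MvPolynomial

theorem edgeForm_swap {ι : Type*} [DecidableEq ι] (j k : ι) :
    edgeForm k j = (-1 : ℝ) • edgeForm j k := by
  rw [edgeForm, edgeForm, neg_one_smul, neg_sub]

/-- The pairs of vertices of a face correspond to the opposite vertices. -/
theorem exists_pairIndex_equiv (σ : Equiv.Perm (Fin 4)) :
    ∃ (E : PairIndex (faceVertices σ) ≃ Fin 3) (c : PairIndex (faceVertices σ) → ℝ),
      (∀ q, c q ≠ 0) ∧ ∀ q, edgeForm q.1.1 q.1.2 =
        c q • ![edgeForm (σ 1) (σ 2), edgeForm (σ 2) (σ 0), edgeForm (σ 0) (σ 1)] (E q) := by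
  have hmem : ∀ i : Fin 3, σ i.castSucc ∈ faceVertices σ := fun i =>
    (mem_faceVertices_iff σ _).2 ⟨i, rfl⟩
  have hinj : ∀ i j : Fin 3, σ i.castSucc = σ j.castSucc ↔ i = j := fun i j => by
    rw [σ.injective.eq_iff, Fin.castSucc_inj]
  have hne : ∀ i : Fin 3, σ (i + 2).castSucc ≠ σ (i + 1).castSucc := fun i => by
    rw [Ne, hinj]
    revert i
    decide
  -- The increasing pair of the vertices opposite to `i`, where `i + 1` and `i + 2` are taken modulo
  -- three.
  let f : Fin 3 → PairIndex (faceVertices σ) := fun i =>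
    if h : σ (i + 1).castSucc < σ (i + 2).castSucc
    then ⟨(σ (i + 1).castSucc, σ (i + 2).castSucc), hmem _, hmem _, h⟩
    else ⟨(σ (i + 2).castSucc, σ (i + 1).castSucc), hmem _, hmem _,
      lt_of_le_of_ne (not_lt.1 h) (hne i)⟩
  have hf : ∀ i, ((f i).1 = (σ (i + 1).castSucc, σ (i + 2).castSucc)) ∨
      (f i).1 = (σ (i + 2).castSucc, σ (i + 1).castSucc) := by
    intro i
    by_cases h : σ (i + 1).castSucc < σ (i + 2).castSucc
    · exact Or.inl (by simp only [f, dif_pos h])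
    · exact Or.inr (by simp only [f, dif_neg h])
  have hbij : Function.Bijective f := by
    constructor
    · intro i j hij
      have h1 := hf i
      have h2 := hf j
      rw [hij] at h1
      have h3 : (i + 1 = j + 1 ∧ i + 2 = j + 2) ∨ (i + 1 = j + 2 ∧ i + 2 = j + 1) := by
        rcases h1 with h1 | h1 <;> rcases h2 with h2 | h2 <;> rw [h1] at h2 <;>
          simp only [Prod.mk.injEq, hinj] at h2 <;> tauto
      clear h1 h2 hij
      revert i j
      decide
    · rintro ⟨⟨p, q⟩, hp, hq, hpq⟩
      obtain ⟨i, rfl⟩ := (mem_faceVertices_iff σ p).1 hp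
      obtain ⟨j, rfl⟩ := (mem_faceVertices_iff σ q).1 hq
      change σ i.castSucc < σ j.castSucc at hpq
      have hij : i ≠ j := fun h => hpq.ne (by rw [h])
      obtain ⟨k, hk⟩ : ∃ k : Fin 3, (i = k + 1 ∧ j = k + 2) ∨ (i = k + 2 ∧ j = k + 1) := by
        clear hpq hp hq
        revert i j
        decide
      refine ⟨k, Subtype.ext ?_⟩
      rcases hk with ⟨rfl, rfl⟩ | ⟨rfl, rfl⟩
      · simp only [f, dif_pos hpq]
        rfl
      · simp only [f, dif_neg hpq.not_gt]
        rfl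
  let E := (Equiv.ofBijective f hbij).symm
  have hE : ∀ q, f (E q) = q := fun q => (Equiv.ofBijective f hbij).apply_symm_apply q
  have hform : ∀ i : Fin 3, edgeForm (σ (i + 1).castSucc) (σ (i + 2).castSucc) =
      ![edgeForm (σ 1) (σ 2), edgeForm (σ 2) (σ 0), edgeForm (σ 0) (σ 1)] i := by
    intro i
    fin_cases i <;> rfl
  have hc : ∀ q : PairIndex (faceVertices σ), ∃ r : ℝ, r ≠ 0 ∧ edgeForm q.1.1 q.1.2 =
      r • ![edgeForm (σ 1) (σ 2), edgeForm (σ 2) (σ 0), edgeForm (σ 0) (σ 1)] (E q) := by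
    intro q
    rcases hf (E q) with h | h
    · refine ⟨1, one_ne_zero, ?_⟩
      rw [hE] at h
      rw [one_smul, h, hform]
    · refine ⟨-1, by norm_num, ?_⟩
      rw [hE] at h
      rw [h, ← hform, edgeForm_swap]
  choose c hc0 hcE using hc
  exact ⟨E, c, hc0, hcE⟩

variable {x : Fin 4 → E3} {σ : Equiv.Perm (Fin 4)} {ν o : E3} (hx : AffineIndependent ℝ x)

theorem vertex_mem_affineSpan_face (x : Fin 4 → E3) (σ : Equiv.Perm (Fin 4)) :
    x (σ 0) ∈ affineSpan ℝ (face x σ) :=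
  subset_affineSpan ℝ _ (subset_convexHull ℝ _ (by simp))

include hx

theorem isBasisOf_scalarTrace_face {n : ℕ} (hn : 1 ≤ n) :
    IsBasisOf (fun j => scalarTrace (face x σ) (h1FaceFamily x σ n j))
      (polySpace n (face x σ)) := by
  have ho := vertex_mem_affineSpan_face x σ
  rw [face_eq_subsimplex] at ho ⊢
  exact isBasisOf_scalarTrace hx ho (mem_faceVertices_iff σ) hn
    (edgeFaceIndex_toMulti_injective (card_faceVertices σ))
    (edgeFaceIndex_iff (card_faceVertices σ))

/-- The planar basis uses edge forms in cyclic order and the family uses increasing pairs; the two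
differ by nonzero factors, absorbed by rescaling. -/
theorem isBasisOf_tangentialTrace (ho : o ∈ affineSpan ℝ (subsimplex x (faceEmb σ)))
    {g : Fin 4 → E3} {a : Fin 4 → ℝ} (hg : IsDualFrame x g a) {n m : ℕ}
    (β : ClosedIndex m (faceVertices σ))
    {V : Submodule ℝ (Fin 2 → MvPolynomial (Fin 2) ℝ)}
    (h : IsBasisOf (Sum.elim (fun i : Fin 3 => pullForm (chartPoly x (faceEmb σ) o)
        (![edgeForm (σ 1) (σ 2), edgeForm (σ 2) (σ 0), edgeForm (σ 0) (σ 1)] i))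
      (Sum.elim (fun j : EdgeFaceIndex (n + 1) (faceVertices σ) =>
          planeGrad (aeval (chartPoly x (faceEmb σ) o) (bernsteinPoly j.toMulti)))
        fun α : {α : ClosedIndex m (faceVertices σ) // α ≠ β} =>
          pullForm (chartPoly x (faceEmb σ) o) (bubbleForm (σ 0) (σ 1) (σ 2) m α.1.1))) V) :
    IsBasisOf (fun j => tangentialTrace (subsimplex x (faceEmb σ)) (hcurlFaceFamily x σ n m β j))
      (V.map (tangentMap x (faceEmb σ) o g)) := by
  obtain ⟨E, c, hc, hcE⟩ := exists_pairIndex_equiv σ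
  refine (h.map (tangentMap_injective hx ho hg)).reindex_smul
    (E.sumCongr (Equiv.refl _)) (Sum.elim c fun _ => 1) ?_ ?_
  · rintro (q | j)
    · exact hc q
    · exact one_ne_zero
  · rintro (q | j | α)
    · simp only [hcurlFaceFamily, Sum.elim_inl, Equiv.sumCongr_apply, Sum.map_inl]
      rw [edgeElement_eq hx hg, tangentialTrace_formField hx ho hg, hcE, pullForm_smul, map_smul]
    · have h1 : planeGrad (aeval (chartPoly x (faceEmb σ) o) (bernsteinPoly j.toMulti)) =
          pullForm (chartPoly x (faceEmb σ) o) (gradForm (bernsteinPoly j.toMulti)) :=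
        funext fun i => (pullForm_gradForm _ _ i).symm
      simp only [hcurlFaceFamily, Sum.elim_inl, Sum.elim_inr, Equiv.sumCongr_apply, Sum.map_inr,
        Equiv.refl_apply, one_smul]
      rw [gradient_bernstein hx hg, tangentialTrace_formField hx ho hg, h1]
    · simp only [hcurlFaceFamily, Sum.elim_inr, Equiv.sumCongr_apply, Sum.map_inr,
        Equiv.refl_apply, one_smul]
      rw [faceBubble_eq hx hg, tangentialTrace_formField hx ho hg]

theorem isBasisOf_tangentialTrace_face {n : ℕ} (β : ClosedIndex n (faceVertices σ)) :
    IsBasisOf (fun j => tangentialTrace (face x σ) (hcurlFaceFamily x σ (n + 1) n β j))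
      (tangentPolySpace (n + 1) (face x σ)) := by
  obtain ⟨g, a, hg⟩ := exists_isDualFrame hx
  have ho := vertex_mem_affineSpan_face x σ
  rw [face_eq_subsimplex] at ho ⊢
  rw [tangentPolySpace_subsimplex hx ho hg]
  exact isBasisOf_tangentialTrace hx ho hg β
    ((isTrianglePoly_chartPoly hx ho).isBasisOf_polyFields β
      (edgeFaceIndex_toMulti_injective (card_faceVertices σ))
      (edgeFaceIndex_iff (card_faceVertices σ)))

theorem isBasisOf_tangentialTrace_face_sup (hν : IsOutwardUnitNormal x σ ν) {n : ℕ}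
    (β : ClosedIndex n (faceVertices σ)) (ho : o ∈ affineSpan ℝ (face x σ)) :
    Disjoint (tangentPolySpace n (face x σ)) (rotHomogSpace n (face x σ) o ν) ∧
      IsBasisOf (fun j => tangentialTrace (face x σ) (hcurlFaceFamily x σ n n β j))
        (tangentPolySpace n (face x σ) ⊔ rotHomogSpace n (face x σ) o ν) := by
  obtain ⟨g, a, hg⟩ := exists_isDualFrame hx
  obtain ⟨hν1, hνF, -⟩ := hν
  rw [face_eq_subsimplex] at ho hνF ⊢
  rw [tangentPolySpace_subsimplex hx ho hg, rotHomogSpace_subsimplex hν1 hνF hx ho hg,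
    ← Submodule.map_sup]
  refine ⟨Submodule.disjoint_map (tangentMap_injective hx ho hg) disjoint_polyFields_rotFields, ?_⟩
  exact isBasisOf_tangentialTrace hx ho hg β
    ((isTrianglePoly_chartPoly hx ho).isBasisOf_sup β
      (edgeFaceIndex_toMulti_injective (card_faceVertices σ))
      (edgeFaceIndex_iff (card_faceVertices σ)))

theorem isBasisOf_normalTrace_face (hν : IsOutwardUnitNormal x σ ν) {n : ℕ}
    (β : ClosedIndex n (faceVertices σ)) :
    IsBasisOf (fun j => componentTrace (face x σ) ν (hdivFaceFamily x σ n β j))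
      (polySpace n (face x σ)) := by
  obtain ⟨g, a, hg⟩ := exists_isDualFrame hx
  have ho := vertex_mem_affineSpan_face x σ
  obtain ⟨hν1, hνF, -⟩ := hν
  rw [face_eq_subsimplex] at ho hνF ⊢
  obtain ⟨r, hr, hface⟩ := componentTrace_faceElement hx hg ho hν1 hνF rfl
  rw [polySpace_subsimplex hx ho]
  refine (((isTrianglePoly_chartPoly hx ho).isBasisOf_rot β hr).map
    (chartMap_injective hx ho)).reindex_smul (Equiv.refl _)
    (fun _ => (areaFactor x (faceEmb σ) ν)⁻¹)
    (fun _ => inv_ne_zero (hg.areaFactor_ne_zero hν1 hνF)) ?_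
  rintro (i | α)
  · exact hface
  · simp only [hdivFaceFamily, Sum.elim_inr, Equiv.refl_apply]
    have hb := componentTrace_curl_formField hx hg ho hν1 hνF
      (bubbleForm (σ 0) (σ 1) (σ 2) n α.1.1)
    rw [← faceBubble_eq hx hg] at hb
    exact hb

end FaceBases

/-! ### Bases of the traces on an edge of a triangle -/

section Edge

open MvPolynomial

variable {y : Fin 3 → E3} {τ : Equiv.Perm (Fin 3)} {g : Fin 3 → E3} {a : Fin 3 → ℝ}

/-- The vertices of an edge of the triangle. -/
def edgeEmb (τ : Equiv.Perm (Fin 3)) : Fin 2 ↪ Fin 3 :=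
  Fin.castSuccEmb.trans τ.toEmbedding

theorem edge_eq_subsimplex (y : Fin 3 → E3) (τ : Equiv.Perm (Fin 3)) :
    edge y τ = subsimplex y (edgeEmb τ) := by
  rw [edge, subsimplex]
  congr 1
  ext p
  simp only [Set.mem_insert_iff, Set.mem_singleton_iff, Set.mem_range, Fin.exists_fin_succ,
    IsEmpty.exists_iff, or_false, eq_comm (a := p)]
  rfl

theorem mem_edgeVertices_iff (τ : Equiv.Perm (Fin 3)) (k : Fin 3) :
    k ∈ edgeVertices τ ↔ k ∈ Set.range (edgeEmb τ) := by
  simp only [edgeVertices, Finset.mem_insert, Finset.mem_singleton, Set.mem_range,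
    Fin.exists_fin_succ, IsEmpty.exists_iff, or_false, eq_comm (a := k)]
  rfl

theorem card_edgeVertices (τ : Equiv.Perm (Fin 3)) : (edgeVertices τ).card = 2 :=
  Finset.card_eq_two.2 ⟨τ 0, τ 1, τ.injective.ne (by decide), rfl⟩

theorem edge_subset_triangle (y : Fin 3 → E3) (τ : Equiv.Perm (Fin 3)) :
    edge y τ ⊆ triangle y := by
  refine convexHull_mono ?_
  rintro _ (rfl | rfl)
  · exact ⟨_, rfl⟩
  · exact ⟨_, rfl⟩

theorem edgeTangent_eq (y : Fin 3 → E3) (τ : Equiv.Perm (Fin 3)) :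
    edgeTangent y τ = (-‖y (τ 1) - y (τ 0)‖⁻¹) • edgeVector y (edgeEmb τ) 0 := by
  have : edgeVector y (edgeEmb τ) 0 = -(y (τ 1) - y (τ 0)) := by
    rw [neg_sub]
    rfl
  rw [this, smul_neg, neg_smul, neg_neg, edgeTangent]

theorem edgeVector_mem_triangle (y : Fin 3 → E3) (τ : Equiv.Perm (Fin 3)) :
    edgeVector y (edgeEmb τ) 0 ∈ vectorSpan ℝ (triangle y) :=
  vsub_mem_vectorSpan ℝ (subset_convexHull ℝ _ ⟨_, rfl⟩) (subset_convexHull ℝ _ ⟨_, rfl⟩)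

theorem vertex_mem_affineSpan_edge (y : Fin 3 → E3) (τ : Equiv.Perm (Fin 3)) :
    y (τ 0) ∈ affineSpan ℝ (edge y τ) :=
  subset_affineSpan ℝ _ (subset_convexHull ℝ _ (by simp))

variable (hy : AffineIndependent ℝ y)

include hy

theorem isBasisOf_scalarTrace_edge {n : ℕ} (hn : 1 ≤ n) :
    IsBasisOf (fun j => scalarTrace (edge y τ) (h1EdgeFamily y τ n j))
      (polySpace n (edge y τ)) := by
  have ho := vertex_mem_affineSpan_edge y τ
  rw [edge_eq_subsimplex] at ho ⊢
  exact isBasisOf_scalarTrace hy ho (mem_edgeVertices_iff τ) hn Subtype.val_injective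
    (bubbleIndex_iff (card_edgeVertices τ))

variable (hg : IsDualFrame y g a)

include hg

/-- Tangential displacements stay in the affine hull of the triangle, where `bary` agrees with the
affine extension of the dual frame. -/
theorem inner_surfaceGradient_eval {p u : E3} (hp : p ∈ triangle y)
    (hu : u ∈ vectorSpan ℝ (triangle y)) (P : MvPolynomial (Fin 3) ℝ) :
    inner ℝ (surfaceGradient (triangle y) (fun q => eval (fun k => bary y k q) P) p) u =
      ∑ k, eval (fun k => bary y k p) (pderiv k P) * inner ℝ (g k) u := by
  have hb : ∀ q ∈ affineSpan ℝ (triangle y), ∀ k, bary y k q = inner ℝ (g k) q + a k :=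
    fun q hq k => hg.bary_eq hy (e := Function.Embedding.refl (Fin 3)) hq k
  have hpw : ∀ w : vectorSpan ℝ (triangle y), p + w ∈ affineSpan ℝ (triangle y) := fun w => by
    rw [add_comm]
    refine AffineSubspace.vadd_mem_of_mem_direction ?_ (subset_affineSpan ℝ _ hp)
    rw [direction_affineSpan]
    exact w.2
  have hf : (fun w : vectorSpan ℝ (triangle y) => eval (fun k => bary y k (p + w)) P) =
      fun w : vectorSpan ℝ (triangle y) => eval (fun k => inner ℝ (g k) (p + w) + a k) P := by
    funext w
    simp only [hb _ (hpw w)]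
  have hder : ∀ k, HasFDerivAt
      (fun w : vectorSpan ℝ (triangle y) => (inner ℝ (g k) (p + w) + a k : ℝ))
      ((innerSL ℝ (g k)).comp (vectorSpan ℝ (triangle y)).subtypeL) 0 := fun k => by
    have h1 : HasFDerivAt (fun w : vectorSpan ℝ (triangle y) => p + (w : E3))
        (vectorSpan ℝ (triangle y)).subtypeL 0 :=
      ((vectorSpan ℝ (triangle y)).subtypeL.hasFDerivAt).const_add p
    exact (((innerSL ℝ (g k)).hasFDerivAt).comp _ h1).add_const (a k)
  have hgrad : inner ℝ (gradient
      (fun w : vectorSpan ℝ (triangle y) => eval (fun k => bary y k (p + w)) P) 0)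
      (⟨u, hu⟩ : vectorSpan ℝ (triangle y)) =
      fderiv ℝ (fun w : vectorSpan ℝ (triangle y) => eval (fun k => bary y k (p + w)) P) 0
        ⟨u, hu⟩ := InnerProductSpace.toDual_symm_apply
  refine hgrad.trans ?_
  rw [hf, (hasFDerivAt_eval hder P).fderiv]
  simp [hb p (subset_affineSpan ℝ _ hp)]

theorem inner_surfaceGradient_bary {p u : E3} (hp : p ∈ triangle y)
    (hu : u ∈ vectorSpan ℝ (triangle y)) (k : Fin 3) :
    inner ℝ (surfaceGradient (triangle y) (bary y k) p) u = (inner ℝ (g k) u : ℝ) := by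
  have := inner_surfaceGradient_eval hy hg hp hu (X k)
  simp only [eval_X] at this
  rw [this, Finset.sum_eq_single k]
  · simp
  · intro j _ hj
    simp [pderiv_X_of_ne hj.symm]
  · simp

omit hg in
theorem isBasisOf_tangentialTrace_edge {n : ℕ} :
    IsBasisOf (fun j => componentTrace (edge y τ) (edgeTangent y τ) (hcurlEdgeFamily y τ n j))
      (polySpace n (edge y τ)) := by
  obtain ⟨g, a, hg⟩ := exists_isDualFrame hy
  have ho := vertex_mem_affineSpan_edge y τ
  have hsub := edge_subset_triangle y τ
  rw [edge_eq_subsimplex] at ho hsub ⊢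
  rw [polySpace_subsimplex hy ho]
  have hu := edgeVector_mem_triangle y τ
  have h01 : τ 0 ≠ τ 1 := τ.injective.ne (by decide)
  have hg0 : (inner ℝ (g (τ 0)) (edgeVector y (edgeEmb τ) 0) : ℝ) = 1 := by
    rw [hg.inner_edgeVector]
    exact (congrArg₂ _ (if_pos rfl) (if_neg h01.symm)).trans (sub_zero 1)
  have hg1 : (inner ℝ (g (τ 1)) (edgeVector y (edgeEmb τ) 0) : ℝ) = -1 := by
    rw [hg.inner_edgeVector]
    exact (congrArg₂ _ (if_neg h01) (if_pos rfl)).trans (zero_sub 1)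
  have hnorm : -‖y (τ 1) - y (τ 0)‖⁻¹ ≠ 0 :=
    neg_ne_zero.2 (inv_ne_zero (norm_ne_zero_iff.2 (sub_ne_zero.2 (hy.injective.ne h01.symm))))
  -- The chart direction is `y (τ 0) - y (τ 1)`, along which the edge element has component `-λ_{τ
  -- 0} - λ_{τ 1} = -1`; hence `r = -1` and the negative scaling to the unit tangent.
  refine (((isBaryPoly_chartPoly hy (mem_edgeVertices_iff τ) ho).isBasisOf_pderiv
    (Subtype.val_injective (p := fun α : Fin 3 → ℕ => ∑ i, α i = n + 1 ∧
      ∀ i, 0 < α i ↔ i ∈ edgeVertices τ))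
    (bubbleIndex_iff (card_edgeVertices τ)) (r := -1) (by norm_num)).map
      (chartMap_injective hy ho)).reindex_smul (Equiv.refl _)
      (fun _ => -‖y (τ 1) - y (τ 0)‖⁻¹) (fun _ => hnorm) ?_
  rintro (i | α)
  · funext p
    have h1 : bary y (τ 0) p.1 + bary y (τ 1) p.1 = 1 := by
      have h2 := sum_bary hy (mem_affineSpan_of_mem p.2)
      rw [sum_eq_sum_embedding (edgeEmb τ) fun k hk =>
        bary_eq_zero hy (mem_affineSpan_of_mem p.2) hk, Fin.sum_univ_two] at h2
      exact h2
    simp only [hcurlEdgeFamily, Sum.elim_inl, Equiv.refl_apply, Pi.smul_apply, chartMap_apply,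
      eval_C, smul_eq_mul, componentTrace, triEdgeElement, edgeTangent_eq]
    rw [real_inner_smul_right, inner_sub_left, real_inner_smul_left, real_inner_smul_left,
      inner_surfaceGradient_bary hy hg (hsub p.2) hu, inner_surfaceGradient_bary hy hg (hsub p.2) hu,
      hg0, hg1]
    linear_combination ‖y (τ 1) - y (τ 0)‖⁻¹ * h1
  · funext p
    simp only [hcurlEdgeFamily, Sum.elim_inr, Equiv.refl_apply, Pi.smul_apply, chartMap_apply,
      smul_eq_mul, componentTrace, edgeTangent_eq]
    have hb : bernstein y α.1 = fun q => eval (fun k => bary y k q) (bernsteinPoly α.1) :=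
      funext fun q => bernstein_eq_eval y α.1 q
    rw [real_inner_smul_right, hb, inner_surfaceGradient_eval hy hg (hsub p.2) hu, pderiv_aeval,
      map_sum]
    congr 1
    refine Finset.sum_congr rfl fun k _ => ?_
    rw [map_mul, eval_chart_aeval hy ho, pderiv_chartPoly, eval_C, hg.inner_edgeVector]

end Edge

end BernsteinBezier

theorem theorem2 :
    -- from a tetrahedron to a face
    (∀ (x : Fin 4 → E3), AffineIndependent ℝ x →
      ∀ (σ : Equiv.Perm (Fin 4)) (ν : E3), IsOutwardUnitNormal x σ ν →
        (∀ n : ℕ, 1 ≤ n →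
          IsBasisOf (fun j => scalarTrace (face x σ) (h1FaceFamily x σ n j))
            (polySpace n (face x σ))) ∧
        (∀ (n : ℕ) (β : ClosedIndex n (faceVertices σ)) (o : E3),
          o ∈ affineSpan ℝ (face x σ) →
          Disjoint (tangentPolySpace n (face x σ)) (rotHomogSpace n (face x σ) o ν) ∧
          IsBasisOf (fun j => tangentialTrace (face x σ) (hcurlFaceFamily x σ n n β j))
            (tangentPolySpace n (face x σ) ⊔ rotHomogSpace n (face x σ) o ν)) ∧
        (∀ n : ℕ, 1 ≤ n → ∀ β : ClosedIndex (n - 1) (faceVertices σ),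
          IsBasisOf (fun j => tangentialTrace (face x σ) (hcurlFaceFamily x σ n (n - 1) β j))
            (tangentPolySpace n (face x σ))) ∧
        (∀ (n : ℕ) (β : ClosedIndex n (faceVertices σ)),
          IsBasisOf (fun j => componentTrace (face x σ) ν (hdivFaceFamily x σ n β j))
            (polySpace n (face x σ)))) ∧
    -- from a triangle to an edge
    (∀ (y : Fin 3 → E3), AffineIndependent ℝ y → ∀ τ : Equiv.Perm (Fin 3),
        (∀ n : ℕ, 1 ≤ n →
          IsBasisOf (fun j => scalarTrace (edge y τ) (h1EdgeFamily y τ n j))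
            (polySpace n (edge y τ))) ∧
        (∀ n : ℕ,
          IsBasisOf (fun j => componentTrace (edge y τ) (edgeTangent y τ) (hcurlEdgeFamily y τ n j))
            (polySpace n (edge y τ)))) := by
  refine ⟨fun x hx σ ν hν => ⟨fun n hn => isBasisOf_scalarTrace_face hx hn,
    fun n β o ho => isBasisOf_tangentialTrace_face_sup hx hν β ho, fun n hn β => ?_,
    fun n β => isBasisOf_normalTrace_face hx hν β⟩,
    fun y hy τ => ⟨fun n hn => isBasisOf_scalarTrace_edge hy hn,
      fun n => isBasisOf_tangentialTrace_edge hy⟩⟩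
  obtain ⟨m, rfl⟩ : ∃ m, n = m + 1 := ⟨n - 1, by omega⟩
  exact isBasisOf_tangentialTrace_face hx β
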